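/- Let $d\in\mathbb N$, $0<T<\infty$, and put $V=L^2(\mathbb R^d)$, $H=H^{-1}(\mathbb R^d)$ (the dual of $H^1(\mathbb R^d)$), all functions being real valued. Assume that there are constants $0<\gamma_1<\gamma_2$ and $\gamma_0>0$ such that - $u:(0,T)\times\mathbb R^d\to\mathbb R$ is measurable with $\gamma_1\le u\le\gamma_2$ a.e.; - $a_{ij}\in W^{1,\infty}(\mathbb R^d)$ for $1\le i,j\le d$, and $\sum_{i,j=1}^d a_{ij}(x)\xi_i\xi_j\ge\gamma_0|\xi|^2$ for a.e. $x\in\mathbb R^d$ and all $\xi\in\mathbb R^d$. Let $f\in L^\infty(\mathbb R^d;\mathbb R^d)$ and $\rho_0\in H^{-1}(\mathbb R^d)$. Define, in the sense of distributions on $\mathbb R^d$, $$A_0w=-\sum_{i,j=1}^d D_i(a_{ij}D_jw),\qquad A(t)v=-\frac12\sum_{i,j=1}^d D^2_{ij}\big(u(t,\cdot)a_{ij}v\big)+\operatorname{div}(fv)\qquad(v,w\in L^2(\mathbb R^d)),$$ where $a_{ij}D_jw:=D_j(a_{ij}w)-(D_ja_{ij})w$. Let $V^*=(L^2)^*:=(I+A_0)L^2(\mathbb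 R^d)\subset\mathcal D'(\mathbb R^d)$, with norm $\|(I+A_0)w\|_{V^*}=\|w\|_{L^2}$, be the dual of $V$ with respect to the pivot space $H^{-1}$, the pairing being $\langle (I+A_0)w,v\rangle=\int_{\mathbb R^d}wv\,dx$; thus $L^2\subset H^{-1}\subset(L^2)^*$. Then the Fokker–Planck equation $$\frac{d\rho}{dt}-\frac12\sum_{i,j=1}^dD^2_{ij}(u\,a_{ij}\,\rho)+\operatorname{div}(f\rho)=0\ \text{ in }(0,T)\times\mathbb R^d,\qquad \rho(0)=\rho_0,$$ has exactly one $H^{-1}$-weak solution, i.e. there is exactly one $$\rho\in L^2(0,T;V)\cap C([0,T];H)\quad\text{with}\quad\frac{d\rho}{dt}\in L^2(0,T;V^*)$$ (derivative in the sense of distributions on $(0,T)$) such that $\rho(0)=\rho_0$ and $\frac{d\rho}{dt}(t)+A(t)\rho(t)=0$ in $V^*$ for a.e. $t\in(0,T)$. -/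

import Mathlib

open MeasureTheory Set TopologicalSpace
open scoped Distributions LineDeriv ENNReal

noncomputable section

namespace FokkerPlanck

/-- `ℝᵈ` with the Euclidean norm. -/
abbrev Space (d : ℕ) : Type := EuclideanSpace ℝ (Fin d)

/-- `V = L²(ℝᵈ)` (real valued). -/
abbrev L2 (d : ℕ) : Type := Lp ℝ 2 (volume : Measure (Space d))

/-- Test functions `𝓓(ℝᵈ) = C_c^∞(ℝᵈ)`. -/
abbrev Test (d : ℕ) : Type := TestFunction (⊤ : Opens (Space d)) ℝ ⊤

/-- Distributions `𝓓'(ℝᵈ)`. -/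
abbrev Distr (d : ℕ) : Type := Distribution (⊤ : Opens (Space d)) ℝ ⊤

/-- The regular distribution `φ ↦ ∫ φ g dx` of a locally integrable function `g`. -/
def regular {d : ℕ} (g : Space d → ℝ) : Distr d :=
  (TestFunction.integralAgainstBilinCLM (ContinuousLinearMap.mul ℝ ℝ) volume g :
    Test d →L[ℝ] ℝ)

theorem regular_apply {d : ℕ} {g : Space d → ℝ} (hg : LocallyIntegrable g volume)
    (φ : Test d) : regular g φ = ∫ x, φ x * g x := by
  have h : LocallyIntegrableOn g ((⊤ : Opens (Space d)) : Set (Space d)) volume := by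
    simpa [locallyIntegrableOn_univ] using hg
  exact TestFunction.integralAgainstBilinCLM_eq_integral h

/-- The distributional partial derivative `D_i`. -/
def partialD {d : ℕ} (i : Fin d) (S : Distr d) : Distr d :=
  ∂_{(EuclideanSpace.single i (1 : ℝ) : Space d)} S

theorem regular_add {d : ℕ} (v w : L2 d) :
    regular (⇑(v + w)) = regular (⇑v) + regular (⇑w) := by
  have hl : ∀ z : L2 d, LocallyIntegrable (⇑z) volume :=
    fun z ↦ (Lp.memLp z).locallyIntegrable (by norm_num)
  ext φ
  have hi : ∀ z : L2 d, Integrable (fun x ↦ φ x * z x) volume := fun z ↦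
    (hl z).integrable_smul_left_of_hasCompactSupport φ.continuous φ.hasCompactSupport
  change regular (⇑(v + w)) φ = regular (⇑v) φ + regular (⇑w) φ
  rw [regular_apply (hl _), regular_apply (hl _), regular_apply (hl _),
    ← integral_add (hi v) (hi w)]
  refine integral_congr_ae ?_
  filter_upwards [Lp.coeFn_add v w] with x hx
  rw [hx, Pi.add_apply, mul_add]

theorem regular_smul {d : ℕ} (c : ℝ) (v : L2 d) :
    regular (⇑(c • v)) = c • regular (⇑v) := by
  have hl : ∀ z : L2 d, LocallyIntegrable (⇑z) volume :=
    fun z ↦ (Lp.memLp z).locallyIntegrable (by norm_num)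
  ext φ
  change regular (⇑(c • v)) φ = c • regular (⇑v) φ
  rw [regular_apply (hl _), regular_apply (hl _), smul_eq_mul, ← integral_const_mul]
  refine integral_congr_ae ?_
  filter_upwards [Lp.coeFn_smul c v] with x hx
  rw [hx, Pi.smul_apply, smul_eq_mul]
  ring

/-- The Sobolev space `H¹(ℝᵈ) = {v ∈ L² : ∇v ∈ L²}`; an element is stored as the pair `(v, ∇v)`,
so that the norm is `(‖v‖² + ∑ᵢ ‖D_i v‖²)^{1/2}`. -/
def H1 (d : ℕ) : Submodule ℝ (WithLp 2 (L2 d × PiLp 2 (fun _ : Fin d ↦ L2 d))) where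
  carrier := {p | ∀ i, partialD i (regular (⇑p.fst)) = regular (⇑(p.snd i))}
  add_mem' {p q} hp hq i := by
    simp only [mem_ofPred_eq, partialD] at hp hq ⊢
    simp only [WithLp.add_fst, WithLp.add_snd, PiLp.add_apply, regular_add, ← hp i, ← hq i]
    exact LineDeriv.lineDerivOp_add _ _ _
  zero_mem' i := by
    have h0 : regular (⇑(0 : L2 d)) = 0 := by simpa using regular_smul (0 : ℝ) (0 : L2 d)
    simp only [WithLp.zero_fst, WithLp.zero_snd, PiLp.zero_apply, partialD, h0]
    exact LineDeriv.lineDerivOp_zero _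
  smul_mem' c p hp i := by
    simp only [mem_ofPred_eq, partialD] at hp ⊢
    simp only [WithLp.smul_fst, WithLp.smul_snd, PiLp.smul_apply, regular_smul, ← hp i]
    exact LineDeriv.lineDerivOp_smul _ _ _

/-- `H = H⁻¹(ℝᵈ)`, the dual of `H¹(ℝᵈ)`, with the dual norm. -/
abbrev HNegOne (d : ℕ) : Type := StrongDual ℝ (H1 d)

/-- The embedding `L² ⊂ H⁻¹`, `v ↦ (φ ↦ ∫ v φ dx)`. -/
def toHNegOne {d : ℕ} (v : L2 d) : HNegOne d :=
  (innerSL ℝ v).comp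
    ((WithLp.fstL 2 ℝ (L2 d) (PiLp 2 (fun _ : Fin d ↦ L2 d))).comp (H1 d).subtypeL)

theorem toHNegOne_apply {d : ℕ} (v : L2 d) (p : H1 d) :
    toHNegOne v p = ∫ x, v x * (p : WithLp 2 (L2 d × PiLp 2 (fun _ : Fin d ↦ L2 d))).fst x := by
  change inner ℝ v _ = _
  rw [L2.inner_def]
  refine integral_congr_ae (Filter.Eventually.of_forall fun x ↦ ?_)
  simp [mul_comm]

/-- An element of `W^{1,∞}(ℝᵈ)`: an essentially bounded function together with its weak
gradient, which is essentially bounded. -/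
structure W1Infty (d : ℕ) where
  /-- the function -/
  val : Space d → ℝ
  /-- its weak partial derivatives -/
  grad : Fin d → Space d → ℝ
  memLp_val : MemLp val ∞ volume
  memLp_grad : ∀ k, MemLp (grad k) ∞ volume
  weak_grad : ∀ k, partialD k (regular val) = regular (grad k)

/-- `A₀ w = -∑_{i,j} D_i (a_{ij} D_j w)` in `𝓓'(ℝᵈ)` for `w ∈ L²`, where the product of the
`W^{1,∞}` function `a_{ij}` with the distribution `D_j w` is given by the product rule
`a_{ij} D_j w = D_j (a_{ij} w) - (D_j a_{ij}) w`. -/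
def opA0 {d : ℕ} (a : Fin d → Fin d → W1Infty d) (w : L2 d) : Distr d :=
  -∑ i, ∑ j, partialD i
    (partialD j (regular fun x ↦ (a i j).val x * w x) -
      regular fun x ↦ (a i j).grad j x * w x)

/-- The element `(I + A₀) w` of `V* = (I + A₀) V ⊂ 𝓓'(ℝᵈ)`, for `w ∈ V = L²`. Here `V*` is the dual
of `V` with respect to the pivot space `H⁻¹`: the element `(I + A₀) w` acts on `v ∈ V` by
`∫ w v dx`, so that its norm in `V*` is `‖w‖_{L²}`. -/
def idAddA0 {d : ℕ} (a : Fin d → Fin d → W1Infty d) (w : L2 d) : Distr d :=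
  regular (⇑w) + opA0 a w

/-- `A(t) v = -½ ∑_{i,j} D²_{ij} (u(t,·) a_{ij} v) + div (f v)` in `𝓓'(ℝᵈ)`, for `v ∈ L²`; the
argument `ut` is `u(t,·)`. -/
def opA {d : ℕ} (a : Fin d → Fin d → W1Infty d) (f : Space d → Space d) (ut : Space d → ℝ)
    (v : L2 d) : Distr d :=
  (-(1 / 2 : ℝ)) • (∑ i, ∑ j, partialD i (partialD j
      (regular fun x ↦ ut x * (a i j).val x * v x))) +
    ∑ i, partialD i (regular fun x ↦ f x i * v x)

/-- `dv/dt = g` on `(0,T)` in the sense of (vector-valued) distributions: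
`∫ χ'(t) v(t) dt = - ∫ χ(t) g(t) dt` for all `χ ∈ C_c^∞(0,T)`, both sides being compared as
distributions on `ℝᵈ`. -/
def HasTimeDeriv {d : ℕ} (T : ℝ) (v : ℝ → L2 d) (g : ℝ → Distr d) : Prop :=
  ∀ (χ : TestFunction (⟨Ioo 0 T, isOpen_Ioo⟩ : Opens ℝ) ℝ ⊤) (φ : Test d),
    ∫ t in Ioo 0 T, deriv (⇑χ) t * regular (⇑(v t)) φ = -∫ t in Ioo 0 T, χ t * g t φ

/-- `ρ` is an `H⁻¹`-weak solution on `[0,T]` of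
`dρ/dt - ½ ∑_{i,j} D²_{ij} (u a_{ij} ρ) + div (f ρ) = 0`, `ρ(0) = ρ₀`, that is,
`ρ ∈ C([0,T];H)`, `ρ` coincides a.e. on `(0,T)` with some `v ∈ L²(0,T;V)`, its derivative is
`dρ/dt = (I + A₀) w` with `w ∈ L²(0,T;L²)`, i.e. `dρ/dt ∈ L²(0,T;V*)`, and the equation holds in
`V*` for a.e. `t`. -/
structure IsWeakSolution {d : ℕ} (T : ℝ) (hT : 0 < T) (a : Fin d → Fin d → W1Infty d)
    (f : Space d → Space d) (u : ℝ → Space d → ℝ) (ρ₀ : HNegOne d)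
    (ρ : C(Icc (0 : ℝ) T, HNegOne d)) : Prop where
  initial : ρ ⟨0, left_mem_Icc.2 hT.le⟩ = ρ₀
  evolution : ∃ v w : Lp (L2 d) 2 (volume.restrict (Ioo 0 T)),
    (∀ᵐ t : ℝ, ∀ ht : t ∈ Ioo 0 T, ρ ⟨t, Ioo_subset_Icc_self ht⟩ = toHNegOne (v t)) ∧
    HasTimeDeriv T (⇑v) (fun t ↦ idAddA0 a (w t)) ∧
    ∀ᵐ t ∂(volume.restrict (Ioo 0 T)), idAddA0 a (w t) + opA a f (u t) (v t) = 0

end FokkerPlanck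

end

/-!
The equation is solved in `L²(0,T;L²)` after applying the inverse of an elliptic operator.

Identify `H⁻¹` with `H¹` by the Riesz isomorphism, so that the embedding `L² ⊂ H⁻¹` becomes the
adjoint `J` of the inclusion `J* : H¹ → L²`. Let `s` be the symmetric part of `a`, let `μ` be large,
and let `K` be the operator on `H¹` of the form `μ ∫ p q + ∑ ∫ s_{ij} D_j p D_i q`, with inverse
`N`. For the second order term, `∑ D²_{ij} (u a_{ij} v)` differs from `∑ D_i (s_{ij} D_j (u v))` by
first order terms only. Hence `M(t) = (μ + A₀)⁻¹ A(t)`, with `A₀` formed from `s`, is a bounded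
operator of `L²`: it is `u(t)/2` plus a term factoring through `J* N`
(`SobolevModel.evolutionOp`, `SobolevModel.inner_evolutionOp`). The bound `u ≥ γ₁` gives the
Gårding inequality `(γ₁/4) ‖v‖² ≤ ⟨M(t) v, v⟩ + λ ⟨N J v, J v⟩`
(`SobolevModel.exists_evolutionOp_coercive`), and the equation becomes
`J* N ρ(t) = J* N ρ₀ - ∫₀ᵗ M v`, with `ρ = J v` almost everywhere.

This abstract problem is handled in a Hilbert space. The weighted energy identity for
`t ↦ ⟨G Φ, Φ⟩`, where `G = J* N J`, gives an a priori estimate (`energy_estimate`); the method of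
continuity from `M = I` gives density of the range of `ψ ↦ G ψ + M ∫ ψ`
(`denseRange_compLpL_add_mul_volterra`). Approximate solutions are then Cauchy both in
`L²(0,T;L²)` and in `C([0,T];H⁻¹)`, which proves existence (`exists_evolution`). For uniqueness
(`eq_zero_of_compLpL_add_volterra_mul_eq_zero`), a solution `v` of `G v + ∫ M v = 0` is
a limit of primitives of functions `ψₙ` to which the a priori estimate applies.

To pass from distributions to the integrated equation, the du Bois-Reymond lemma in time is combined
with the density in `L²` of `(μ - ∑ D_j s_{ij} D_i) C_c^∞` (`exists_denseRange_formalAdjoint`). The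
latter follows by pairing with `φ - Δφ`: two integrations by parts show that the pairing controls
the full `H²` norm when `μ` is large, so that the claim is reduced to the density of
`(1 - Δ) C_c^∞`, which is the maximum principle for bounded solutions of `W - ΔW = 0`
(`denseRange_helmholtz`).

The space `V* = (I + A₀) L²` is built with `a` itself, not with `s`. The density `w` of the time
derivative `(I + A₀) w` is `-(I + A₀)⁻¹ A(t) v`, given by the same formula as `-M(t) v` with `a` and
`1` in place of `s` and `μ`; the Lax–Milgram lemma replaces symmetry there.
-/

noncomputable section

open MeasureTheory Set TopologicalSpace Filter
open scoped Distributions LineDeriv ENNReal Topology Convolution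

namespace FokkerPlanck

/-! ### Dense range criteria in Hilbert spaces -/

section DenseRange

variable {D H : Type*} [AddCommGroup D] [Module ℝ D] [NormedAddCommGroup H]
  [InnerProductSpace ℝ H] [CompleteSpace H]

theorem denseRange_of_forall_inner_eq_zero (L : D →ₗ[ℝ] H)
    (h : ∀ w : H, (∀ x, inner ℝ w (L x) = 0) → w = 0) : DenseRange L := by
  have h1 : (LinearMap.range L).topologicalClosure = ⊤ := by
    rw [Submodule.topologicalClosure_eq_top_iff, Submodule.eq_bot_iff]
    intro w hw
    refine h w fun x ↦ ?_
    rw [real_inner_comm]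
    exact (Submodule.mem_orthogonal _ _).1 hw _ (LinearMap.mem_range_self L x)
  have h2 := Submodule.dense_iff_topologicalClosure_eq_top.2 h1
  rwa [LinearMap.coe_range] at h2

/-- If `L` is bounded relative to `P` and coercive when paired with `P`, then its range is dense as
soon as that of `P` is: for `w` orthogonal to the range of `L`, approximate `w` by `P xₙ`; then
`⟨L xₙ, P xₙ⟩ = ⟨L xₙ, P xₙ - w⟩` tends to zero. -/
theorem denseRange_of_inner_coercive (L P : D →ₗ[ℝ] H) (hP : DenseRange P) {c C : ℝ} (hc : 0 < c)
    (hcoer : ∀ x, c * ‖P x‖ ^ 2 ≤ inner ℝ (L x) (P x)) (hbd : ∀ x, ‖L x‖ ≤ C * ‖P x‖) :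
    DenseRange L := by
  refine denseRange_of_forall_inner_eq_zero L fun w hw ↦ ?_
  obtain ⟨x, hx⟩ : ∃ x : ℕ → D, Tendsto (fun n ↦ P (x n)) atTop (𝓝 w) := by
    obtain ⟨y, hy, hlim⟩ := mem_closure_iff_seq_limit.1 (hP w)
    choose x hx using hy
    exact ⟨x, by simpa only [hx] using hlim⟩
  have h1 : ∀ n, c * ‖P (x n)‖ ^ 2 ≤ C * ‖P (x n)‖ * ‖P (x n) - w‖ := fun n ↦ by
    calc c * ‖P (x n)‖ ^ 2 ≤ inner ℝ (L (x n)) (P (x n)) := hcoer _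
      _ = inner ℝ (L (x n)) (P (x n) - w) := by
        rw [inner_sub_right, real_inner_comm w, hw, sub_zero]
      _ ≤ ‖L (x n)‖ * ‖P (x n) - w‖ := real_inner_le_norm _ _
      _ ≤ _ := by gcongr; exact hbd _
  have h2 : c * ‖w‖ ^ 2 ≤ C * ‖w‖ * ‖w - w‖ :=
    le_of_tendsto_of_tendsto' ((hx.norm.pow 2).const_mul c)
      ((hx.norm.const_mul C).mul (hx.sub_const w).norm) h1
  rw [sub_self, norm_zero, mul_zero] at h2
  have : ‖w‖ ^ 2 ≤ 0 := nonpos_of_mul_nonpos_right h2 hc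
  simpa using le_antisymm this (by positivity)

/-- The method of continuity: along `L + θ S`, `θ ∈ [0, 1]`, density of the range propagates by
steps of a fixed length. -/
theorem denseRange_add_of_continuity (L S : D →ₗ[ℝ] H) (hL : DenseRange L) (C : ℝ)
    (hS : ∀ θ ∈ Icc (0 : ℝ) 1, ∀ x, ‖S x‖ ≤ C * ‖L x + θ • S x‖) : DenseRange (L + S) := by
  obtain ⟨n, hn⟩ := exists_nat_gt C
  have key : ∀ k : ℕ, k ≤ n + 1 → DenseRange (L + ((k : ℝ) / (n + 1)) • S) := by
    intro k
    induction k with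
    | zero => intro _; simpa using hL
    | succ k ih =>
      intro hk
      have ihk := ih (by omega)
      set θ : ℝ := (k : ℝ) / (n + 1) with hθ
      have hθ01 : θ ∈ Icc (0 : ℝ) 1 :=
        ⟨by positivity, (div_le_one (by positivity)).2 (by exact_mod_cast (by omega : k ≤ n + 1))⟩
      refine denseRange_of_inner_coercive _ (L + θ • S) ihk (c := 1 - C / (n + 1))
        (C := 1 + C / (n + 1)) ?_ (fun x ↦ ?_) (fun x ↦ ?_)
      · rw [sub_pos, div_lt_one (by positivity)]; linarith
      all_goals
        have hs : (L + (((k + 1 : ℕ) : ℝ) / (n + 1)) • S) x =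
            (L + θ • S) x + (1 / (n + 1 : ℝ)) • S x := by
          simp only [LinearMap.add_apply, LinearMap.smul_apply, add_assoc, ← add_smul, hθ]
          congr 3; push_cast; ring
        have hb : ‖(1 / (n + 1 : ℝ)) • S x‖ ≤ C / (n + 1) * ‖(L + θ • S) x‖ := by
          rw [norm_smul, Real.norm_of_nonneg (by positivity)]
          have := hS θ hθ01 x
          calc 1 / (n + 1 : ℝ) * ‖S x‖ ≤ 1 / (n + 1 : ℝ) * (C * ‖L x + θ • S x‖) := by gcongr
            _ = _ := by simp only [LinearMap.add_apply, LinearMap.smul_apply]; ring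
        rw [hs]
      · rw [inner_add_left, real_inner_self_eq_norm_sq]
        have := neg_le_of_abs_le (abs_real_inner_le_norm ((1 / (n + 1 : ℝ)) • S x) ((L + θ • S) x))
        nlinarith [norm_nonneg ((L + θ • S) x)]
      · refine (norm_add_le _ _).trans ?_
        linarith
  have := key (n + 1) le_rfl
  rwa [Nat.cast_add, Nat.cast_one, div_self (by positivity), one_smul] at this

end DenseRange

/-! ### Primitives of square integrable functions -/

/-- Lebesgue measure on the time interval `(0, T)`. -/
abbrev timeMeasure (T : ℝ) : Measure ℝ := volume.restrict (Ioo 0 T)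

section Time

theorem integrable_coeFn {X : Type*} [NormedAddCommGroup X] {T : ℝ}
    (v : Lp X 2 (timeMeasure T)) : Integrable v (timeMeasure T) :=
  (Lp.memLp v).integrable one_le_two

theorem intervalIntegrable_coeFn {X : Type*} [NormedAddCommGroup X] {T : ℝ}
    (v : Lp X 2 (timeMeasure T)) (a b : ℝ) :
    IntervalIntegrable v (timeMeasure T) a b :=
  (integrable_coeFn v).intervalIntegrable

theorem exists_integral_norm_le (X : Type*) [NormedAddCommGroup X] (T : ℝ) :
    ∃ C, 0 ≤ C ∧ ∀ v : Lp X 2 (timeMeasure T), ∫ t, ‖v t‖ ∂(timeMeasure T) ≤ C * ‖v‖ := by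
  refine ⟨((timeMeasure T) univ ^ (1 / (1 : ℝ) - 1 / 2)).toReal, by positivity, fun v ↦ ?_⟩
  have h := eLpNorm_le_eLpNorm_mul_rpow_measure_univ (p := 1) (q := 2) (by norm_num)
    (Lp.memLp v).aestronglyMeasurable
  rw [integral_norm_eq_lintegral_enorm (Lp.memLp v).aestronglyMeasurable,
    ← eLpNorm_one_eq_lintegral_enorm, mul_comm, Lp.norm_def, ← ENNReal.toReal_mul]
  refine ENNReal.toReal_mono ?_ (by simpa using h)
  refine ENNReal.mul_ne_top (Lp.memLp v).eLpNorm_ne_top ?_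
  exact ENNReal.rpow_ne_top_of_nonneg (by norm_num) (measure_ne_top _ _)

/-- `v ↦ ∫₀ᵗ v ds`; only the part of `(0, t)` inside `(0, T)` counts. -/
def primitive (X : Type*) [NormedAddCommGroup X] [InnerProductSpace ℝ X] [CompleteSpace X]
    (T t : ℝ) : Lp X 2 (timeMeasure T) →L[ℝ] X :=
  LinearMap.mkContinuousOfExistsBound
    { toFun := fun v ↦ ∫ s in (0 : ℝ)..t, v s ∂(timeMeasure T)
      map_add' := fun v w ↦ by
        rw [← intervalIntegral.integral_add (intervalIntegrable_coeFn v _ _)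
          (intervalIntegrable_coeFn w _ _)]
        refine intervalIntegral.integral_congr_ae ?_
        filter_upwards [Lp.coeFn_add v w] with s hs _ using hs
      map_smul' := fun c v ↦ by
        rw [RingHom.id_apply, ← intervalIntegral.integral_smul]
        refine intervalIntegral.integral_congr_ae ?_
        filter_upwards [Lp.coeFn_smul c v] with s hs _ using hs }
    (by
      obtain ⟨C, -, hC⟩ := exists_integral_norm_le X T
      refine ⟨C, fun v ↦ le_trans ?_ (hC v)⟩
      exact (intervalIntegral.norm_integral_le_integral_norm_uIoc).trans
        (setIntegral_le_integral (integrable_coeFn v).norm (ae_of_all _ fun _ ↦ norm_nonneg _)))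

variable {X : Type*} [NormedAddCommGroup X] [InnerProductSpace ℝ X] [CompleteSpace X] {T : ℝ}

theorem primitive_apply (t : ℝ) (v : Lp X 2 (timeMeasure T)) :
    primitive X T t v = ∫ s in (0 : ℝ)..t, v s ∂(timeMeasure T) := rfl

theorem exists_norm_primitive_le (X : Type*) [NormedAddCommGroup X] [InnerProductSpace ℝ X]
    [CompleteSpace X] (T : ℝ) :
    ∃ C, 0 ≤ C ∧ ∀ t, ∀ v : Lp X 2 (timeMeasure T), ‖primitive X T t v‖ ≤ C * ‖v‖ := by
  obtain ⟨C, hC0, hC⟩ := exists_integral_norm_le X T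
  refine ⟨C, hC0, fun t v ↦ le_trans ?_ (hC v)⟩
  exact (intervalIntegral.norm_integral_le_integral_norm_uIoc).trans
    (setIntegral_le_integral (integrable_coeFn v).norm (ae_of_all _ fun _ ↦ norm_nonneg _))

theorem continuous_primitive (v : Lp X 2 (timeMeasure T)) :
    Continuous fun t ↦ primitive X T t v :=
  intervalIntegral.continuous_primitive (fun _ _ ↦ intervalIntegrable_coeFn v _ _) 0

theorem memLp_primitive (v : Lp X 2 (timeMeasure T)) :
    MemLp (fun t ↦ primitive X T t v) 2 (timeMeasure T) := by
  obtain ⟨C, -, hC⟩ := exists_norm_primitive_le X T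
  exact MemLp.of_bound (continuous_primitive v).aestronglyMeasurable (C * ‖v‖)
    (ae_of_all _ fun t ↦ hC t v)

theorem norm_toLp_le_of_forall_norm_le (X : Type*) [NormedAddCommGroup X] (T : ℝ) :
    ∃ C, 0 ≤ C ∧ ∀ (g : ℝ → X) (hg : MemLp g 2 (timeMeasure T)) (b : ℝ), (∀ t, ‖g t‖ ≤ b) →
      ‖hg.toLp g‖ ≤ C * b := by
  refine ⟨((timeMeasure T) univ ^ (2 : ℝ≥0∞).toReal⁻¹).toReal, by positivity, fun g hg b hb ↦ ?_⟩
  have hb0 : 0 ≤ b := (norm_nonneg _).trans (hb 0)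
  have h := eLpNorm_le_of_ae_bound (p := 2) (ae_of_all (timeMeasure T) hb)
  rw [Lp.norm_toLp]
  refine (ENNReal.toReal_mono ?_ h).trans ?_
  · exact ENNReal.mul_ne_top
      (ENNReal.rpow_ne_top_of_nonneg (by positivity) (measure_ne_top _ _)) (by simp)
  · rw [ENNReal.toReal_mul, ENNReal.toReal_ofReal hb0]

/-- The Volterra operator `v ↦ (t ↦ ∫₀ᵗ v ds)` of `L²(0, T; X)`. -/
def volterra (X : Type*) [NormedAddCommGroup X] [InnerProductSpace ℝ X] [CompleteSpace X]
    (T : ℝ) : Lp X 2 (timeMeasure T) →L[ℝ] Lp X 2 (timeMeasure T) :=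
  LinearMap.mkContinuousOfExistsBound
    { toFun := fun v ↦ (memLp_primitive v).toLp fun t ↦ primitive X T t v
      map_add' := fun v w ↦ by
        rw [← MemLp.toLp_add]
        exact MemLp.toLp_congr _ _ (ae_of_all _ fun t ↦ map_add _ v w)
      map_smul' := fun c v ↦ by
        rw [RingHom.id_apply, ← MemLp.toLp_const_smul]
        exact MemLp.toLp_congr _ _ (ae_of_all _ fun t ↦ map_smul _ c v) }
    (by
      obtain ⟨C, hC0, hC⟩ := exists_norm_primitive_le X T
      obtain ⟨C', hC'0, hC'⟩ := norm_toLp_le_of_forall_norm_le X T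
      refine ⟨C' * C, fun v ↦ ?_⟩
      rw [mul_assoc]
      exact hC' _ (memLp_primitive v) _ fun t ↦ hC t v)

theorem coeFn_volterra (v : Lp X 2 (timeMeasure T)) :
    volterra X T v =ᵐ[timeMeasure T] fun t ↦ primitive X T t v :=
  MemLp.coeFn_toLp (memLp_primitive v)

/-- The constant function `x` as an element of `L²(0, T; X)`. -/
def constL (X : Type*) [NormedAddCommGroup X] [InnerProductSpace ℝ X] (T : ℝ) :
    X →L[ℝ] Lp X 2 (timeMeasure T) :=
  Lp.constL 2 (timeMeasure T) ℝ

omit [CompleteSpace X] in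
theorem coeFn_constL (x : X) : constL X T x =ᵐ[timeMeasure T] fun _ ↦ x :=
  Lp.coeFn_const ..

end Time

/-! ### Measurable families of operators -/

section Family

variable {X : Type*} [NormedAddCommGroup X] [InnerProductSpace ℝ X] {T : ℝ}

theorem norm_sq_eq_integral (v : Lp X 2 (timeMeasure T)) :
    ‖v‖ ^ 2 = ∫ t, ‖v t‖ ^ 2 ∂(timeMeasure T) := by
  rw [← real_inner_self_eq_norm_sq, L2.inner_def]
  simp only [real_inner_self_eq_norm_sq]

omit [InnerProductSpace ℝ X] in
theorem integrable_norm_sq (v : Lp X 2 (timeMeasure T)) :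
    Integrable (fun t ↦ ‖v t‖ ^ 2) (timeMeasure T) :=
  (Lp.memLp v).integrable_norm_pow two_ne_zero

/-- A bounded, strongly measurable family of operators on `X`. -/
structure OpFamily (X : Type*) [NormedAddCommGroup X] [InnerProductSpace ℝ X] where
  /-- the operator at time `t` -/
  op : ℝ → X →L[ℝ] X
  /-- a uniform bound of the operator norms -/
  bound : ℝ
  bound_nonneg : 0 ≤ bound
  stronglyMeasurable_apply : ∀ x, StronglyMeasurable fun t ↦ op t x
  norm_apply_le : ∀ t x, ‖op t x‖ ≤ bound * ‖x‖

theorem OpFamily.aestronglyMeasurable [SecondCountableTopology X] (M : OpFamily X)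
    {μ : Measure ℝ} {v : ℝ → X} (hv : AEStronglyMeasurable v μ) :
    AEStronglyMeasurable (fun t ↦ M.op t (v t)) μ := by
  borelize X
  have h := stronglyMeasurable_uncurry_of_continuous_of_stronglyMeasurable
    (u := fun x t ↦ M.op t x) (fun t ↦ (M.op t).continuous) M.stronglyMeasurable_apply
  exact (h.comp_measurable (hv.stronglyMeasurable_mk.measurable.prodMk measurable_id)
    ).aestronglyMeasurable.congr (hv.ae_eq_mk.mono fun t ht ↦ by
      simp only [Function.comp_def, Function.uncurry, id, ht])

theorem OpFamily.memLp [SecondCountableTopology X] (M : OpFamily X)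
    {μ : Measure ℝ} {v : ℝ → X} (hv : MemLp v 2 μ) : MemLp (fun t ↦ M.op t (v t)) 2 μ :=
  hv.of_le_mul (M.aestronglyMeasurable hv.1) (ae_of_all _ fun t ↦ M.norm_apply_le t _)

/-- The operator `v ↦ (t ↦ M(t) v(t))` of `L²(0, T; X)`. -/
def OpFamily.mul [SecondCountableTopology X] (M : OpFamily X) (T : ℝ) :
    Lp X 2 (timeMeasure T) →L[ℝ] Lp X 2 (timeMeasure T) :=
  LinearMap.mkContinuous
    { toFun := fun v ↦ (M.memLp (Lp.memLp v)).toLp fun t ↦ M.op t (v t)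
      map_add' := fun v w ↦ by
        rw [← MemLp.toLp_add]
        refine MemLp.toLp_congr _ _ ?_
        filter_upwards [Lp.coeFn_add v w] with t ht
        rw [ht, Pi.add_apply, Pi.add_apply, map_add]
      map_smul' := fun c v ↦ by
        rw [RingHom.id_apply, ← MemLp.toLp_const_smul]
        refine MemLp.toLp_congr _ _ ?_
        filter_upwards [Lp.coeFn_smul c v] with t ht
        rw [ht, Pi.smul_apply, Pi.smul_apply, map_smul] }
    M.bound (fun v ↦ Lp.norm_le_mul_norm_of_ae_le_mul (by
      filter_upwards [MemLp.coeFn_toLp (M.memLp (Lp.memLp v))] with t ht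
      rw [LinearMap.coe_mk, AddHom.coe_mk, ht]
      exact M.norm_apply_le t _))

theorem OpFamily.coeFn_mul [SecondCountableTopology X] (M : OpFamily X)
    (v : Lp X 2 (timeMeasure T)) : M.mul T v =ᵐ[timeMeasure T] fun t ↦ M.op t (v t) :=
  MemLp.coeFn_toLp (M.memLp (Lp.memLp v))

theorem OpFamily.norm_mul_le [SecondCountableTopology X] (M : OpFamily X)
    (v : Lp X 2 (timeMeasure T)) : ‖M.mul T v‖ ≤ M.bound * ‖v‖ :=
  Lp.norm_le_mul_norm_of_ae_le_mul (by
    filter_upwards [M.coeFn_mul v] with t ht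
    rw [ht]
    exact M.norm_apply_le t _)

/-- The family `(1 - θ) I + θ M(t)`. -/
def OpFamily.segment (M : OpFamily X) (θ : ℝ) : OpFamily X where
  op t := (1 - θ) • ContinuousLinearMap.id ℝ X + θ • M.op t
  bound := |1 - θ| + |θ| * M.bound
  bound_nonneg := by have := M.bound_nonneg; positivity
  stronglyMeasurable_apply x := by
    exact stronglyMeasurable_const.add ((M.stronglyMeasurable_apply x).const_smul θ)
  norm_apply_le t x := by
    simp only [add_apply, smul_apply,
      ContinuousLinearMap.id_apply]
    refine (norm_add_le _ _).trans ?_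
    rw [norm_smul, norm_smul, Real.norm_eq_abs, Real.norm_eq_abs, add_mul, mul_assoc]
    gcongr
    exact M.norm_apply_le t x

theorem OpFamily.segment_mul [SecondCountableTopology X] (M : OpFamily X) (θ : ℝ)
    (v : Lp X 2 (timeMeasure T)) :
    (M.segment θ).mul T v = v + θ • (M.mul T v - v) := by
  refine Lp.ext ?_
  filter_upwards [(M.segment θ).coeFn_mul v, Lp.coeFn_add v (θ • (M.mul T v - v)),
    Lp.coeFn_smul θ (M.mul T v - v), Lp.coeFn_sub (M.mul T v) v,
    M.coeFn_mul v] with t h1 h2 h3 h4 h5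
  rw [h1, h2, Pi.add_apply, h3, Pi.smul_apply, h4, Pi.sub_apply, h5]
  simp only [OpFamily.segment, add_apply, smul_apply,
      ContinuousLinearMap.id_apply]
  module

end Family

/-! ### The energy estimate -/

section Energy

variable {X : Type*} [NormedAddCommGroup X] [InnerProductSpace ℝ X] [CompleteSpace X] {T : ℝ}

theorem primitive_eq_integral {ψ : ℝ → X} {v : Lp X 2 (timeMeasure T)} (hv : v =ᵐ[timeMeasure T] ψ)
    {t : ℝ} (ht : t ∈ Icc 0 T) : primitive X T t v = ∫ s in (0 : ℝ)..t, ψ s := by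
  have hsub : Ioo 0 t ⊆ Ioo 0 T := Ioo_subset_Ioo_right ht.2
  rw [primitive_apply, intervalIntegral.integral_of_le ht.1, intervalIntegral.integral_of_le ht.1,
    integral_Ioc_eq_integral_Ioo, integral_Ioc_eq_integral_Ioo,
    Measure.restrict_restrict measurableSet_Ioo, inter_eq_left.2 hsub]
  exact integral_congr_ae (ae_mono (Measure.restrict_mono hsub le_rfl) hv)

/-- The energy identity for `Φ(t) = x + ∫₀ᵗ ψ`, with the weight `e^{-2λt}`. -/
theorem energy_identity (G : X →L[ℝ] X) (hG : ∀ x y, inner ℝ (G x) y = inner ℝ x (G y))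
    (l : ℝ) (x : X) {ψ : ℝ → X} (hψ : Continuous ψ) (t : ℝ) :
    Real.exp (-2 * l * t) * inner ℝ (G (x + ∫ s in (0 : ℝ)..t, ψ s)) (x + ∫ s in (0 : ℝ)..t, ψ s) =
      inner ℝ (G x) x + ∫ s in (0 : ℝ)..t, 2 * Real.exp (-2 * l * s) *
        (inner ℝ (G (ψ s)) (x + ∫ r in (0 : ℝ)..s, ψ r) -
          l * inner ℝ (G (x + ∫ r in (0 : ℝ)..s, ψ r)) (x + ∫ r in (0 : ℝ)..s, ψ r)) := by
  set Φ : ℝ → X := fun s ↦ x + ∫ r in (0 : ℝ)..s, ψ r with hΦ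
  have hd : ∀ s, HasDerivAt Φ (ψ s) s := fun s ↦
    (hψ.integral_hasStrictDerivAt 0 s).hasDerivAt.const_add x
  have hc : Continuous Φ := continuous_iff_continuousAt.2 fun s ↦ (hd s).continuousAt
  have he : ∀ s, HasDerivAt (fun s ↦ Real.exp (-2 * l * s) * inner ℝ (G (Φ s)) (Φ s))
      (2 * Real.exp (-2 * l * s) * (inner ℝ (G (ψ s)) (Φ s) - l * inner ℝ (G (Φ s)) (Φ s))) s := by
    intro s
    have h1 : HasDerivAt (fun s ↦ Real.exp (-2 * l * s)) (Real.exp (-2 * l * s) * (-2 * l)) s := by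
      simpa using ((hasDerivAt_id s).const_mul (-2 * l)).exp
    have h2 : HasDerivAt (fun s ↦ inner ℝ (G (Φ s)) (Φ s))
        (inner ℝ (G (Φ s)) (ψ s) + inner ℝ (G (ψ s)) (Φ s)) s :=
      (G.hasFDerivAt.comp_hasDerivAt s (hd s)).inner ℝ (hd s)
    refine (h1.mul h2).congr_deriv ?_
    have h3 : inner ℝ (G (Φ s)) (ψ s) = inner ℝ (G (ψ s)) (Φ s) := by rw [hG, real_inner_comm]
    rw [h3]
    ring
  have h := intervalIntegral.integral_eq_sub_of_hasDerivAt (a := 0) (b := t) (fun s _ ↦ he s)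
    (Continuous.intervalIntegrable (by fun_prop) _ _)
  rw [h]
  simp [hΦ]

/-- The a priori estimate for a primitive `Φ = x + ∫₀ᵗ ψ` in terms of `F = G Φ' + M Φ`, for
continuous `ψ`. -/
theorem energy_inequality [SecondCountableTopology X] (hT : 0 < T) (M : OpFamily X)
    (G : X →L[ℝ] X) (hG : ∀ x y, inner ℝ (G x) y = inner ℝ x (G y)) {c l : ℝ} (hc : 0 < c)
    (hl : 0 ≤ l) (hM : ∀ t x, c * ‖x‖ ^ 2 ≤ inner ℝ (M.op t x) x + l * inner ℝ (G x) x)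
    (x : X) {ψ : ℝ → X} (hψ : Continuous ψ) {v φ F : Lp X 2 (timeMeasure T)}
    (hv : v =ᵐ[timeMeasure T] ψ) (hφ : φ = constL X T x + volterra X T v)
    (hF : F = G.compLpL 2 (timeMeasure T) v + M.mul T φ) :
    (∀ t ∈ Icc 0 T, Real.exp (-2 * l * t) *
        inner ℝ (G (x + primitive X T t v)) (x + primitive X T t v) ≤
          inner ℝ (G x) x + c⁻¹ * ‖F‖ ^ 2) ∧
      Real.exp (-2 * l * T) * (inner ℝ (G (x + primitive X T T v)) (x + primitive X T T v) +
        c * ‖φ‖ ^ 2) ≤ inner ℝ (G x) x + c⁻¹ * ‖F‖ ^ 2 := by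
  set Φ : ℝ → X := fun t ↦ x + ∫ s in (0 : ℝ)..t, ψ s with hΦ
  set e' : ℝ → ℝ := fun s ↦ 2 * Real.exp (-2 * l * s) *
    (inner ℝ (G (ψ s)) (Φ s) - l * inner ℝ (G (Φ s)) (Φ s)) with he'
  have hΦc : Continuous Φ := continuous_const.add
    (intervalIntegral.continuous_primitive (fun _ _ ↦ hψ.intervalIntegrable _ _) 0)
  have he'c : Continuous e' := by fun_prop
  have hprim : ∀ t ∈ Icc 0 T, x + primitive X T t v = Φ t := fun t ht ↦ by
    rw [primitive_eq_integral hv ht]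
  have hint : ∀ t ∈ Icc 0 T, ∫ s in (0 : ℝ)..t, e' s = ∫ s in Ioo 0 t, e' s := fun t ht ↦ by
    rw [intervalIntegral.integral_of_le ht.1, integral_Ioc_eq_integral_Ioo]
  have hφ' : ∀ᵐ s ∂(timeMeasure T), φ s = Φ s := by
    rw [hφ]
    filter_upwards [Lp.coeFn_add (constL X T x) (volterra X T v), coeFn_constL (T := T) x,
      coeFn_volterra v, ae_restrict_mem measurableSet_Ioo] with s h1 h2 h3 h4
    rw [h1, Pi.add_apply, h2, h3, hprim s (Ioo_subset_Icc_self h4)]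
  have hF' : ∀ᵐ s ∂(timeMeasure T), F s = G (ψ s) + M.op s (Φ s) := by
    rw [hF]
    filter_upwards [Lp.coeFn_add (G.compLpL 2 (timeMeasure T) v) (M.mul T φ), G.coeFn_compLpL v,
      M.coeFn_mul φ, hv, hφ'] with s h1 h2 h3 h4 h5
    rw [h1, Pi.add_apply, h2, h3, h4, h5]
  -- pointwise, `e' ≤ e^{-2λs} (‖F‖² / c - c ‖φ‖²)`
  have hpt : ∀ᵐ s ∂(timeMeasure T),
      e' s ≤ Real.exp (-2 * l * s) * (c⁻¹ * ‖F s‖ ^ 2 - c * ‖φ s‖ ^ 2) := by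
    filter_upwards [hφ', hF'] with s h1 h2
    have h3 : G (ψ s) = F s - M.op s (Φ s) := by rw [h2]; abel
    have h4 := hM s (Φ s)
    have h5 := real_inner_le_norm (F s) (Φ s)
    have h6 : 2 * (‖F s‖ * ‖Φ s‖) ≤ c⁻¹ * ‖F s‖ ^ 2 + c * ‖Φ s‖ ^ 2 := by
      have : 0 ≤ c⁻¹ * (‖F s‖ - c * ‖Φ s‖) ^ 2 := by positivity
      have h7 : c⁻¹ * (‖F s‖ - c * ‖Φ s‖) ^ 2 =
        c⁻¹ * ‖F s‖ ^ 2 + c * ‖Φ s‖ ^ 2 - 2 * (‖F s‖ * ‖Φ s‖) := by field_simp; ring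
      linarith
    rw [he', h1]
    simp only
    rw [h3, inner_sub_left, mul_comm (2 : ℝ), mul_assoc]
    gcongr
    linarith
  have hexp : ∀ s ∈ Ioo 0 T, Real.exp (-2 * l * s) ≤ 1 ∧
      Real.exp (-2 * l * T) ≤ Real.exp (-2 * l * s) := fun s hs ↦ by
    constructor
    · rw [Real.exp_le_one_iff]; nlinarith [mul_nonneg hl hs.1.le]
    · rw [Real.exp_le_exp]; nlinarith [mul_le_mul_of_nonneg_left hs.2.le hl]
  constructor
  · intro t ht
    have hsub : Ioo 0 t ⊆ Ioo 0 T := Ioo_subset_Ioo_right ht.2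
    rw [hprim t ht, energy_identity G hG l x hψ t, hint t ht, norm_sq_eq_integral,
      ← integral_const_mul]
    gcongr
    refine le_trans ?_ (setIntegral_mono_set ((integrable_norm_sq F).const_mul _)
      (ae_of_all _ fun s ↦ by positivity) hsub.eventuallyLE)
    refine integral_mono_ae (he'c.integrableOn_Icc.mono_set Ioo_subset_Icc_self)
      (((integrable_norm_sq F).const_mul _).mono_measure (Measure.restrict_mono hsub le_rfl)) ?_
    filter_upwards [ae_mono (Measure.restrict_mono hsub le_rfl) hpt,
      ae_restrict_mem measurableSet_Ioo] with s h1 h2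
    refine h1.trans ?_
    have h3 := (hexp s (hsub h2)).1
    have h4 : 0 ≤ c⁻¹ * ‖F s‖ ^ 2 := by positivity
    have h5 : 0 ≤ c * ‖φ s‖ ^ 2 := by positivity
    have h6 := Real.exp_pos (-2 * l * s)
    nlinarith
  · have hTT : T ∈ Icc 0 T := ⟨hT.le, le_rfl⟩
    rw [hprim T hTT, mul_add, energy_identity G hG l x hψ T, hint T hTT, norm_sq_eq_integral,
      norm_sq_eq_integral, ← integral_const_mul, ← integral_const_mul, ← integral_const_mul,
      add_assoc, ← integral_add (he'c.integrableOn_Icc.mono_set Ioo_subset_Icc_self)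
        (((integrable_norm_sq φ).const_mul _).const_mul _)]
    refine add_le_add le_rfl ?_
    refine integral_mono_ae ((he'c.integrableOn_Icc.mono_set Ioo_subset_Icc_self).add
      (((integrable_norm_sq φ).const_mul _).const_mul _))
      ((integrable_norm_sq F).const_mul _) ?_
    filter_upwards [hpt, ae_restrict_mem measurableSet_Ioo] with s h1 h2
    have h3 := hexp s h2
    have h4 : 0 ≤ c⁻¹ * ‖F s‖ ^ 2 := by positivity
    have h5 : 0 ≤ c * ‖φ s‖ ^ 2 := by positivity
    nlinarith

end Energy

section Volterra

variable {X : Type*} [NormedAddCommGroup X] [InnerProductSpace ℝ X] [CompleteSpace X] {T : ℝ}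

theorem denseRange_toLp_boundedContinuousFunction (X : Type*) [NormedAddCommGroup X]
    [InnerProductSpace ℝ X] (T : ℝ) :
    DenseRange (BoundedContinuousFunction.toLp (E := X) 2 (timeMeasure T) ℝ) :=
  BoundedContinuousFunction.toLp_denseRange _ _ ℝ (by norm_num)

theorem primitive_compLpL (G : X →L[ℝ] X) (t : ℝ) (v : Lp X 2 (timeMeasure T)) :
    primitive X T t (G.compLpL 2 (timeMeasure T) v) = G (primitive X T t v) := by
  rw [primitive_apply, primitive_apply,
    ← G.intervalIntegral_comp_comm (intervalIntegrable_coeFn v _ _)]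
  exact intervalIntegral.integral_congr_ae ((G.coeFn_compLpL v).mono fun _ h _ ↦ h)

theorem volterra_compLpL (G : X →L[ℝ] X) (v : Lp X 2 (timeMeasure T)) :
    volterra X T (G.compLpL 2 (timeMeasure T) v) =
      G.compLpL 2 (timeMeasure T) (volterra X T v) := by
  refine Lp.ext ?_
  filter_upwards [coeFn_volterra (G.compLpL 2 (timeMeasure T) v), coeFn_volterra v,
    G.coeFn_compLpL (volterra X T v)] with t h1 h2 h3
  rw [h1, h3, h2, primitive_compLpL]

/-- `⟨∫₀ᵗ v, v⟩` integrates to `½ ‖∫₀ᵀ v‖²`. -/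
theorem inner_volterra_nonneg (hT : 0 < T) (v : Lp X 2 (timeMeasure T)) :
    0 ≤ inner ℝ (volterra X T v) v := by
  refine (denseRange_toLp_boundedContinuousFunction X T).induction_on
    (p := fun v ↦ 0 ≤ inner ℝ (volterra X T v) v) v
    (isClosed_le (by fun_prop) (by fun_prop)) fun ψ ↦ ?_
  set w := BoundedContinuousFunction.toLp (E := X) 2 (timeMeasure T) ℝ ψ with hw
  have hw' : w =ᵐ[timeMeasure T] ψ := BoundedContinuousFunction.coeFn_toLp ..
  have h := energy_identity (ContinuousLinearMap.id ℝ X) (fun _ _ ↦ rfl) 0 0 ψ.continuous T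
  simp only [mul_zero, zero_mul, Real.exp_zero, one_mul, zero_add, sub_zero,
    ContinuousLinearMap.id_apply, inner_zero_left, mul_one,
    intervalIntegral.integral_const_mul] at h
  rw [intervalIntegral.integral_of_le hT.le (f := fun s ↦ inner ℝ (ψ s) _),
    integral_Ioc_eq_integral_Ioo] at h
  have h2 : inner ℝ (volterra X T w) w =
      ∫ s in Ioo 0 T, inner ℝ (ψ s) (∫ r in (0 : ℝ)..s, ψ r) := by
    rw [L2.inner_def]
    refine integral_congr_ae ?_
    filter_upwards [hw', coeFn_volterra w, ae_restrict_mem measurableSet_Ioo] with s h1 h2 h3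
    rw [h1, h2, primitive_eq_integral hw' (Ioo_subset_Icc_self h3), real_inner_comm]
  rw [h2]
  have := real_inner_self_nonneg (F := X) (x := ∫ s in (0 : ℝ)..T, ψ s)
  linarith

variable [SecondCountableTopology X]

/-- The a priori estimate for `Φ = x + ∫₀ᵗ v` in terms of `G Φ' + M Φ`: a bound of `G` along `Φ` at
every time, and a bound of `Φ` in `L²(0, T; X)`. -/
theorem energy_estimate (hT : 0 < T) (M : OpFamily X)
    (G : X →L[ℝ] X) (hG : ∀ x y, inner ℝ (G x) y = inner ℝ x (G y)) {c l : ℝ} (hc : 0 < c)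
    (hl : 0 ≤ l) (hM : ∀ t x, c * ‖x‖ ^ 2 ≤ inner ℝ (M.op t x) x + l * inner ℝ (G x) x)
    (x : X) (v : Lp X 2 (timeMeasure T)) :
    (∀ t ∈ Icc 0 T, Real.exp (-2 * l * t) *
        inner ℝ (G (x + primitive X T t v)) (x + primitive X T t v) ≤
          inner ℝ (G x) x + c⁻¹ * ‖G.compLpL 2 (timeMeasure T) v +
            M.mul T (constL X T x + volterra X T v)‖ ^ 2) ∧
      Real.exp (-2 * l * T) * (inner ℝ (G (x + primitive X T T v)) (x + primitive X T T v) +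
        c * ‖constL X T x + volterra X T v‖ ^ 2) ≤
          inner ℝ (G x) x + c⁻¹ * ‖G.compLpL 2 (timeMeasure T) v +
            M.mul T (constL X T x + volterra X T v)‖ ^ 2 := by
  have key := fun ψ : BoundedContinuousFunction ℝ X ↦ energy_inequality hT M G hG hc hl hM x
    ψ.continuous (BoundedContinuousFunction.coeFn_toLp 2 (timeMeasure T) ℝ ψ) rfl rfl
  refine ⟨fun t ht ↦ ?_, ?_⟩
  · exact (denseRange_toLp_boundedContinuousFunction X T).induction_on
      (p := fun v ↦ Real.exp (-2 * l * t) *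
        inner ℝ (G (x + primitive X T t v)) (x + primitive X T t v) ≤
          inner ℝ (G x) x + c⁻¹ * ‖G.compLpL 2 (timeMeasure T) v +
            M.mul T (constL X T x + volterra X T v)‖ ^ 2) v
      (isClosed_le (by fun_prop) (by fun_prop)) fun ψ ↦ (key ψ).1 t ht
  · exact (denseRange_toLp_boundedContinuousFunction X T).induction_on
      (p := fun v ↦ Real.exp (-2 * l * T) *
        (inner ℝ (G (x + primitive X T T v)) (x + primitive X T T v) +
        c * ‖constL X T x + volterra X T v‖ ^ 2) ≤
          inner ℝ (G x) x + c⁻¹ * ‖G.compLpL 2 (timeMeasure T) v +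
            M.mul T (constL X T x + volterra X T v)‖ ^ 2) v
      (isClosed_le (by fun_prop) (by fun_prop)) fun ψ ↦ (key ψ).2

omit [CompleteSpace X] [SecondCountableTopology X] in
theorem inner_compLpL (G : X →L[ℝ] X) (v w : Lp X 2 (timeMeasure T)) :
    inner ℝ (G.compLpL 2 (timeMeasure T) v) w = ∫ t, inner ℝ (G (v t)) (w t) ∂(timeMeasure T) := by
  rw [L2.inner_def]
  exact integral_congr_ae ((G.coeFn_compLpL v).mono fun t h ↦ by simp only [h])

omit [CompleteSpace X] [SecondCountableTopology X] in
theorem eq_zero_of_inner_compLpL_nonpos (G : X →L[ℝ] X)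
    (hpos : ∀ x, x ≠ 0 → 0 < inner ℝ (G x) x) (v : Lp X 2 (timeMeasure T))
    (hv : inner ℝ (G.compLpL 2 (timeMeasure T) v) v ≤ 0) : v = 0 := by
  have h0 : ∀ x, 0 ≤ inner ℝ (G x) x := fun x ↦ by
    rcases eq_or_ne x 0 with rfl | hx
    · simp
    · exact (hpos x hx).le
  rw [inner_compLpL] at hv
  have hi : Integrable (fun t ↦ inner ℝ (G (v t)) (v t)) (timeMeasure T) :=
    (L2.integrable_inner (𝕜 := ℝ) (G.compLpL 2 (timeMeasure T) v) v).congr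
      ((G.coeFn_compLpL v).mono fun t h ↦ by simp only [h])
  have h1 := (integral_eq_zero_iff_of_nonneg (fun t ↦ h0 (v t)) hi).1
    (le_antisymm hv (integral_nonneg fun t ↦ h0 _))
  refine Lp.eq_zero_iff_ae_eq_zero.2 (h1.mono fun t ht ↦ ?_)
  by_contra hne
  exact (hpos _ hne).ne' ht

omit [SecondCountableTopology X] in
/-- Uniqueness for `G v + ∫₀ᵗ v = 0`. -/
theorem eq_zero_of_compLpL_add_volterra_eq_zero (hT : 0 < T) (G : X →L[ℝ] X)
    (hpos : ∀ x, x ≠ 0 → 0 < inner ℝ (G x) x) (v : Lp X 2 (timeMeasure T))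
    (hv : G.compLpL 2 (timeMeasure T) v + volterra X T v = 0) : v = 0 := by
  refine eq_zero_of_inner_compLpL_nonpos G hpos v ?_
  have h := congrArg (fun z ↦ inner ℝ z v) hv
  simp only [inner_add_left, inner_zero_left] at h
  linarith [inner_volterra_nonneg hT v]

omit [SecondCountableTopology X] in
theorem denseRange_compLpL_add_volterra (hT : 0 < T) (G : X →L[ℝ] X)
    (hpos : ∀ x, x ≠ 0 → 0 < inner ℝ (G x) x) :
    DenseRange ((G.compLpL 2 (timeMeasure T) + volterra X T :
      Lp X 2 (timeMeasure T) →L[ℝ] Lp X 2 (timeMeasure T)) :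
        Lp X 2 (timeMeasure T) →ₗ[ℝ] Lp X 2 (timeMeasure T)) := by
  refine denseRange_of_forall_inner_eq_zero _ fun w hw ↦ eq_zero_of_inner_compLpL_nonpos G hpos w ?_
  have h := hw w
  rw [real_inner_comm] at h
  simp only [ContinuousLinearMap.coe_coe, add_apply, inner_add_left] at h
  linarith [inner_volterra_nonneg hT w]

end Volterra

/-! ### Well-posedness of the abstract evolution equation -/

section Evolution

variable {X : Type*} [NormedAddCommGroup X] [InnerProductSpace ℝ X] [CompleteSpace X]
  [SecondCountableTopology X] {T : ℝ}

/-- The a priori estimate for `Φ = ∫₀ᵗ v` in `L²(0, T; X)`. -/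
theorem norm_volterra_le (hT : 0 < T) (M : OpFamily X)
    (G : X →L[ℝ] X) (hG : ∀ x y, inner ℝ (G x) y = inner ℝ x (G y))
    (hpos : ∀ x, x ≠ 0 → 0 < inner ℝ (G x) x) {c l : ℝ} (hc : 0 < c)
    (hl : 0 ≤ l) (hM : ∀ t x, c * ‖x‖ ^ 2 ≤ inner ℝ (M.op t x) x + l * inner ℝ (G x) x)
    (v : Lp X 2 (timeMeasure T)) :
    ‖volterra X T v‖ ≤ c⁻¹ * Real.exp (l * T) *
      ‖G.compLpL 2 (timeMeasure T) v + M.mul T (volterra X T v)‖ := by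
  have h := (energy_estimate hT M G hG hc hl hM 0 v).2
  simp only [map_zero, zero_add, inner_zero_left] at h
  have h0 : 0 ≤ inner ℝ (G (primitive X T T v)) (primitive X T T v) := by
    rcases eq_or_ne (primitive X T T v) 0 with hx | hx
    · simp [hx]
    · exact (hpos _ hx).le
  set F := G.compLpL 2 (timeMeasure T) v + M.mul T (volterra X T v)
  have hE : Real.exp (-2 * l * T) = (Real.exp (l * T) ^ 2)⁻¹ := by
    rw [← Real.exp_nat_mul, ← Real.exp_neg]; congr 1; push_cast; ring
  rw [hE] at h
  have hp := Real.exp_pos (l * T)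
  refine le_of_sq_le_sq ?_ (by positivity)
  have h2 : (Real.exp (l * T) ^ 2)⁻¹ * (c * ‖volterra X T v‖ ^ 2) ≤ c⁻¹ * ‖F‖ ^ 2 :=
    le_trans (by gcongr; linarith) h
  rw [mul_pow, mul_pow]
  calc ‖volterra X T v‖ ^ 2 = c⁻¹ * Real.exp (l * T) ^ 2 *
        ((Real.exp (l * T) ^ 2)⁻¹ * (c * ‖volterra X T v‖ ^ 2)) := by field_simp
    _ ≤ c⁻¹ * Real.exp (l * T) ^ 2 * (c⁻¹ * ‖F‖ ^ 2) := by gcongr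
    _ = _ := by ring

/-- `v ↦ G v + M ∫₀ᵗ v` has dense range, by the method of continuity along `(1 - θ) I + θ M`, all
members of which satisfy the same a priori estimate. -/
theorem denseRange_compLpL_add_mul_volterra (hT : 0 < T) (M : OpFamily X)
    (G : X →L[ℝ] X) (hG : ∀ x y, inner ℝ (G x) y = inner ℝ x (G y))
    (hpos : ∀ x, x ≠ 0 → 0 < inner ℝ (G x) x) {c l : ℝ} (hc : 0 < c)
    (hl : 0 ≤ l) (hM : ∀ t x, c * ‖x‖ ^ 2 ≤ inner ℝ (M.op t x) x + l * inner ℝ (G x) x) :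
    DenseRange fun v ↦ G.compLpL 2 (timeMeasure T) v + M.mul T (volterra X T v) := by
  have h := denseRange_add_of_continuity _
    ((M.mul T ∘L volterra X T - volterra X T :
      Lp X 2 (timeMeasure T) →L[ℝ] Lp X 2 (timeMeasure T)) :
        Lp X 2 (timeMeasure T) →ₗ[ℝ] Lp X 2 (timeMeasure T))
    (denseRange_compLpL_add_volterra hT G hpos)
    ((M.bound + 1) * ((min 1 c)⁻¹ * Real.exp (l * T))) (fun θ hθ v ↦ ?_)
  · convert h using 2 with v
    simp
  have hseg : ∀ t x, min 1 c * ‖x‖ ^ 2 ≤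
      inner ℝ ((M.segment θ).op t x) x + l * inner ℝ (G x) x := fun t x ↦ by
    have h1 := hM t x
    have h2 : 0 ≤ inner ℝ (G x) x := by
      rcases eq_or_ne x 0 with rfl | hx
      · simp
      · exact (hpos x hx).le
    have h3 : 0 ≤ ‖x‖ ^ 2 := by positivity
    have h4 : min 1 c * ‖x‖ ^ 2 ≤ 1 * ‖x‖ ^ 2 := by gcongr; exact min_le_left _ _
    have h5 : min 1 c * ‖x‖ ^ 2 ≤ c * ‖x‖ ^ 2 := by gcongr; exact min_le_right _ _
    simp only [OpFamily.segment, add_apply, smul_apply, ContinuousLinearMap.id_apply,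
      inner_add_left, real_inner_smul_left, real_inner_self_eq_norm_sq]
    have h6 : 0 ≤ (1 - θ) * (1 * ‖x‖ ^ 2 + l * inner ℝ (G x) x - min 1 c * ‖x‖ ^ 2) :=
      mul_nonneg (by linarith [hθ.2]) (by nlinarith [mul_nonneg hl h2])
    have h7 : 0 ≤ θ * (inner ℝ (M.op t x) x + l * inner ℝ (G x) x - min 1 c * ‖x‖ ^ 2) :=
      mul_nonneg hθ.1 (by linarith)
    linarith
  have h1 := norm_volterra_le hT (M.segment θ) G hG hpos (lt_min one_pos hc) hl hseg v
  rw [OpFamily.segment_mul] at h1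
  have h2 : ‖M.mul T (volterra X T v) - volterra X T v‖ ≤ (M.bound + 1) * ‖volterra X T v‖ := by
    refine (norm_sub_le _ _).trans ?_
    rw [add_mul, one_mul]
    gcongr
    exact M.norm_mul_le _
  simp only [ContinuousLinearMap.coe_coe, add_apply, sub_apply, ContinuousLinearMap.comp_apply]
  rw [add_assoc]
  have := M.bound_nonneg
  refine h2.trans ?_
  rw [mul_assoc]
  gcongr

/-- Uniqueness for `G v(t) + ∫₀ᵗ M v = 0` in `L²(0, T; X)`. Since `v` need not be a primitive, the a
priori estimate is not applied to `v` itself, but to `φₙ = ∫₀ᵗ ψₙ`, where `G ψₙ + φₙ → v - M v`; the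
`φₙ` converge to `v`, while `G ψₙ + M φₙ → 0`. -/
theorem eq_zero_of_compLpL_add_volterra_mul_eq_zero (hT : 0 < T) (M : OpFamily X)
    (G : X →L[ℝ] X) (hG : ∀ x y, inner ℝ (G x) y = inner ℝ x (G y))
    (hpos : ∀ x, x ≠ 0 → 0 < inner ℝ (G x) x) {c l : ℝ} (hc : 0 < c)
    (hl : 0 ≤ l) (hM : ∀ t x, c * ‖x‖ ^ 2 ≤ inner ℝ (M.op t x) x + l * inner ℝ (G x) x)
    (v : Lp X 2 (timeMeasure T))
    (hv : G.compLpL 2 (timeMeasure T) v + volterra X T (M.mul T v) = 0) : v = 0 := by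
  set P := G.compLpL 2 (timeMeasure T) + volterra X T with hP
  have hd := denseRange_compLpL_add_volterra hT G hpos
  obtain ⟨ψ, hψ⟩ : ∃ ψ : ℕ → Lp X 2 (timeMeasure T),
      Tendsto (fun n ↦ P (ψ n)) atTop (𝓝 (v - M.mul T v)) := by
    obtain ⟨y, hy, hlim⟩ := mem_closure_iff_seq_limit.1 (hd (v - M.mul T v))
    choose x hx using hy
    exact ⟨x, by
      rw [show y = fun n ↦ P (x n) from funext fun n ↦ (hx n).symm] at hlim
      exact hlim⟩
  -- the a priori estimate for `M = I` makes `φₙ = ∫ ψₙ` a Cauchy sequence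
  have hone : ∀ w, ‖volterra X T w‖ ≤ ‖P w‖ := fun w ↦ by
    have h := norm_volterra_le hT (M.segment 0) G hG hpos one_pos le_rfl (fun t x ↦ by
      simp [OpFamily.segment]) w
    rw [OpFamily.segment_mul] at h
    simpa [hP] using h
  obtain ⟨φ, hφ⟩ : ∃ φ, Tendsto (fun n ↦ volterra X T (ψ n)) atTop (𝓝 φ) := by
    refine cauchySeq_tendsto_of_complete ?_
    refine Metric.cauchySeq_iff.2 fun ε hε ↦ ?_
    obtain ⟨n, hn⟩ := Metric.cauchySeq_iff.1 hψ.cauchySeq ε hε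
    refine ⟨n, fun k hk m hm ↦ lt_of_le_of_lt ?_ (hn k hk m hm)⟩
    rw [dist_eq_norm, dist_eq_norm, ← map_sub, ← map_sub]
    exact hone _
  have h1 : P (φ - v) = 0 := by
    have h2 : ∀ n, P (volterra X T (ψ n)) = volterra X T (P (ψ n)) := fun n ↦ by
      simp only [hP, add_apply, map_add, volterra_compLpL]
    have h3 : P φ = volterra X T (v - M.mul T v) :=
      tendsto_nhds_unique ((P.continuous.tendsto _).comp hφ)
        ((((volterra X T).continuous.tendsto _).comp hψ).congr fun n ↦ (h2 n).symm)
    have h4 := eq_neg_of_add_eq_zero_left hv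
    rw [map_sub, h3, map_sub, hP, add_apply, h4]
    abel
  -- the limit of `φₙ` satisfies `G φ + ∫ φ = ∫ (v - M v) = G v + ∫ v`
  have h2 : φ = v := sub_eq_zero.1 (eq_zero_of_compLpL_add_volterra_eq_zero hT G hpos _ h1)
  rw [h2] at hφ
  have h3 : Tendsto (fun n ↦ G.compLpL 2 (timeMeasure T) (ψ n) + M.mul T (volterra X T (ψ n)))
      atTop (𝓝 0) := by
    have h0 : Tendsto (fun n ↦ M.mul T (volterra X T (ψ n))) atTop (𝓝 (M.mul T v)) :=
      ((M.mul T).continuous.tendsto v).comp hφ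
    have h4 := hψ.add (h0.sub hφ)
    rw [sub_add_sub_cancel, sub_self] at h4
    refine h4.congr fun n ↦ ?_
    simp only [hP, add_apply]
    abel
  have h4 := le_of_tendsto_of_tendsto' hφ.norm (h3.norm.const_mul _)
    fun n ↦ norm_volterra_le hT M G hG hpos hc hl hM (ψ n)
  simpa using h4

omit [CompleteSpace X] [SecondCountableTopology X] [InnerProductSpace ℝ X] in
theorem cauchySeq_of_sq_le {b : ℕ → ℕ → ℝ} (hb : ∀ ε > 0, ∃ n₀, ∀ n ≥ n₀, ∀ m ≥ n₀, b n m < ε)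
    {g : ℕ → X} {k : ℝ} (hk : 0 < k) (hg : ∀ n m, k * ‖g n - g m‖ ^ 2 ≤ b n m) : CauchySeq g := by
  refine Metric.cauchySeq_iff.2 fun ε hε ↦ ?_
  obtain ⟨n₀, hn₀⟩ := hb (k * ε ^ 2) (by positivity)
  refine ⟨n₀, fun n hn m hm ↦ ?_⟩
  have h := lt_of_mul_lt_mul_left ((hg n m).trans_lt (hn₀ n hn m hm)) hk.le
  rw [dist_eq_norm]
  exact lt_of_pow_lt_pow_left₀ 2 hε.le h

/-- Existence for `G v(t) + ∫₀ᵗ M v = J* N r₀`, where `G = J* N J`, with `J v` continuous: the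
approximate solutions `xₙ + ∫₀ᵗ ψₙ`, with `J xₙ → r₀`, are Cauchy in `L²(0, T; X)` and their images
under `J` are Cauchy in `C([0, T]; E)`, by the energy estimate. -/
theorem exists_evolution {E : Type*} [NormedAddCommGroup E] [InnerProductSpace ℝ E]
    [CompleteSpace E] (hT : 0 < T) (M : OpFamily X) (J : X →L[ℝ] E) (hJ : DenseRange J)
    (hJinj : Function.Injective J) (N : E →L[ℝ] E)
    (hN : ∀ r s, inner ℝ (N r) s = inner ℝ r (N s)) {κ : ℝ} (hκ : 0 < κ)
    (hNκ : ∀ r, κ * ‖r‖ ^ 2 ≤ inner ℝ (N r) r) {c l : ℝ} (hc : 0 < c) (hl : 0 ≤ l)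
    (hM : ∀ t x, c * ‖x‖ ^ 2 ≤ inner ℝ (M.op t x) x + l * inner ℝ (N (J x)) (J x)) (r₀ : E) :
    ∃ r : C(Icc (0 : ℝ) T, E), r ⟨0, left_mem_Icc.2 hT.le⟩ = r₀ ∧
      ∃ v : Lp X 2 (timeMeasure T),
        (∀ᵐ t ∂(timeMeasure T), ∀ ht : t ∈ Icc 0 T, r ⟨t, ht⟩ = J (v t)) ∧
        ∀ t : Icc (0 : ℝ) T, J.adjoint (N (r t)) =
          J.adjoint (N r₀) - primitive X T t (M.mul T v) := by
  set G : X →L[ℝ] X := J.adjoint ∘L N ∘L J with hGdef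
  have hGin : ∀ x y : X, inner ℝ (G x) y = inner ℝ (N (J x)) (J y) := fun x y ↦
    ContinuousLinearMap.adjoint_inner_left J y (N (J x))
  have hG : ∀ x y, inner ℝ (G x) y = inner ℝ x (G y) := fun x y ↦ by
    have h : inner ℝ (G x) y = inner ℝ (N (J y)) (J x) :=
      (hGin x y).trans ((hN _ _).trans (real_inner_comm _ _))
    exact h.trans ((hGin y x).symm.trans (real_inner_comm _ _))
  have hpos : ∀ x, x ≠ 0 → 0 < inner ℝ (G x) x := fun x hx ↦ by
    have : 0 < ‖J x‖ := norm_pos_iff.2 ((map_ne_zero_iff J hJinj).2 hx)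
    rw [hGin]
    exact lt_of_lt_of_le (by positivity) (hNκ _)
  have hM' : ∀ t x, c * ‖x‖ ^ 2 ≤ inner ℝ (M.op t x) x + l * inner ℝ (G x) x := fun t x ↦ by
    rw [hGin]; exact hM t x
  have hJN : Function.Injective fun r ↦ J.adjoint (N r) := fun r s hrs ↦ by
    have h1 : ∀ x, inner ℝ (N (r - s)) (J x) = 0 := fun x ↦ by
      rw [← ContinuousLinearMap.adjoint_inner_left, map_sub, map_sub, sub_eq_zero.2 hrs,
        inner_zero_left]
    have h2 : inner ℝ (N (r - s)) (r - s) = 0 :=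
      hJ.induction_on (p := fun z ↦ inner ℝ (N (r - s)) z = 0) (r - s)
        (isClosed_eq (by fun_prop) (by fun_prop)) h1
    have h3 := hNκ (r - s)
    rw [h2] at h3
    have h4 : ‖r - s‖ ^ 2 ≤ 0 := nonpos_of_mul_nonpos_right h3 hκ
    exact sub_eq_zero.1 (norm_eq_zero.1 (pow_eq_zero_iff two_ne_zero |>.1
      (le_antisymm h4 (by positivity))))
  set GG := G.compLpL 2 (timeMeasure T) with hGG
  -- approximate solutions `xₙ + ∫ ψₙ`
  obtain ⟨x, hx⟩ : ∃ x : ℕ → X, Tendsto (fun n ↦ J (x n)) atTop (𝓝 r₀) := by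
    obtain ⟨y, hy, hlim⟩ := mem_closure_iff_seq_limit.1 (hJ r₀)
    choose x hx using hy
    exact ⟨x, by rwa [show y = fun n ↦ J (x n) from funext fun n ↦ (hx n).symm] at hlim⟩
  have hd := denseRange_compLpL_add_mul_volterra hT M G hG hpos hc hl hM'
  have hex : ∀ n : ℕ, ∃ ψ, ‖GG ψ + M.mul T (constL X T (x n) + volterra X T ψ)‖ <
      1 / ((n : ℝ) + 1) := fun n ↦ by
    obtain ⟨ψ, hψ⟩ := hd.exists_dist_lt (-(M.mul T (constL X T (x n))))
      (ε := 1 / ((n : ℝ) + 1)) (by positivity)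
    refine ⟨ψ, ?_⟩
    rw [dist_comm, dist_eq_norm] at hψ
    have h1 : GG ψ + M.mul T (constL X T (x n) + volterra X T ψ) =
        GG ψ + M.mul T (volterra X T ψ) - -(M.mul T (constL X T (x n))) := by
      rw [map_add]; abel
    rw [h1]
    exact hψ
  choose ψ hψ using hex
  set φ : ℕ → Lp X 2 (timeMeasure T) := fun n ↦ constL X T (x n) + volterra X T (ψ n) with hφ
  set F : ℕ → Lp X 2 (timeMeasure T) := fun n ↦ GG (ψ n) + M.mul T (φ n) with hF
  have hF0 : Tendsto F atTop (𝓝 0) :=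
    squeeze_zero_norm (fun n ↦ (hψ n).le) tendsto_one_div_add_atTop_nhds_zero_nat
  -- the energy estimate for differences of approximate solutions
  set b : ℕ → ℕ → ℝ := fun n m ↦ ‖N‖ * ‖J (x n) - J (x m)‖ ^ 2 + c⁻¹ * ‖F n - F m‖ ^ 2 with hb
  have hbd : ∀ n m, inner ℝ (G (x n - x m)) (x n - x m) + c⁻¹ * ‖GG (ψ n - ψ m) +
      M.mul T (constL X T (x n - x m) + volterra X T (ψ n - ψ m))‖ ^ 2 ≤ b n m := fun n m ↦ by
    have h1 : GG (ψ n - ψ m) + M.mul T (constL X T (x n - x m) + volterra X T (ψ n - ψ m)) =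
        F n - F m := by
      simp only [hF, hφ, map_sub, map_add]; abel
    rw [h1, hGin, map_sub]
    refine add_le_add ?_ le_rfl
    refine (real_inner_le_norm _ _).trans ?_
    rw [pow_two, ← mul_assoc]
    gcongr
    exact N.le_opNorm _
  have hb0 : ∀ ε > 0, ∃ n₀, ∀ n ≥ n₀, ∀ m ≥ n₀, b n m < ε := by
    have hlim : Tendsto (fun p : ℕ × ℕ ↦ b p.1 p.2) atTop (𝓝 0) := by
      have h1 : Tendsto (fun p : ℕ × ℕ ↦ p.1) atTop atTop := by
        rw [← prod_atTop_atTop_eq]; exact tendsto_fst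
      have h2 : Tendsto (fun p : ℕ × ℕ ↦ p.2) atTop atTop := by
        rw [← prod_atTop_atTop_eq]; exact tendsto_snd
      have h3 := ((((hx.comp h1).sub (hx.comp h2)).norm.pow 2).const_mul ‖N‖).add
        ((((hF0.comp h1).sub (hF0.comp h2)).norm.pow 2).const_mul c⁻¹)
      simpa using h3
    intro ε hε
    obtain ⟨⟨n₁, n₂⟩, hn⟩ := eventually_atTop.1 (hlim.eventually_lt_const hε)
    exact ⟨max n₁ n₂, fun n h m h' ↦ hn (n, m)
      ⟨(le_max_left _ _).trans h, (le_max_right _ _).trans h'⟩⟩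
  obtain ⟨v, hv⟩ : ∃ v, Tendsto φ atTop (𝓝 v) := by
    refine cauchySeq_tendsto_of_complete
      (cauchySeq_of_sq_le hb0 (k := Real.exp (-2 * l * T) * c) (by positivity) fun n m ↦ ?_)
    have h := (energy_estimate hT M G hG hc hl hM' (x n - x m) (ψ n - ψ m)).2.trans (hbd n m)
    have h1 : φ n - φ m = constL X T (x n - x m) + volterra X T (ψ n - ψ m) := by
      simp only [hφ, map_sub]; abel
    rw [h1, mul_assoc]
    refine le_trans ?_ h
    gcongr
    rw [hGin]
    exact le_add_of_nonneg_left (le_trans (by positivity) (hNκ _))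
  set R : ℕ → C(Icc (0 : ℝ) T, E) := fun n ↦
    ⟨fun t ↦ J (x n + primitive X T t (ψ n)), by
      have := continuous_primitive (ψ n)
      fun_prop⟩ with hR
  obtain ⟨r, hr⟩ : ∃ r, Tendsto R atTop (𝓝 r) := by
    refine cauchySeq_tendsto_of_complete
      (cauchySeq_of_sq_le hb0 (k := Real.exp (-2 * l * T) * κ) (by positivity) fun n m ↦ ?_)
    have hbnn : 0 ≤ b n m := by positivity
    have hle : ‖R n - R m‖ ≤ Real.sqrt ((Real.exp (-2 * l * T) * κ)⁻¹ * b n m) := by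
      refine (ContinuousMap.norm_le _ (Real.sqrt_nonneg _)).2 fun t ↦ Real.le_sqrt_of_sq_le ?_
      have h := ((energy_estimate hT M G hG hc hl hM' (x n - x m) (ψ n - ψ m)).1 t t.2).trans
        (hbd n m)
      have h1 : (R n - R m) t = J (x n - x m + primitive X T t (ψ n - ψ m)) := by
        simp only [hR, ContinuousMap.sub_apply, ContinuousMap.coe_mk, map_sub, map_add]; abel
      rw [h1, inv_mul_eq_div, le_div_iff₀ (by positivity), mul_comm]
      refine le_trans ?_ h
      rw [hGin, mul_assoc]
      have h2 : Real.exp (-2 * l * T) ≤ Real.exp (-2 * l * t) := by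
        rw [Real.exp_le_exp]; nlinarith [mul_le_mul_of_nonneg_left t.2.2 hl]
      exact mul_le_mul h2 (hNκ _) (by positivity) (by positivity)
    have h3 := pow_le_pow_left₀ (norm_nonneg _) hle 2
    rw [Real.sq_sqrt (by positivity)] at h3
    calc _ ≤ Real.exp (-2 * l * T) * κ * ((Real.exp (-2 * l * T) * κ)⁻¹ * b n m) := by gcongr
      _ = b n m := by rw [mul_inv_cancel_left₀ (by positivity)]
  have hrt : ∀ t : Icc (0 : ℝ) T, Tendsto (fun n ↦ R n t) atTop (𝓝 (r t)) := fun t ↦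
    ((ContinuousEvalConst.continuous_eval_const t).tendsto r).comp hr
  have hident : ∀ t : Icc (0 : ℝ) T, J.adjoint (N (r t)) =
      J.adjoint (N r₀) - primitive X T t (M.mul T v) := fun t ↦ by
    have h1 : ∀ n, J.adjoint (N (R n t)) = J.adjoint (N (J (x n))) +
        (primitive X T t (F n) - primitive X T t (M.mul T (φ n))) := fun n ↦ by
      simp only [hF, map_add, add_sub_cancel_right]
      rw [hGG, primitive_compLpL]
      simp only [hR, ContinuousMap.coe_mk, map_add, hGdef, ContinuousLinearMap.comp_apply]
    have h2 : Tendsto (fun n ↦ J.adjoint (N (R n t))) atTop (𝓝 (J.adjoint (N (r t)))) :=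
      ((J.adjoint ∘L N).continuous.tendsto _).comp (hrt t)
    have h3 := ((((J.adjoint ∘L N).continuous.tendsto _).comp hx).add
      ((((primitive X T t).continuous.tendsto _).comp hF0).sub
        (((primitive X T t ∘L M.mul T).continuous.tendsto _).comp hv)))
    have h4 := tendsto_nhds_unique h2 (h3.congr fun n ↦ (h1 n).symm)
    rw [h4, map_zero, zero_sub, sub_eq_add_neg]
    rfl
  have hprim0 : ∀ w, primitive X T 0 w = 0 := fun w ↦ by
    rw [primitive_apply, intervalIntegral.integral_same]
  refine ⟨r, ?_, v, ?_, hident⟩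
  · exact hJN (by simpa [hprim0] using hident ⟨0, left_mem_Icc.2 hT.le⟩)
  · have h1 : GG v = constL X T (J.adjoint (N r₀)) - volterra X T (M.mul T v) := by
      have h2 : ∀ n, GG (φ n) = constL X T (J.adjoint (N (J (x n)))) +
          (volterra X T (F n) - volterra X T (M.mul T (φ n))) := fun n ↦ by
        have h5 : GG (constL X T (x n)) = constL X T (G (x n)) := by
          refine Lp.ext ?_
          filter_upwards [G.coeFn_compLpL (constL X T (x n)), coeFn_constL (T := T) (x n),
            coeFn_constL (T := T) (G (x n))] with t h1 h2 h3
          rw [h1, h2, h3]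
        simp only [hF, map_add, add_sub_cancel_right]
        rw [hGG, volterra_compLpL, ← hGG]
        simp only [hφ, map_add, h5]
        rfl
      have h3 := ((((constL X T ∘L J.adjoint ∘L N).continuous.tendsto _).comp hx).add
        ((((volterra X T).continuous.tendsto _).comp hF0).sub
          (((volterra X T ∘L M.mul T).continuous.tendsto _).comp hv)))
      have h4 := tendsto_nhds_unique ((GG.continuous.tendsto _).comp hv)
        (h3.congr fun n ↦ (h2 n).symm)
      rw [h4, map_zero, zero_sub, sub_eq_add_neg]
      rfl
    filter_upwards [G.coeFn_compLpL v, Lp.coeFn_sub (constL X T (J.adjoint (N r₀)))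
      (volterra X T (M.mul T v)), coeFn_constL (T := T) (J.adjoint (N r₀)),
      coeFn_volterra (M.mul T v)] with t h2 h3 h4 h5 ht
    refine hJN ?_
    have h6 : G (v t) = J.adjoint (N (r ⟨t, ht⟩)) := by
      rw [← h2, ← hGG, h1, h3, Pi.sub_apply, h4, h5, hident]
    exact h6.symm

end Evolution

/-! ### Test functions -/

section Test

variable {d : ℕ}

theorem memLp_test (φ : Test d) (p : ℝ≥0∞) : MemLp φ p volume :=
  φ.continuous.memLp_of_hasCompactSupport φ.hasCompactSupport

/-- The inclusion of test functions into `L²`. -/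
def testL2 : Test d →ₗ[ℝ] L2 d where
  toFun φ := (memLp_test φ 2).toLp φ
  map_add' _ _ := rfl
  map_smul' _ _ := rfl

theorem coeFn_testL2 (φ : Test d) : testL2 φ =ᵐ[volume] φ := MemLp.coeFn_toLp (memLp_test φ 2)

theorem locallyIntegrable_coeFn (v : L2 d) : LocallyIntegrable (⇑v) volume :=
  (Lp.memLp v).locallyIntegrable (by norm_num)

theorem inner_testL2 (v : L2 d) (φ : Test d) : inner ℝ v (testL2 φ) = ∫ x, φ x * v x := by
  rw [L2.inner_def]
  refine integral_congr_ae ((coeFn_testL2 φ).mono fun x hx ↦ ?_)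
  simp [hx]

theorem regular_coeFn_apply (v : L2 d) (φ : Test d) : regular (⇑v) φ = inner ℝ v (testL2 φ) := by
  rw [regular_apply (locallyIntegrable_coeFn v), inner_testL2]

theorem regular_congr {g h : Space d → ℝ} (hg : LocallyIntegrable g volume)
    (hgh : g =ᵐ[volume] h) : regular g = regular h := by
  ext φ
  refine (regular_apply hg φ).trans (Eq.trans ?_ (regular_apply (hg.congr hgh) φ).symm)
  exact integral_congr_ae (hgh.mono fun x hx ↦ by simp only [hx])

theorem eq_zero_of_forall_inner_testL2 (v : L2 d) (h : ∀ φ, inner ℝ v (testL2 φ) = 0) :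
    v = 0 := by
  refine Lp.eq_zero_iff_ae_eq_zero.2 ?_
  refine ae_eq_zero_of_integral_contDiff_smul_eq_zero (locallyIntegrable_coeFn v)
    fun g hg hgc ↦ ?_
  have := h ⟨g, hg, hgc, subset_univ _⟩
  rw [inner_testL2] at this
  exact this

/-- The partial derivative of a test function. -/
def pd (i : Fin d) : Test d →ₗ[ℝ] Test d :=
  (TestFunction.lineDerivCLM ℝ (EuclideanSpace.single i (1 : ℝ)) : Test d →L[ℝ] Test d)

theorem differentiable_test (φ : Test d) : Differentiable ℝ φ :=
  φ.contDiff.differentiable (by simp)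

theorem pd_apply (i : Fin d) (φ : Test d) (x : Space d) :
    pd i φ x = fderiv ℝ φ x (EuclideanSpace.single i 1) := by
  rw [← (differentiable_test φ x).lineDeriv_eq_fderiv]
  exact TestFunction.lineDerivCLM_apply_of_le (by simp)

theorem partialD_apply (i : Fin d) (S : Distr d) (φ : Test d) :
    partialD i S φ = -S (pd i φ) := rfl

theorem pd_comm (i j : Fin d) (φ : Test d) : pd i (pd j φ) = pd j (pd i φ) := by
  have key : ∀ i j : Fin d, ∀ x, pd i (pd j φ) x = fderiv ℝ (fderiv ℝ φ) x
      (EuclideanSpace.single i 1) (EuclideanSpace.single j 1) := fun i j x ↦ by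
    rw [pd_apply, show (⇑(pd j φ) : Space d → ℝ) =
      fun y ↦ fderiv ℝ φ y (EuclideanSpace.single j 1) from funext (pd_apply j φ)]
    have h : DifferentiableAt ℝ (fderiv ℝ φ) x :=
      ((φ.contDiff.fderiv_right (m := 1) (by norm_cast)).differentiable (by simp)) x
    rw [fderiv_clm_apply h (differentiableAt_const _)]
    simp
  ext x
  rw [key, key]
  exact (φ.contDiff.contDiffAt.isSymmSndFDerivAt (by
    rw [minSmoothness_of_isRCLikeNormedField]; norm_cast)).eq _ _

/-- The product of two test functions. -/
def testMul (φ ψ : Test d) : Test d where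
  toFun x := φ x * ψ x
  contDiff' := φ.contDiff.mul ψ.contDiff
  hasCompactSupport' := φ.hasCompactSupport.mul_right
  tsupport_subset' := subset_univ _

theorem testMul_apply (φ ψ : Test d) (x : Space d) : testMul φ ψ x = φ x * ψ x := rfl

theorem pd_testMul (i : Fin d) (φ ψ : Test d) (x : Space d) :
    pd i (testMul φ ψ) x = pd i φ x * ψ x + φ x * pd i ψ x := by
  rw [pd_apply, pd_apply, pd_apply,
    show (⇑(testMul φ ψ) : Space d → ℝ) = fun x ↦ φ x * ψ x from rfl,
    fderiv_fun_mul (differentiable_test φ x) (differentiable_test ψ x)]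
  simp [mul_comm, add_comm]

theorem inner_pd_right (i : Fin d) (φ ψ : Test d) :
    inner ℝ (testL2 φ) (testL2 (pd i ψ)) = -inner ℝ (testL2 (pd i φ)) (testL2 ψ) := by
  have hint : ∀ φ ψ : Test d, Integrable (fun x ↦ φ x * ψ x) volume := fun φ ψ ↦
    (memLp_test φ 2).integrable_mul (memLp_test ψ 2)
  have h : ∀ φ ψ : Test d, inner ℝ (testL2 φ) (testL2 ψ) = ∫ x, φ x * ψ x := fun φ ψ ↦ by
    rw [inner_testL2]
    refine integral_congr_ae ((coeFn_testL2 φ).mono fun x hx ↦ ?_)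
    simp only [hx, mul_comm]
  rw [h, h]
  simp only [pd_apply]
  have h1 := hint (pd i φ) ψ
  have h2 := hint φ (pd i ψ)
  simp only [pd_apply] at h1 h2
  exact integral_mul_fderiv_eq_neg_fderiv_mul_of_integrable h1 h2 (hint φ ψ)
    (fun x _ ↦ differentiable_test φ x) (fun x _ ↦ differentiable_test ψ x)

theorem partialD_regular_testL2 (i : Fin d) (φ : Test d) :
    partialD i (regular (⇑(testL2 φ))) = regular (⇑(testL2 (pd i φ))) := by
  ext ψ
  change partialD i (regular (⇑(testL2 φ))) ψ = regular (⇑(testL2 (pd i φ))) ψ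
  rw [partialD_apply, regular_coeFn_apply, regular_coeFn_apply, inner_pd_right, neg_neg]

/-- A test function as an element of `H¹`. -/
def testH1 (φ : Test d) : H1 d :=
  ⟨WithLp.toLp 2 (testL2 φ, WithLp.toLp 2 fun i ↦ testL2 (pd i φ)),
    fun i ↦ partialD_regular_testL2 i φ⟩

end Test

/-! ### Multiplication by bounded functions -/

section Mul

variable {d : ℕ}

/-- Multiplication by a function `m ∈ L^∞`, as an operator of `L²`; it is `0` if `m ∉ L^∞`. -/
def mulL (m : Space d → ℝ) : L2 d →L[ℝ] L2 d :=
  open Classical in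
  if hm : MemLp m ∞ volume then
    (ContinuousLinearMap.mul ℝ ℝ).holderL volume ∞ 2 2 (hm.toLp m)
  else 0

theorem coeFn_mulL {m : Space d → ℝ} (hm : MemLp m ∞ volume) (v : L2 d) :
    mulL m v =ᵐ[volume] fun x ↦ m x * v x := by
  rw [mulL, dif_pos hm, ContinuousLinearMap.holderL_apply_apply]
  filter_upwards [(ContinuousLinearMap.mul ℝ ℝ).coeFn_holder (r := 2) (hm.toLp m) v,
    hm.coeFn_toLp] with x h1 h2
  rw [h1, h2]
  rfl

theorem inner_mulL_left {m : Space d → ℝ} (hm : MemLp m ∞ volume) (v w : L2 d) :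
    inner ℝ (mulL m v) w = ∫ x, m x * v x * w x := by
  rw [L2.inner_def]
  refine integral_congr_ae ((coeFn_mulL hm v).mono fun x hx ↦ ?_)
  simp only [hx, RCLike.inner_apply, conj_trivial, mul_comm]

theorem inner_mulL_comm {m : Space d → ℝ} (hm : MemLp m ∞ volume) (v w : L2 d) :
    inner ℝ (mulL m v) w = inner ℝ v (mulL m w) := by
  rw [real_inner_comm (mulL m w) v, inner_mulL_left hm, inner_mulL_left hm]
  congr 1
  ext x
  ring

theorem regular_mul {m : Space d → ℝ} (hm : MemLp m ∞ volume) (v : L2 d) :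
    regular (fun x ↦ m x * v x) = regular (⇑(mulL m v)) :=
  (regular_congr (locallyIntegrable_coeFn _) (coeFn_mulL hm v)).symm

theorem norm_mulL_le {m : Space d → ℝ} (hm : MemLp m ∞ volume) {b : ℝ}
    (hb : ∀ᵐ x, |m x| ≤ b) (v : L2 d) : ‖mulL m v‖ ≤ b * ‖v‖ := by
  refine Lp.norm_le_mul_norm_of_ae_le_mul ?_
  filter_upwards [coeFn_mulL hm v, hb] with x h1 h2
  rw [h1, norm_mul]
  gcongr
  exact h2

theorem mulL_testL2_comm {a : Space d → ℝ} (ha : MemLp a ∞ volume) (φ ψ : Test d) :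
    inner ℝ (mulL a (testL2 φ)) (testL2 ψ) = ∫ x, testMul φ ψ x * a x := by
  rw [inner_mulL_left ha]
  refine integral_congr_ae ?_
  filter_upwards [coeFn_testL2 φ, coeFn_testL2 ψ] with x h1 h2
  rw [h1, h2, testMul_apply]
  ring

/-- Integration by parts against a `W^{1,∞}` coefficient, for test functions. -/
theorem W1Infty.inner_mulL_pd (a : W1Infty d) (k : Fin d) (φ ψ : Test d) :
    inner ℝ (mulL a.val (testL2 φ)) (testL2 (pd k ψ)) =
      -inner ℝ (mulL (a.grad k) (testL2 φ)) (testL2 ψ) -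
        inner ℝ (mulL a.val (testL2 (pd k φ))) (testL2 ψ) := by
  have hl : LocallyIntegrable a.val volume := a.memLp_val.locallyIntegrable le_top
  have hl' : LocallyIntegrable (a.grad k) volume := (a.memLp_grad k).locallyIntegrable le_top
  have h := congrArg (fun S : Distr d ↦ S (testMul φ ψ)) (a.weak_grad k)
  simp only [partialD_apply, regular_apply hl, regular_apply hl'] at h
  have hi : ∀ φ : Test d, Integrable (fun x ↦ φ x * a.val x) := fun φ ↦
    hl.integrable_smul_left_of_hasCompactSupport φ.continuous φ.hasCompactSupport
  rw [mulL_testL2_comm a.memLp_val, mulL_testL2_comm a.memLp_val,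
    mulL_testL2_comm (a.memLp_grad k), ← h, neg_neg, ← integral_sub (hi _) (hi _)]
  congr 1
  ext x
  rw [pd_testMul, testMul_apply, testMul_apply]
  ring

end Mul

/-! ### Density of `(1 - Δ) C_c^∞` in `L²` -/

section Helmholtz

variable {d : ℕ}

/-- `φ ↦ φ - Δφ` on test functions. -/
def helmholtz : Test d →ₗ[ℝ] Test d := LinearMap.id - ∑ i, pd i ∘ₗ pd i

theorem helmholtz_apply (φ : Test d) : helmholtz φ = φ - ∑ i, pd i (pd i φ) := by
  simp [helmholtz]

/-- The test function `y ↦ η (x - y)`. -/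
def reflect (x : Space d) (η : Test d) : Test d where
  toFun y := η (x - y)
  contDiff' := η.contDiff.comp (contDiff_const.sub contDiff_id)
  hasCompactSupport' := η.hasCompactSupport.comp_homeomorph (Homeomorph.subLeft x)
  tsupport_subset' := subset_univ _

theorem reflect_apply (x y : Space d) (η : Test d) : reflect x η y = η (x - y) := rfl

theorem pd_reflect (i : Fin d) (x : Space d) (η : Test d) :
    pd i (reflect x η) = -reflect x (pd i η) := by
  ext y
  have h : HasFDerivAt (fun y ↦ η (x - y)) ((fderiv ℝ η (x - y)).comp
      (-ContinuousLinearMap.id ℝ (Space d))) y :=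
    (differentiable_test η (x - y)).hasFDerivAt.comp y ((hasFDerivAt_id y).const_sub x)
  rw [pd_apply, show (⇑(reflect x η) : Space d → ℝ) = fun y ↦ η (x - y) from rfl, h.fderiv]
  change _ = -(reflect x (pd i η) y)
  rw [reflect_apply, pd_apply]
  simp

/-- `x ↦ ∫ w(y) η(x - y) dy`. -/
def mollify (w : L2 d) (η : Test d) (x : Space d) : ℝ := inner ℝ w (testL2 (reflect x η))

theorem mollify_eq_convolution (w : L2 d) (η : Test d) :
    mollify w η = (⇑w ⋆[ContinuousLinearMap.mul ℝ ℝ, volume] ⇑η) := by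
  ext x
  rw [mollify, inner_testL2, convolution_def]
  simp only [reflect_apply, ContinuousLinearMap.mul_apply', mul_comm]

theorem hasFDerivAt_mollify (w : L2 d) (η : Test d) (x : Space d) :
    ∃ D : Space d →L[ℝ] ℝ, HasFDerivAt (mollify w η) D x ∧
      ∀ i, D (EuclideanSpace.single i 1) = mollify w (pd i η) x := by
  have hη : ContDiff ℝ 1 η := η.contDiff.of_le (by norm_cast)
  have h := η.hasCompactSupport.hasFDerivAt_convolution_right (ContinuousLinearMap.mul ℝ ℝ)
    (locallyIntegrable_coeFn w) hη x
  refine ⟨_, mollify_eq_convolution w η ▸ h, fun i ↦ ?_⟩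
  rw [convolution_precompR_apply _ (locallyIntegrable_coeFn w) (η.hasCompactSupport.fderiv ℝ)
    (hη.continuous_fderiv (by simp)), mollify_eq_convolution]
  congr 1

theorem hasDerivAt_mollify (w : L2 d) (η : Test d) (x : Space d) (i : Fin d) (s : ℝ) :
    HasDerivAt (fun s : ℝ ↦ mollify w η (x + s • EuclideanSpace.single i 1))
      (mollify w (pd i η) (x + s • EuclideanSpace.single i 1)) s := by
  obtain ⟨D, hD, hDi⟩ := hasFDerivAt_mollify w η (x + s • EuclideanSpace.single i 1)
  have h : HasDerivAt (fun s : ℝ ↦ x + s • (EuclideanSpace.single i 1 : Space d))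
      (EuclideanSpace.single i 1) s := by
    simpa using ((hasDerivAt_id s).smul_const (EuclideanSpace.single i 1 : Space d)).const_add x
  rw [← hDi]
  exact hD.comp_hasDerivAt s h

theorem exists_mollify_le (w : L2 d) (η : Test d) : ∃ b, ∀ x, |mollify w η x| ≤ b := by
  refine ⟨‖w‖ * ‖testL2 η‖, fun x ↦ ?_⟩
  refine (abs_real_inner_le_norm _ _).trans (le_of_eq ?_)
  congr 1
  have h : ∀ φ : Test d, ‖testL2 φ‖ ^ 2 = ∫ y, φ y * φ y := fun φ ↦ by
    rw [← real_inner_self_eq_norm_sq, inner_testL2]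
    exact integral_congr_ae ((coeFn_testL2 φ).mono fun y hy ↦ by simp only [hy])
  refine (pow_left_inj₀ (norm_nonneg _) (norm_nonneg _) two_ne_zero).1 ?_
  rw [h, h]
  exact integral_sub_left_eq_self (fun y ↦ η y * η y) volume x

/-- The second derivative is nonpositive at a maximum. -/
theorem second_deriv_nonpos_of_forall_le {g g' : ℝ → ℝ} {g₂ s : ℝ} (hg : ∀ s, HasDerivAt g (g' s) s)
    (hg' : HasDerivAt g' g₂ s) (hmax : ∀ r, g r ≤ g s) : g₂ ≤ 0 := by
  by_contra! hpos
  have hd : deriv g = g' := funext fun r ↦ (hg r).deriv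
  have hlm : IsLocalMax g s := Eventually.of_forall hmax
  have hmin : IsLocalMin g s := isLocalMin_of_deriv_deriv_pos
    (by rw [hd, hg'.deriv]; exact hpos) hlm.deriv_eq_zero (hg s).continuousAt
  have hconst : g =ᶠ[𝓝 s] fun _ ↦ g s := hmin.mono fun r hr ↦ le_antisymm (hmax r) hr
  have h0 : deriv g =ᶠ[𝓝 s] fun _ ↦ 0 := by
    simpa using hconst.deriv
  have h1 := h0.deriv_eq
  rw [hd, hg'.deriv, deriv_const] at h1
  exact hpos.ne' h1

/-- The maximum principle: `W = mollify w η` is bounded and solves `W - ΔW = 0`. As `W` need not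
attain its supremum, the second derivative test is applied at a maximum `x₀` of `W - ε ‖·‖²`. -/
theorem mollify_le_zero (w : L2 d) (hw : ∀ φ, inner ℝ w (testL2 (helmholtz φ)) = 0) (η : Test d)
    (x : Space d) : mollify w η x ≤ 0 := by
  obtain ⟨b, hb⟩ := exists_mollify_le w η
  have hcont : Continuous (mollify w η) := continuous_iff_continuousAt.2 fun x ↦ by
    obtain ⟨D, hD, -⟩ := hasFDerivAt_mollify w η x
    exact hD.continuousAt
  have hlap : ∀ x, mollify w η x = ∑ i, mollify w (pd i (pd i η)) x := fun x ↦ by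
    have h := hw (reflect x η)
    rw [helmholtz_apply, map_sub, inner_sub_right, map_sum, inner_sum, sub_eq_zero] at h
    rw [mollify, h]
    refine Finset.sum_congr rfl fun i _ ↦ ?_
    rw [pd_reflect, map_neg, pd_reflect, neg_neg, mollify]
  have key : ∀ ε > 0, mollify w η x ≤ ε * (2 * d + ‖x‖ ^ 2) := fun ε hε ↦ by
    have hlim : Tendsto (fun y ↦ mollify w η y - ε * ‖y‖ ^ 2) (cocompact (Space d)) atBot := by
      have h1 : Tendsto (fun y : Space d ↦ ε * ‖y‖ ^ 2) (cocompact (Space d)) atTop :=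
        (((tendsto_pow_atTop two_ne_zero).comp
          (tendsto_norm_cocompact_atTop)).const_mul_atTop hε)
      simp only [sub_eq_add_neg]
      exact tendsto_atBot_add_left_of_ge _ b (fun y ↦ (le_abs_self _).trans (hb y))
        (tendsto_neg_atTop_atBot.comp h1)
    obtain ⟨x₀, hx₀⟩ := (hcont.sub (by fun_prop : Continuous fun y : Space d ↦ ε * ‖y‖ ^ 2)
      ).exists_forall_ge hlim
    have hi : ∀ i, mollify w (pd i (pd i η)) x₀ ≤ 2 * ε := fun i ↦ by
      have hn : ∀ s : ℝ, ‖x₀ + s • (EuclideanSpace.single i 1 : Space d)‖ ^ 2 =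
          ‖x₀‖ ^ 2 + 2 * s * x₀ i + s ^ 2 := fun s ↦ by
        rw [norm_add_sq_real, real_inner_smul_right, norm_smul, mul_pow]
        simp [EuclideanSpace.inner_single_right]
        ring
      have h1 : ∀ s, HasDerivAt (fun s : ℝ ↦ mollify w η (x₀ + s • EuclideanSpace.single i 1) -
          ε * (‖x₀‖ ^ 2 + 2 * s * x₀ i + s ^ 2))
          (mollify w (pd i η) (x₀ + s • EuclideanSpace.single i 1) -
            ε * (2 * x₀ i + 2 * s)) s := fun s ↦ by
        refine (hasDerivAt_mollify w η x₀ i s).sub (HasDerivAt.const_mul ε ?_)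
        have := ((((hasDerivAt_id s).const_mul 2).mul_const (x₀ i)).const_add (‖x₀‖ ^ 2)).fun_add
          (hasDerivAt_pow 2 s)
        simpa using this
      have h2 : HasDerivAt (fun s : ℝ ↦ mollify w (pd i η) (x₀ + s • EuclideanSpace.single i 1) -
            ε * (2 * x₀ i + 2 * s)) (mollify w (pd i (pd i η)) (x₀ + (0 : ℝ) •
              EuclideanSpace.single i 1) - ε * 2) 0 := by
        refine (hasDerivAt_mollify w (pd i η) x₀ i 0).sub (HasDerivAt.const_mul ε ?_)
        simpa using ((hasDerivAt_id (0 : ℝ)).const_mul 2).const_add (2 * x₀ i)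
      have h3 := second_deriv_nonpos_of_forall_le h1 h2 (fun r ↦ by
        have := hx₀ (x₀ + r • EuclideanSpace.single i 1)
        simp only [Pi.sub_apply] at this
        rw [hn] at this
        simpa using this)
      rw [zero_smul, add_zero] at h3
      linarith
    have h1 : mollify w η x₀ ≤ d * (2 * ε) := by
      rw [hlap]
      refine (Finset.sum_le_card_nsmul _ _ _ fun i _ ↦ hi i).trans ?_
      simp
    have h2 := hx₀ x
    simp only [Pi.sub_apply] at h2
    nlinarith [mul_nonneg hε.le (sq_nonneg ‖x₀‖)]
  refine le_of_forall_pos_le_add fun ε hε ↦ ?_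
  have h := key (ε / (2 * d + ‖x‖ ^ 2 + 1)) (by positivity)
  rw [zero_add]
  refine h.trans ?_
  rw [div_mul_eq_mul_div, div_le_iff₀ (by positivity)]
  nlinarith

/-- A function `w` orthogonal to `(1 - Δ) C_c^∞` has mollifications which vanish. -/
theorem denseRange_helmholtz : DenseRange (testL2 ∘ₗ helmholtz (d := d)) := by
  refine denseRange_of_forall_inner_eq_zero _ fun w hw ↦ eq_zero_of_forall_inner_testL2 w fun φ ↦ ?_
  have hrefl : ∀ φ : Test d, reflect 0 (reflect 0 φ) = φ := fun φ ↦ by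
    ext y
    simp [reflect_apply]
  have hle : ∀ φ, inner ℝ w (testL2 φ) ≤ 0 := fun φ ↦ by
    have := mollify_le_zero w hw (reflect 0 φ) 0
    rwa [mollify, hrefl] at this
  -- applying this to `-φ` gives the reverse inequality
  have h := hle (-φ)
  rw [map_neg, inner_neg_right] at h
  linarith [hle φ]

end Helmholtz

/-! ### The Sobolev space `H¹` -/

/-- A Hilbert space `E` presented as the Sobolev space `H¹(ℝᵈ)`: it comes with the inclusion into
`L²`, the weak derivatives, and the test functions it contains, and its inner product is the one of
`H¹`. The operator theory of this file is developed for such an abstract `E`, so that it never has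
to unfold the submodule which encodes `H¹`. -/
structure SobolevModel (d : ℕ) (E : Type*) [NormedAddCommGroup E] [InnerProductSpace ℝ E] where
  /-- the inclusion `H¹ ⊂ L²` -/
  incl : E →L[ℝ] L2 d
  /-- the weak partial derivatives -/
  weakD : Fin d → E →L[ℝ] L2 d
  /-- the inclusion of the test functions -/
  test : Test d →ₗ[ℝ] E
  inner_eq : ∀ p q, inner ℝ p q = inner ℝ (incl p) (incl q) + ∑ i, inner ℝ (weakD i p) (weakD i q)
  inner_weakD : ∀ i p φ, inner ℝ (weakD i p) (testL2 φ) = -inner ℝ (incl p) (testL2 (pd i φ))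
  incl_test : ∀ φ, incl (test φ) = testL2 φ
  weakD_test : ∀ i φ, weakD i (test φ) = testL2 (pd i φ)

namespace SobolevModel

variable {d : ℕ} {E : Type*} [NormedAddCommGroup E] [InnerProductSpace ℝ E] (S : SobolevModel d E)

theorem norm_sq (p : E) : ‖p‖ ^ 2 = ‖S.incl p‖ ^ 2 + ∑ i, ‖S.weakD i p‖ ^ 2 := by
  simp only [← real_inner_self_eq_norm_sq, S.inner_eq]

theorem eq_zero_of_incl_eq_zero (p : E) (hp : S.incl p = 0) : p = 0 := by
  have h : ∀ i, S.weakD i p = 0 := fun i ↦ eq_zero_of_forall_inner_testL2 _ fun φ ↦ by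
    rw [S.inner_weakD, hp, inner_zero_left, neg_zero]
  have h2 := S.norm_sq p
  simp only [hp, h, norm_zero] at h2
  simpa using h2

variable [CompleteSpace E]

/-- An element of `H¹` orthogonal to all test functions `φ` is orthogonal in `L²` to `φ - Δφ`. -/
theorem denseRange_test : DenseRange S.test := by
  refine denseRange_of_forall_inner_eq_zero S.test fun p hp ↦
    S.eq_zero_of_incl_eq_zero p ?_
  have h : ∀ φ : Test d, inner ℝ (S.incl p) (testL2 (helmholtz φ)) = 0 := fun φ ↦ by
    have h1 := hp φ
    simp only [S.inner_eq, S.incl_test, S.weakD_test, S.inner_weakD] at h1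
    rw [helmholtz_apply, map_sub, map_sum, inner_sub_right, inner_sum]
    rw [Finset.sum_neg_distrib] at h1
    linarith
  have h2 : inner ℝ (S.incl p) (S.incl p) = 0 :=
    denseRange_helmholtz.induction_on (p := fun z ↦ inner ℝ (S.incl p) z = 0)
      (S.incl p) (isClosed_eq (by fun_prop) (by fun_prop)) h
  exact inner_self_eq_zero.1 h2

/-- The embedding `L² ⊂ H⁻¹`, the dual `H⁻¹` of `H¹` being identified with `H¹` by the Riesz
isomorphism: it is the Hilbert space adjoint of the inclusion `H¹ ⊂ L²`. -/
def inclAdj : L2 d →L[ℝ] E := S.incl.adjoint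

theorem inner_inclAdj (v : L2 d) (p : E) : inner ℝ (S.inclAdj v) p = inner ℝ v (S.incl p) :=
  ContinuousLinearMap.adjoint_inner_left _ _ _

theorem adjoint_inclAdj : S.inclAdj.adjoint = S.incl :=
  ContinuousLinearMap.adjoint_adjoint _

/-- The operator `-D_i : L² → H⁻¹`, in the Riesz identification of `H⁻¹` with `H¹`. -/
def weakDAdj (i : Fin d) : L2 d →L[ℝ] E := (S.weakD i).adjoint

theorem inner_weakDAdj (i : Fin d) (v : L2 d) (p : E) :
    inner ℝ (S.weakDAdj i v) p = inner ℝ v (S.weakD i p) :=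
  ContinuousLinearMap.adjoint_inner_left _ _ _

theorem denseRange_inclAdj : DenseRange S.inclAdj := by
  have h := denseRange_of_forall_inner_eq_zero
    (S.inclAdj : L2 d →ₗ[ℝ] E) (fun p hp ↦ by
      refine S.eq_zero_of_incl_eq_zero p ?_
      have := hp (S.incl p)
      rw [ContinuousLinearMap.coe_coe, real_inner_comm, S.inner_inclAdj] at this
      exact inner_self_eq_zero.1 this)
  exact h

theorem injective_inclAdj : Function.Injective S.inclAdj := by
  refine (injective_iff_map_eq_zero _).2 fun v hv ↦ eq_zero_of_forall_inner_testL2 v fun φ ↦ ?_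
  rw [← S.incl_test, ← inner_inclAdj, hv, inner_zero_left]

/-- Integration by parts against a `W^{1,∞}` coefficient, for a function of `H¹`. -/
theorem inner_mulL_weakD (a : W1Infty d) (k : Fin d) (p : E) (ψ : Test d) :
    inner ℝ (mulL a.val (S.weakD k p)) (testL2 ψ) =
      -inner ℝ (S.incl p) (mulL a.val (testL2 (pd k ψ)) + mulL (a.grad k) (testL2 ψ)) := by
  refine S.denseRange_test.induction_on (p := fun p ↦
    inner ℝ (mulL a.val (S.weakD k p)) (testL2 ψ) =
      -inner ℝ (S.incl p) (mulL a.val (testL2 (pd k ψ)) + mulL (a.grad k) (testL2 ψ))) p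
    (isClosed_eq (by fun_prop) (by fun_prop)) fun φ ↦ ?_
  have h := a.inner_mulL_pd k φ ψ
  rw [S.incl_test, S.weakD_test, inner_add_right, ← inner_mulL_comm a.memLp_val,
    ← inner_mulL_comm (a.memLp_grad k)]
  linarith

end SobolevModel

/-! ### Elliptic operators -/

section Elliptic

variable {d : ℕ}

/-- `T φ = μ φ - ∑_{i,j} D_j (a_{ij} D_i φ)`, the formal adjoint of `μ + A₀`, on test functions. -/
def formalAdjoint (a : Fin d → Fin d → W1Infty d) (μ : ℝ) : Test d →ₗ[ℝ] L2 d :=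
  μ • testL2 - ∑ i, ∑ j, ((mulL (a i j).val : L2 d →ₗ[ℝ] L2 d) ∘ₗ testL2 ∘ₗ pd j ∘ₗ pd i +
    (mulL ((a i j).grad j) : L2 d →ₗ[ℝ] L2 d) ∘ₗ testL2 ∘ₗ pd i)

theorem formalAdjoint_apply (a : Fin d → Fin d → W1Infty d) (μ : ℝ) (φ : Test d) :
    formalAdjoint a μ φ = μ • testL2 φ - ∑ i, ∑ j, (mulL (a i j).val (testL2 (pd j (pd i φ))) +
      mulL ((a i j).grad j) (testL2 (pd i φ))) := by
  simp [formalAdjoint]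

/-- Ellipticity, integrated. -/
theorem elliptic_L2 {a : Fin d → Fin d → W1Infty d} {γ₀ : ℝ}
    (ha : ∀ᵐ x : Space d, ∀ ξ : Space d,
      γ₀ * ‖ξ‖ ^ 2 ≤ ∑ i, ∑ j, (a i j).val x * ξ i * ξ j) (g : Fin d → L2 d) :
    γ₀ * ∑ i, ‖g i‖ ^ 2 ≤ ∑ i, ∑ j, inner ℝ (mulL (a i j).val (g i)) (g j) := by
  have hi : ∀ v w : L2 d, Integrable (fun x ↦ v x * w x) := fun v w ↦
    (Lp.memLp v).integrable_mul (Lp.memLp w)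
  have h1 : ∀ i, ‖g i‖ ^ 2 = ∫ x, g i x * g i x := fun i ↦ by
    rw [← real_inner_self_eq_norm_sq, L2.inner_def]
    rfl
  have hi' : ∀ i j, Integrable (fun x ↦ (a i j).val x * g i x * g j x) := fun i j ↦
    (hi (mulL (a i j).val (g i)) (g j)).congr
      ((coeFn_mulL (a i j).memLp_val (g i)).mono fun x hx ↦ by simp only [hx])
  simp only [h1, inner_mulL_left (a _ _).memLp_val]
  rw [← integral_finsetSum _ (fun i _ ↦ hi _ _), ← integral_const_mul]
  simp only [← integral_finsetSum _ (fun j _ ↦ hi' _ j)]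
  rw [← integral_finsetSum _ (fun i _ ↦ integrable_finsetSum _ fun j _ ↦ hi' i j)]
  refine integral_mono_ae ((integrable_finsetSum _ fun i _ ↦ hi _ _).const_mul _)
    (integrable_finsetSum _ fun i _ ↦ integrable_finsetSum _ fun j _ ↦ hi' i j) ?_
  filter_upwards [ha] with x hx
  have h := hx (WithLp.toLp 2 fun i ↦ g i x)
  rw [EuclideanSpace.real_norm_sq_eq] at h
  simpa [pow_two] using h

/-- The Lax–Milgram lemma for an operator. -/
theorem exists_inverse_of_coercive {E : Type*} [NormedAddCommGroup E] [InnerProductSpace ℝ E]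
    [CompleteSpace E] (K : E →L[ℝ] E) {c : ℝ} (hc : 0 < c)
    (hK : ∀ p, c * ‖p‖ ^ 2 ≤ inner ℝ (K p) p) :
    ∃ N : E →L[ℝ] E, ∀ p, K (N p) = p := by
  have hco : IsCoercive ((innerSL ℝ : E →L[ℝ] E →L[ℝ] ℝ) ∘L K) :=
    ⟨c, hc, fun p ↦ by
      have := hK p
      rwa [pow_two, ← mul_assoc] at this⟩
  refine ⟨hco.continuousLinearEquivOfBilin.symm, fun p ↦ ?_⟩
  refine ext_inner_right ℝ fun q ↦ ?_
  have h := hco.continuousLinearEquivOfBilin_apply (hco.continuousLinearEquivOfBilin.symm p) q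
  rw [ContinuousLinearEquiv.apply_symm_apply] at h
  exact h.symm

theorem inverse_coercive {E : Type*} [NormedAddCommGroup E] [InnerProductSpace ℝ E]
    (K N : E →L[ℝ] E) {c : ℝ} (hc : 0 < c)
    (hK : ∀ p, c * ‖p‖ ^ 2 ≤ inner ℝ (K p) p) (hN : ∀ p, K (N p) = p) :
    ∃ κ > 0, ∀ p, κ * ‖p‖ ^ 2 ≤ inner ℝ (N p) p := by
  refine ⟨c / (‖K‖ + 1) ^ 2, by positivity, fun p ↦ ?_⟩
  have h1 := hK (N p)
  rw [hN, real_inner_comm] at h1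
  have h2 : ‖p‖ ≤ (‖K‖ + 1) * ‖N p‖ := by
    calc ‖p‖ = ‖K (N p)‖ := by rw [hN]
      _ ≤ ‖K‖ * ‖N p‖ := K.le_opNorm _
      _ ≤ _ := by gcongr; linarith
  refine le_trans ?_ h1
  calc c / (‖K‖ + 1) ^ 2 * ‖p‖ ^ 2 ≤ c / (‖K‖ + 1) ^ 2 * ((‖K‖ + 1) * ‖N p‖) ^ 2 := by gcongr
    _ = c * ‖N p‖ ^ 2 := by field_simp

variable {E : Type*} [NormedAddCommGroup E] [InnerProductSpace ℝ E] [CompleteSpace E]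
  (S : SobolevModel d E)

/-- The operator of the form `μ ∫ p q + ∑_{i,j} ∫ a_{ij} D_j p D_i q` on `H¹`. -/
def SobolevModel.energyOp (a : Fin d → Fin d → W1Infty d) (μ : ℝ) : E →L[ℝ] E :=
  μ • S.inclAdj ∘L S.incl +
    ∑ i, ∑ j, S.weakDAdj i ∘L mulL (a i j).val ∘L S.weakD j

theorem SobolevModel.inner_energyOp (a : Fin d → Fin d → W1Infty d) (μ : ℝ) (p q : E) :
    inner ℝ (S.energyOp a μ p) q = μ * inner ℝ (S.incl p) (S.incl q) +
      ∑ i, ∑ j, inner ℝ (mulL (a i j).val (S.weakD j p)) (S.weakD i q) := by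
  simp only [energyOp, add_apply, smul_apply, sum_apply,
    ContinuousLinearMap.comp_apply, inner_add_left, sum_inner, real_inner_smul_left,
    S.inner_inclAdj, S.inner_weakDAdj]

/-- `S.energyOp a μ` is the weak form of `μ + A₀`. -/
theorem SobolevModel.inner_energyOp_test (a : Fin d → Fin d → W1Infty d) (μ : ℝ) (p : E)
    (φ : Test d) :
    inner ℝ (S.energyOp a μ p) (S.test φ) = inner ℝ (S.incl p) (formalAdjoint a μ φ) := by
  rw [S.inner_energyOp, formalAdjoint_apply, inner_sub_right, real_inner_smul_right, S.incl_test]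
  simp only [S.weakD_test, S.inner_mulL_weakD, inner_sum, Finset.sum_neg_distrib]
  rw [sub_eq_add_neg]

theorem SobolevModel.energyOp_coercive {a : Fin d → Fin d → W1Infty d} {γ₀ : ℝ}
    (ha : ∀ᵐ x : Space d, ∀ ξ : Space d,
      γ₀ * ‖ξ‖ ^ 2 ≤ ∑ i, ∑ j, (a i j).val x * ξ i * ξ j) (μ : ℝ) (p : E) :
    min μ γ₀ * ‖p‖ ^ 2 ≤ inner ℝ (S.energyOp a μ p) p := by
  have h := elliptic_L2 ha fun i ↦ S.weakD i p
  rw [S.inner_energyOp, S.norm_sq, mul_add, real_inner_self_eq_norm_sq]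
  refine add_le_add (by gcongr; exact min_le_left _ _) (le_trans ?_ (h.trans (le_of_eq ?_)))
  · gcongr
    exact min_le_right _ _
  · refine Finset.sum_congr rfl fun i _ ↦ Finset.sum_congr rfl fun j _ ↦ ?_
    rw [inner_mulL_comm (a i j).memLp_val, real_inner_comm]

end Elliptic

/-! ### Density of the range of an elliptic operator in `L²` -/

section Density

variable {d : ℕ}

theorem inner_pd_pd (k l : Fin d) (φ : Test d) :
    inner ℝ (testL2 (pd k (pd k φ))) (testL2 (pd l (pd l φ))) =
      ‖testL2 (pd l (pd k φ))‖ ^ 2 := by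
  rw [inner_pd_right, pd_comm l k (pd k φ), ← inner_pd_right, pd_comm k l φ,
    real_inner_self_eq_norm_sq]

/-- The graph norm of `1 - Δ` is an `H²` norm. -/
theorem norm_sq_helmholtz (φ : Test d) :
    ‖testL2 (helmholtz φ)‖ ^ 2 = ‖testL2 φ‖ ^ 2 + 2 * ∑ i, ‖testL2 (pd i φ)‖ ^ 2 +
      ∑ i, ∑ k, ‖testL2 (pd i (pd k φ))‖ ^ 2 := by
  rw [helmholtz_apply, map_sub, map_sum, norm_sub_sq_real, inner_sum]
  have h1 : ∀ i, inner ℝ (testL2 φ) (testL2 (pd i (pd i φ))) = -‖testL2 (pd i φ)‖ ^ 2 := fun i ↦ by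
    rw [inner_pd_right, real_inner_self_eq_norm_sq]
  rw [← real_inner_self_eq_norm_sq (∑ i, _), sum_inner]
  simp only [inner_sum, inner_pd_pd, h1, Finset.sum_neg_distrib]
  rw [Finset.sum_comm (f := fun i k ↦ ‖testL2 (pd i (pd k φ))‖ ^ 2)]
  ring

/-- The weak form of `T = μ - ∑_{i,j} D_j a_{ij} D_i` on test functions. -/
theorem inner_formalAdjoint (a : Fin d → Fin d → W1Infty d) (μ : ℝ) (φ ψ : Test d) :
    inner ℝ (formalAdjoint a μ φ) (testL2 ψ) = μ * inner ℝ (testL2 φ) (testL2 ψ) +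
      ∑ i, ∑ j, inner ℝ (mulL (a i j).val (testL2 (pd i φ))) (testL2 (pd j ψ)) := by
  rw [formalAdjoint_apply, inner_sub_left, real_inner_smul_left]
  simp only [sum_inner, inner_add_left, W1Infty.inner_mulL_pd, ← Finset.sum_neg_distrib,
    sub_eq_add_neg]
  congr 1
  refine Finset.sum_congr rfl fun i _ ↦ Finset.sum_congr rfl fun j _ ↦ ?_
  ring

/-- The pairing of `T φ` with a second derivative of `φ`, after two integrations by parts. -/
theorem inner_formalAdjoint_pd_pd (a : Fin d → Fin d → W1Infty d) (μ : ℝ) (φ : Test d)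
    (k : Fin d) :
    inner ℝ (formalAdjoint a μ φ) (testL2 (pd k (pd k φ))) = -(μ * ‖testL2 (pd k φ)‖ ^ 2) -
      ∑ i, ∑ j, (inner ℝ (mulL (a i j).val (testL2 (pd i (pd k φ)))) (testL2 (pd j (pd k φ))) +
        inner ℝ (mulL ((a i j).grad k) (testL2 (pd i φ))) (testL2 (pd j (pd k φ)))) := by
  rw [inner_formalAdjoint, inner_pd_right, real_inner_self_eq_norm_sq, mul_neg, sub_eq_add_neg,
    ← Finset.sum_neg_distrib]
  congr 1
  refine Finset.sum_congr rfl fun i _ ↦ ?_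
  rw [← Finset.sum_neg_distrib]
  refine Finset.sum_congr rfl fun j _ ↦ ?_
  rw [pd_comm j k (pd k φ), W1Infty.inner_mulL_pd, pd_comm k i φ]
  ring

/-- A bound for all the multiplication operators attached to the coefficients. -/
theorem exists_coeff_bound (a : Fin d → Fin d → W1Infty d) : ∃ b : ℝ, 0 ≤ b ∧
    (∀ i j v, ‖mulL (a i j).val v‖ ≤ b * ‖v‖) ∧ ∀ i j k v, ‖mulL ((a i j).grad k) v‖ ≤ b * ‖v‖ := by
  refine ⟨∑ i, ∑ j, (‖mulL (a i j).val‖ + ∑ k, ‖mulL ((a i j).grad k)‖), by positivity,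
    fun i j v ↦ ?_, fun i j k v ↦ ?_⟩
  all_goals
    refine (ContinuousLinearMap.le_opNorm _ _).trans (mul_le_mul_of_nonneg_right ?_ (norm_nonneg _))
    refine le_trans ?_ (Finset.single_le_sum (f := fun i ↦ ∑ j, (‖mulL (a i j).val‖ +
      ∑ k, ‖mulL ((a i j).grad k)‖)) (fun i _ ↦ by positivity) (Finset.mem_univ i))
    refine le_trans ?_ (Finset.single_le_sum (f := fun j ↦ (‖mulL (a i j).val‖ +
      ∑ k, ‖mulL ((a i j).grad k)‖)) (fun i _ ↦ by positivity) (Finset.mem_univ j))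
  · exact le_add_of_nonneg_right (by positivity)
  · exact le_add_of_nonneg_of_le (by positivity) (Finset.single_le_sum
      (f := fun k ↦ ‖mulL ((a i j).grad k)‖) (fun i _ ↦ by positivity) (Finset.mem_univ k))

/-- For large `μ` the operator `T = μ - ∑_{i,j} D_j a_{ij} D_i` pairs coercively with `1 - Δ`. In
`⟨T φ, -Δφ⟩` two integrations by parts produce the elliptic form of the gradients `∇ D_k φ`; the
terms with derivatives of `a` are of lower order and are absorbed by the second derivatives and by
`μ`. -/
theorem exists_helmholtz_coercive {a : Fin d → Fin d → W1Infty d} {γ₀ : ℝ} (hγ₀ : 0 < γ₀)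
    (ha : ∀ᵐ x : Space d, ∀ ξ : Space d,
      γ₀ * ‖ξ‖ ^ 2 ≤ ∑ i, ∑ j, (a i j).val x * ξ i * ξ j) :
    ∃ μ₀, ∀ μ, μ₀ ≤ μ → ∀ φ : Test d, γ₀ / 2 * ‖testL2 (helmholtz φ)‖ ^ 2 ≤
      inner ℝ (formalAdjoint a μ φ) (testL2 (helmholtz φ)) := by
  obtain ⟨b, hb0, -, hb⟩ := exists_coeff_bound a
  -- Young's inequality, with weights for which the second derivatives sum to at most half of
  -- `γ₀ S2`; the factor `d + 1` instead of `d` covers `d = 0`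
  set β := b ^ 2 * (d + 1) / (2 * γ₀) * d ^ 2 with hβ
  have hβ0 : 0 ≤ β := by positivity
  refine ⟨β + γ₀, fun μ hμ φ ↦ ?_⟩
  set S1 := ∑ i, ‖testL2 (pd i φ)‖ ^ 2 with hS1
  set S2 := ∑ k, ∑ i, ‖testL2 (pd i (pd k φ))‖ ^ 2 with hS2
  have hS1' : 0 ≤ S1 := Finset.sum_nonneg fun i _ ↦ sq_nonneg _
  have hS2' : 0 ≤ S2 := Finset.sum_nonneg fun k _ ↦ Finset.sum_nonneg fun i _ ↦ sq_nonneg _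
  have hP : ‖testL2 (helmholtz φ)‖ ^ 2 = ‖testL2 φ‖ ^ 2 + 2 * S1 + S2 := by
    rw [norm_sq_helmholtz, hS2, Finset.sum_comm]
  have hφφ : μ * ‖testL2 φ‖ ^ 2 + γ₀ * S1 ≤ inner ℝ (formalAdjoint a μ φ) (testL2 φ) := by
    rw [inner_formalAdjoint, real_inner_self_eq_norm_sq]
    gcongr
    exact elliptic_L2 ha fun i ↦ testL2 (pd i φ)
  have hell : γ₀ * S2 ≤ ∑ k, ∑ i, ∑ j,
      inner ℝ (mulL (a i j).val (testL2 (pd i (pd k φ)))) (testL2 (pd j (pd k φ))) := by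
    rw [hS2, Finset.mul_sum]
    exact Finset.sum_le_sum fun k _ ↦ elliptic_L2 ha fun i ↦ testL2 (pd i (pd k φ))
  have herr : -(β * S1 + γ₀ / 2 * S2) ≤ ∑ k, ∑ i, ∑ j,
      inner ℝ (mulL ((a i j).grad k) (testL2 (pd i φ))) (testL2 (pd j (pd k φ))) := by
    have h1 : ∀ k i j : Fin d, -(b ^ 2 * (d + 1) / (2 * γ₀) * ‖testL2 (pd i φ)‖ ^ 2 +
        γ₀ / (2 * (d + 1)) * ‖testL2 (pd j (pd k φ))‖ ^ 2) ≤
        inner ℝ (mulL ((a i j).grad k) (testL2 (pd i φ))) (testL2 (pd j (pd k φ))) := fun k i j ↦ by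
      have h2 := (abs_le.1 (abs_real_inner_le_norm (mulL ((a i j).grad k) (testL2 (pd i φ)))
        (testL2 (pd j (pd k φ))))).1
      refine le_trans (neg_le_neg ?_) h2
      set x := ‖testL2 (pd i φ)‖
      set y := ‖testL2 (pd j (pd k φ))‖
      calc ‖mulL ((a i j).grad k) (testL2 (pd i φ))‖ * y ≤ b * x * y := by
            gcongr
            exact hb i j k _
        _ ≤ b ^ 2 * (d + 1) / (2 * γ₀) * x ^ 2 + γ₀ / (2 * (d + 1)) * y ^ 2 := by
            have h3 : b ^ 2 * (d + 1) / (2 * γ₀) * x ^ 2 + γ₀ / (2 * (d + 1)) * y ^ 2 - b * x * y =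
                (b * (d + 1) * x - γ₀ * y) ^ 2 / (2 * γ₀ * (d + 1)) := by
              field_simp
              ring
            have h4 : 0 ≤ (b * (d + 1) * x - γ₀ * y) ^ 2 / (2 * γ₀ * (d + 1)) := by positivity
            linarith
    refine le_trans ?_ (Finset.sum_le_sum fun k _ ↦ Finset.sum_le_sum fun i _ ↦
      Finset.sum_le_sum fun j _ ↦ h1 k i j)
    simp only [Finset.sum_neg_distrib, Finset.sum_add_distrib, ← Finset.mul_sum, Finset.sum_const,
      Finset.card_univ, Fintype.card_fin, nsmul_eq_mul, ← hS1, ← hS2]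
    refine neg_le_neg (add_le_add (le_of_eq ?_) ?_)
    · rw [hβ]; ring
    · calc γ₀ / (2 * (d + 1)) * (d * S2) = (d : ℝ) / (d + 1) * (γ₀ / 2 * S2) := by
            field_simp
        _ ≤ 1 * (γ₀ / 2 * S2) :=
            mul_le_mul_of_nonneg_right ((div_le_one (by positivity)).2 (by linarith))
              (mul_nonneg (half_pos hγ₀).le hS2')
        _ = _ := one_mul _
  have hexp : inner ℝ (formalAdjoint a μ φ) (testL2 (helmholtz φ)) =
      inner ℝ (formalAdjoint a μ φ) (testL2 φ) + μ * S1 +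
      ∑ k, ∑ i, ∑ j,
        inner ℝ (mulL (a i j).val (testL2 (pd i (pd k φ)))) (testL2 (pd j (pd k φ))) +
      ∑ k, ∑ i, ∑ j,
        inner ℝ (mulL ((a i j).grad k) (testL2 (pd i φ))) (testL2 (pd j (pd k φ))) := by
    rw [helmholtz_apply, map_sub, map_sum, inner_sub_right, inner_sum]
    simp only [inner_formalAdjoint_pd_pd, Finset.sum_sub_distrib, Finset.sum_add_distrib,
      Finset.sum_neg_distrib, ← Finset.mul_sum]
    ring
  rw [hP, hexp]
  have h5 : γ₀ / 2 * ‖testL2 φ‖ ^ 2 ≤ μ * ‖testL2 φ‖ ^ 2 :=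
    mul_le_mul_of_nonneg_right (by linarith) (sq_nonneg _)
  have h6 : (β + γ₀) * S1 ≤ μ * S1 := mul_le_mul_of_nonneg_right hμ hS1'
  linarith [mul_nonneg hγ₀.le hS1']

theorem exists_norm_formalAdjoint_le (a : Fin d → Fin d → W1Infty d) (μ : ℝ) :
    ∃ C, ∀ φ : Test d, ‖formalAdjoint a μ φ‖ ≤ C * ‖testL2 (helmholtz φ)‖ := by
  obtain ⟨b, hb0, hb, hb'⟩ := exists_coeff_bound a
  refine ⟨|μ| + ∑ _i : Fin d, ∑ _j : Fin d, (b + b), fun φ ↦ ?_⟩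
  have h := norm_sq_helmholtz φ
  have hs1 : 0 ≤ ∑ i, ‖testL2 (pd i φ)‖ ^ 2 := Finset.sum_nonneg fun i _ ↦ sq_nonneg _
  have hs2 : 0 ≤ ∑ i, ∑ k, ‖testL2 (pd i (pd k φ))‖ ^ 2 :=
    Finset.sum_nonneg fun k _ ↦ Finset.sum_nonneg fun i _ ↦ sq_nonneg _
  have hs0 := sq_nonneg ‖testL2 φ‖
  have h0 : ‖testL2 φ‖ ≤ ‖testL2 (helmholtz φ)‖ :=
    le_of_sq_le_sq (by linarith) (norm_nonneg _)
  have h1 : ∀ i, ‖testL2 (pd i φ)‖ ≤ ‖testL2 (helmholtz φ)‖ := fun i ↦ by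
    have := Finset.single_le_sum (f := fun i ↦ ‖testL2 (pd i φ)‖ ^ 2) (fun i _ ↦ sq_nonneg _)
      (Finset.mem_univ i)
    exact le_of_sq_le_sq (by linarith) (norm_nonneg _)
  have h2 : ∀ i j, ‖testL2 (pd i (pd j φ))‖ ≤ ‖testL2 (helmholtz φ)‖ := fun i j ↦ by
    have h3 := Finset.single_le_sum (f := fun i ↦ ∑ k, ‖testL2 (pd i (pd k φ))‖ ^ 2)
      (fun i _ ↦ Finset.sum_nonneg fun k _ ↦ sq_nonneg _) (Finset.mem_univ i)
    have h4 := Finset.single_le_sum (f := fun k ↦ ‖testL2 (pd i (pd k φ))‖ ^ 2)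
      (fun i _ ↦ sq_nonneg _) (Finset.mem_univ j)
    exact le_of_sq_le_sq (by linarith) (norm_nonneg _)
  rw [formalAdjoint_apply, add_mul, Finset.sum_mul]
  refine (norm_sub_le _ _).trans (add_le_add ?_ ((norm_sum_le _ _).trans
    (Finset.sum_le_sum fun i _ ↦ ?_)))
  · rw [norm_smul, Real.norm_eq_abs]
    exact mul_le_mul_of_nonneg_left h0 (abs_nonneg _)
  · rw [Finset.sum_mul]
    refine (norm_sum_le _ _).trans (Finset.sum_le_sum fun j _ ↦ ?_)
    rw [add_mul]
    refine (norm_add_le _ _).trans (add_le_add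
      ((hb i j _).trans (mul_le_mul_of_nonneg_left (h2 j i) hb0))
      ((hb' i j j _).trans (mul_le_mul_of_nonneg_left (h1 i) hb0)))

/-- The operator `μ - ∑_{i,j} D_j a_{ij} D_i` maps the test functions onto a dense subspace of
`L²`. -/
theorem exists_denseRange_formalAdjoint {a : Fin d → Fin d → W1Infty d} {γ₀ : ℝ} (hγ₀ : 0 < γ₀)
    (ha : ∀ᵐ x : Space d, ∀ ξ : Space d,
      γ₀ * ‖ξ‖ ^ 2 ≤ ∑ i, ∑ j, (a i j).val x * ξ i * ξ j) :
    ∃ μ₀, ∀ μ, μ₀ ≤ μ → DenseRange (formalAdjoint a μ) := by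
  obtain ⟨μ₀, hμ₀⟩ := exists_helmholtz_coercive hγ₀ ha
  refine ⟨μ₀, fun μ hμ ↦ ?_⟩
  obtain ⟨C, hC⟩ := exists_norm_formalAdjoint_le a μ
  exact denseRange_of_inner_coercive (formalAdjoint a μ) (testL2 ∘ₗ helmholtz)
    denseRange_helmholtz (half_pos hγ₀) (hμ₀ μ hμ) hC

end Density

/-! ### The operators `I + A₀` and `A(t)` against test functions -/

section Operators

variable {d : ℕ}

theorem idAddA0_apply (a : Fin d → Fin d → W1Infty d) (w : L2 d) (φ : Test d) :
    idAddA0 a w φ = inner ℝ w (formalAdjoint a 1 φ) := by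
  have h : ∀ i j, (partialD i (partialD j (regular fun x ↦ (a i j).val x * w x) -
      regular fun x ↦ (a i j).grad j x * w x)) φ =
      inner ℝ w (mulL (a i j).val (testL2 (pd j (pd i φ))) +
        mulL ((a i j).grad j) (testL2 (pd i φ))) := fun i j ↦ by
    rw [partialD_apply, sub_apply,
      partialD_apply, regular_mul (a i j).memLp_val, regular_mul ((a i j).memLp_grad j),
      regular_coeFn_apply, regular_coeFn_apply, inner_mulL_comm (a i j).memLp_val,
      inner_mulL_comm ((a i j).memLp_grad j), inner_add_right]
    ring
  rw [idAddA0, opA0, add_apply, neg_apply, regular_coeFn_apply, formalAdjoint_apply, one_smul,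
    inner_sub_right, sub_eq_add_neg]
  simp only [sum_apply, inner_sum, h]

theorem coeFn_mulL_mulL {m k : Space d → ℝ} (hm : MemLp m ∞ volume) (hk : MemLp k ∞ volume)
    (v : L2 d) : mulL m (mulL k v) =ᵐ[volume] fun x ↦ k x * m x * v x := by
  filter_upwards [coeFn_mulL hm (mulL k v), coeFn_mulL hk v] with x h1 h2
  rw [h1, h2]
  ring

theorem opA_apply (a : Fin d → Fin d → W1Infty d) {f : Space d → Space d}
    (hf : ∀ i, MemLp (fun x ↦ f x i) ∞ volume) {ut : Space d → ℝ} (hut : MemLp ut ∞ volume)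
    (v : L2 d) (φ : Test d) :
    opA a f ut v φ =
      -(1 / 2 * ∑ i, ∑ j, inner ℝ (mulL (a i j).val (mulL ut v)) (testL2 (pd j (pd i φ)))) -
        ∑ i, inner ℝ (mulL (fun x ↦ f x i) v) (testL2 (pd i φ)) := by
  have h1 : ∀ i j, (partialD i (partialD j
      (regular fun x ↦ ut x * (a i j).val x * v x))) φ =
      inner ℝ (mulL (a i j).val (mulL ut v)) (testL2 (pd j (pd i φ))) := fun i j ↦ by
    rw [partialD_apply, partialD_apply, neg_neg, ← regular_congr (locallyIntegrable_coeFn _)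
      (coeFn_mulL_mulL (a i j).memLp_val hut v), regular_coeFn_apply]
  have h3 : ∀ i, (partialD i (regular fun x ↦ f x i * v x)) φ =
      -inner ℝ (mulL (fun x ↦ f x i) v) (testL2 (pd i φ)) := fun i ↦ by
    rw [partialD_apply, regular_mul (hf i), regular_coeFn_apply]
  rw [opA, add_apply, smul_apply, smul_eq_mul]
  simp only [sum_apply, h1, h3, Finset.sum_neg_distrib]
  ring

/-- The symmetric part `(a + aᵀ)/2` of the diffusion matrix. -/
def symmPart (a : Fin d → Fin d → W1Infty d) (i j : Fin d) : W1Infty d where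
  val x := 2⁻¹ * ((a i j).val x + (a j i).val x)
  grad k x := 2⁻¹ * ((a i j).grad k x + (a j i).grad k x)
  memLp_val := ((a i j).memLp_val.add (a j i).memLp_val).const_mul _
  memLp_grad k := (((a i j).memLp_grad k).add ((a j i).memLp_grad k)).const_mul _
  weak_grad k := by
    have hv : ∀ i j, LocallyIntegrable (a i j).val volume := fun i j ↦
      (a i j).memLp_val.locallyIntegrable le_top
    have hg : ∀ i j k, LocallyIntegrable ((a i j).grad k) volume := fun i j k ↦
      ((a i j).memLp_grad k).locallyIntegrable le_top
    have key : ∀ {g h : Space d → ℝ}, LocallyIntegrable g volume → LocallyIntegrable h volume →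
        ∀ φ : Test d, regular (fun x ↦ 2⁻¹ * (g x + h x)) φ =
          2⁻¹ * (regular g φ + regular h φ) := by
      intro g h hg hh φ
      have hi : ∀ {g : Space d → ℝ}, LocallyIntegrable g volume →
          Integrable (fun x ↦ φ x * g x) volume := fun hg ↦
        hg.integrable_smul_left_of_hasCompactSupport φ.continuous φ.hasCompactSupport
      have hgh : LocallyIntegrable (fun x ↦ 2⁻¹ * (g x + h x)) volume := (hg.add hh).smul (2⁻¹ : ℝ)
      rw [regular_apply hgh, regular_apply hg, regular_apply hh,
        ← integral_add (hi hg) (hi hh), ← integral_const_mul]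
      congr 1
      ext x
      ring
    ext φ
    change partialD k (regular fun x ↦ 2⁻¹ * ((a i j).val x + (a j i).val x)) φ =
      regular (fun x ↦ 2⁻¹ * ((a i j).grad k x + (a j i).grad k x)) φ
    rw [partialD_apply, key (hv _ _) (hv _ _), key (hg _ _ _) (hg _ _ _), ← (a i j).weak_grad k,
      ← (a j i).weak_grad k, partialD_apply, partialD_apply]
    ring

theorem symmPart_swap (a : Fin d → Fin d → W1Infty d) (i j : Fin d) :
    symmPart a i j = symmPart a j i := by
  simp only [symmPart, add_comm]

theorem symmPart_elliptic {a : Fin d → Fin d → W1Infty d} {γ₀ : ℝ}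
    (ha : ∀ᵐ x : Space d, ∀ ξ : Space d,
      γ₀ * ‖ξ‖ ^ 2 ≤ ∑ i, ∑ j, (a i j).val x * ξ i * ξ j) :
    ∀ᵐ x : Space d, ∀ ξ : Space d,
      γ₀ * ‖ξ‖ ^ 2 ≤ ∑ i, ∑ j, (symmPart a i j).val x * ξ i * ξ j := by
  filter_upwards [ha] with x hx ξ
  refine (hx ξ).trans (le_of_eq ?_)
  have h : ∑ i, ∑ j, (a j i).val x * ξ i * ξ j = ∑ i, ∑ j, (a i j).val x * ξ i * ξ j := by
    rw [Finset.sum_comm]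
    exact Finset.sum_congr rfl fun i _ ↦ Finset.sum_congr rfl fun j _ ↦ by ring
  calc ∑ i, ∑ j, (a i j).val x * ξ i * ξ j
      = 2⁻¹ * (∑ i, ∑ j, (a i j).val x * ξ i * ξ j + ∑ i, ∑ j, (a j i).val x * ξ i * ξ j) := by
        rw [h]; ring
    _ = _ := by
        simp only [← Finset.sum_add_distrib, Finset.mul_sum, symmPart]
        exact Finset.sum_congr rfl fun i _ ↦ Finset.sum_congr rfl fun j _ ↦ by ring

/-- Only the symmetric part of `a` enters `∑_{i,j} D²_{ij} (a_{ij} ·)`. -/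
theorem sum_inner_symmPart (a : Fin d → Fin d → W1Infty d) (v : L2 d) (φ : Test d) :
    ∑ i, ∑ j, inner ℝ (mulL (symmPart a i j).val v) (testL2 (pd j (pd i φ))) =
      ∑ i, ∑ j, inner ℝ (mulL (a i j).val v) (testL2 (pd j (pd i φ))) := by
  have h1 : ∀ i j, mulL (symmPart a i j).val v =
      (2⁻¹ : ℝ) • (mulL (a i j).val v + mulL (a j i).val v) := fun i j ↦ by
    refine Lp.ext ?_
    filter_upwards [coeFn_mulL (symmPart a i j).memLp_val v, coeFn_mulL (a i j).memLp_val v,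
      coeFn_mulL (a j i).memLp_val v,
      Lp.coeFn_smul (2⁻¹ : ℝ) (mulL (a i j).val v + mulL (a j i).val v),
      Lp.coeFn_add (mulL (a i j).val v) (mulL (a j i).val v)] with x h1 h2 h3 h4 h5
    rw [h1, h4, Pi.smul_apply, h5, Pi.add_apply, h2, h3, symmPart, smul_eq_mul]
    ring
  have h2 : ∑ i, ∑ j, inner ℝ (mulL (a j i).val v) (testL2 (pd j (pd i φ))) =
      ∑ i, ∑ j, inner ℝ (mulL (a i j).val v) (testL2 (pd j (pd i φ))) := by
    rw [Finset.sum_comm]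
    exact Finset.sum_congr rfl fun i _ ↦ Finset.sum_congr rfl fun j _ ↦ by rw [pd_comm]
  simp only [h1, real_inner_smul_left, inner_add_left, ← Finset.mul_sum, Finset.sum_add_distrib, h2]
  ring

end Operators

/-! ### The evolution in `L²` -/

namespace SobolevModel

variable {d : ℕ} {E : Type*} [NormedAddCommGroup E] [InnerProductSpace ℝ E] [CompleteSpace E]
  (S : SobolevModel d E)

theorem energyOp_symm (a : Fin d → Fin d → W1Infty d) (ha : ∀ i j, a i j = a j i) (μ : ℝ)
    (p q : E) : inner ℝ (S.energyOp a μ p) q = inner ℝ p (S.energyOp a μ q) := by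
  rw [real_inner_comm (S.energyOp a μ q) p, S.inner_energyOp, S.inner_energyOp,
    real_inner_comm (S.incl p), Finset.sum_comm]
  congr 1
  refine Finset.sum_congr rfl fun i _ ↦ Finset.sum_congr rfl fun j _ ↦ ?_
  rw [inner_mulL_comm (a j i).memLp_val, real_inner_comm, ha j i]

/-- The operator `z ↦ -μ z / 2 - ½ ∑_{i,j} D_i ((D_j a_{ij}) z)`, as a map into `H⁻¹ ≅ E`. It is
what remains of `-½ ∑_{i,j} D²_{ij} (a_{ij} z)` after subtraction of `½ (μ + A₀) z`. -/
def lower (a : Fin d → Fin d → W1Infty d) (μ : ℝ) : L2 d →L[ℝ] E :=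
  (-(μ / 2)) • S.inclAdj + (1 / 2 : ℝ) • ∑ i, ∑ j, S.weakDAdj i ∘L mulL ((a i j).grad j)

/-- The drift `v ↦ div (f v)`, as a map into `H⁻¹ ≅ E`. -/
def drift (f : Space d → Space d) : L2 d →L[ℝ] E :=
  -∑ i, S.weakDAdj i ∘L mulL fun x ↦ f x i

/-- The operator `(μ + A₀)⁻¹ A(t)` on `L²`, where `U` is multiplication by `u(t,·)` and `N` is the
inverse of `S.energyOp a μ`. Splitting off the leading part `U/2` makes it bounded on `L²`, since
the remaining terms of `A(t)` map `L²` into `H⁻¹`. -/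
def evolutionOp (a : Fin d → Fin d → W1Infty d) (μ : ℝ) (N : E →L[ℝ] E) (f : Space d → Space d)
    (U : L2 d →L[ℝ] L2 d) : L2 d →L[ℝ] L2 d :=
  (1 / 2 : ℝ) • U + S.incl ∘L N ∘L (S.lower a μ ∘L U + S.drift f)

theorem evolutionOp_apply (a : Fin d → Fin d → W1Infty d) (μ : ℝ) (N : E →L[ℝ] E)
    (f : Space d → Space d) (U : L2 d →L[ℝ] L2 d) (v : L2 d) :
    S.evolutionOp a μ N f U v =
      (1 / 2 : ℝ) • U v + S.incl (N (S.lower a μ (U v) + S.drift f v)) := rfl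

/-- `S.evolutionOp a μ N f U` is `(μ + A₀)⁻¹ A(t)` in the weak sense. -/
theorem inner_evolutionOp (a : Fin d → Fin d → W1Infty d) (μ : ℝ) {N : E →L[ℝ] E}
    (hN : ∀ p, S.energyOp a μ (N p) = p) (f : Space d → Space d)
    (U : L2 d →L[ℝ] L2 d) (v : L2 d) (φ : Test d) :
    inner ℝ (S.evolutionOp a μ N f U v) (formalAdjoint a μ φ) =
      -(1 / 2 * ∑ i, ∑ j, inner ℝ (mulL (a i j).val (U v)) (testL2 (pd j (pd i φ)))) -
        ∑ i, inner ℝ (mulL (fun x ↦ f x i) v) (testL2 (pd i φ)) := by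
  rw [evolutionOp_apply, inner_add_left, real_inner_smul_left, ← S.inner_energyOp_test, hN,
    formalAdjoint_apply, inner_sub_right, real_inner_smul_right, lower, drift]
  simp only [add_apply, smul_apply, neg_apply, sum_apply, ContinuousLinearMap.comp_apply,
    inner_add_left, inner_neg_left, sum_inner, real_inner_smul_left, inner_sum, inner_add_right,
    S.inner_inclAdj, S.inner_weakDAdj, S.incl_test, S.weakD_test, Finset.sum_add_distrib,
    ← inner_mulL_comm (a _ _).memLp_val, ← inner_mulL_comm ((a _ _).memLp_grad _)]
  ring

/-- The Gårding inequality: the lower order part is `⟨η, N J v⟩` with `‖η‖ ≤ C ‖v‖`, and is absorbed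
by Young's inequality. -/
theorem exists_evolutionOp_coercive (a : Fin d → Fin d → W1Infty d) (μ : ℝ) {N : E →L[ℝ] E}
    (hN : ∀ p q, inner ℝ (N p) q = inner ℝ p (N q)) {κ : ℝ} (hκ : 0 < κ)
    (hNκ : ∀ p, κ * ‖p‖ ^ 2 ≤ inner ℝ (N p) p) (f : Space d → Space d) {γ₁ γ₂ : ℝ} (hγ₁ : 0 < γ₁)
    (hγ₂ : 0 ≤ γ₂) : ∃ l, 0 ≤ l ∧ ∀ U : L2 d →L[ℝ] L2 d, (∀ v, γ₁ * ‖v‖ ^ 2 ≤ inner ℝ (U v) v) →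
      (∀ v, ‖U v‖ ≤ γ₂ * ‖v‖) → ∀ v, γ₁ / 4 * ‖v‖ ^ 2 ≤
        inner ℝ (S.evolutionOp a μ N f U v) v + l * inner ℝ (N (S.inclAdj v)) (S.inclAdj v) := by
  set C := ‖S.lower a μ‖ * γ₂ + ‖S.drift f‖ with hC
  have hC0 : 0 ≤ C := by positivity
  refine ⟨(C * ‖N‖) ^ 2 / γ₁ / κ, by positivity, fun U hU hU' v ↦ ?_⟩
  set η := S.lower a μ (U v) + S.drift f v with hη
  set r := S.inclAdj v with hr
  have h1 : ‖η‖ ≤ C * ‖v‖ := by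
    calc ‖η‖ ≤ ‖S.lower a μ‖ * (γ₂ * ‖v‖) + ‖S.drift f‖ * ‖v‖ :=
          (norm_add_le _ _).trans (add_le_add (((S.lower a μ).le_opNorm _).trans
            (mul_le_mul_of_nonneg_left (hU' v) (norm_nonneg _))) ((S.drift f).le_opNorm _))
      _ = C * ‖v‖ := by rw [hC]; ring
  have h2 : inner ℝ (S.evolutionOp a μ N f U v) v = 1 / 2 * inner ℝ (U v) v + inner ℝ η (N r) := by
    have h : inner ℝ (S.incl (N η)) v = inner ℝ η (N r) := by
      rw [real_inner_comm, ← S.inner_inclAdj, ← hN, real_inner_comm]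
    rw [evolutionOp_apply, inner_add_left, real_inner_smul_left, h]
  have h3 : -(C * ‖v‖ * (‖N‖ * ‖r‖)) ≤ inner ℝ η (N r) := by
    refine le_trans (neg_le_neg ?_) (abs_le.1 (abs_real_inner_le_norm η (N r))).1
    exact mul_le_mul h1 (N.le_opNorm r) (norm_nonneg _) (by positivity)
  have h4 : (C * ‖N‖) ^ 2 / γ₁ * ‖r‖ ^ 2 ≤ (C * ‖N‖) ^ 2 / γ₁ / κ * inner ℝ (N r) r := by
    calc (C * ‖N‖) ^ 2 / γ₁ * ‖r‖ ^ 2 = (C * ‖N‖) ^ 2 / γ₁ / κ * (κ * ‖r‖ ^ 2) := by field_simp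
      _ ≤ _ := mul_le_mul_of_nonneg_left (hNκ r) (by positivity)
  have h5 : C * ‖v‖ * (‖N‖ * ‖r‖) ≤ γ₁ / 4 * ‖v‖ ^ 2 + (C * ‖N‖) ^ 2 / γ₁ * ‖r‖ ^ 2 := by
    have : γ₁ / 4 * ‖v‖ ^ 2 + (C * ‖N‖) ^ 2 / γ₁ * ‖r‖ ^ 2 - C * ‖v‖ * (‖N‖ * ‖r‖) =
        (γ₁ * ‖v‖ - 2 * (C * ‖N‖) * ‖r‖) ^ 2 / (4 * γ₁) := by
      field_simp
      ring
    have h6 : 0 ≤ (γ₁ * ‖v‖ - 2 * (C * ‖N‖) * ‖r‖) ^ 2 / (4 * γ₁) := by positivity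
    linarith
  have h7 := hU v
  rw [h2]
  linarith

end SobolevModel

/-! ### Time-dependent coefficients -/

section TimeDependent

variable {d : ℕ}

/-- In a separable metric space, measurability of the distances to all points is enough. -/
theorem stronglyMeasurable_of_measurable_dist {α X : Type*} [MeasurableSpace α]
    [PseudoMetricSpace X] [SecondCountableTopology X] {F : α → X}
    (hF : ∀ c, Measurable fun t ↦ dist (F t) c) : StronglyMeasurable F := by
  borelize X
  refine Measurable.stronglyMeasurable (measurable_of_isOpen fun s hs ↦ ?_)
  choose! r hr hrs using Metric.isOpen_iff.1 hs
  obtain ⟨C, -, hC, hU⟩ := isOpen_biUnion_countable s (fun x ↦ Metric.ball x (r x))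
    fun _ _ ↦ Metric.isOpen_ball
  have h : s = ⋃ x ∈ C, Metric.ball x (r x) := by
    rw [hU]
    exact Subset.antisymm (fun x hx ↦ mem_biUnion hx (Metric.mem_ball_self (hr x hx)))
      (iUnion₂_subset hrs)
  rw [h, preimage_iUnion₂]
  exact MeasurableSet.biUnion hC fun c _ ↦ measurableSet_lt (hF c) measurable_const

instance secondCountableTopology_L2 (d : ℕ) : SecondCountableTopology (L2 d) :=
  haveI : Fact ((2 : ℝ≥0∞) ≠ ∞) := ⟨by norm_num⟩
  inferInstance

theorem memLp_section {g : ℝ × Space d → ℝ} (hg : StronglyMeasurable g) {b : ℝ}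
    (hb : ∀ p, |g p| ≤ b) (t : ℝ) : MemLp (fun x ↦ g (t, x)) ∞ volume :=
  memLp_top_of_bound (hg.comp_measurable measurable_prodMk_left).aestronglyMeasurable b
    (ae_of_all _ fun x ↦ hb (t, x))

/-- The multiplication operators by the sections `g(t,·)` of a bounded measurable function. -/
def mulFamily (g : ℝ × Space d → ℝ) (hg : StronglyMeasurable g) (b : ℝ) (hb : ∀ p, |g p| ≤ b) :
    OpFamily (L2 d) where
  op t := mulL fun x ↦ g (t, x)
  bound := b
  bound_nonneg := (abs_nonneg _).trans (hb 0)
  norm_apply_le t v := norm_mulL_le (memLp_section hg hb t) (ae_of_all _ fun x ↦ hb (t, x)) v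
  stronglyMeasurable_apply v := by
    refine stronglyMeasurable_of_measurable_dist fun c ↦ ?_
    have h1 : ∀ t, dist (mulL (fun x ↦ g (t, x)) v) c =
        √(∫ x, (g (t, x) * v x - c x) ^ 2) := fun t ↦ by
      rw [dist_eq_norm, eq_comm, Real.sqrt_eq_iff_eq_sq (integral_nonneg fun x ↦ sq_nonneg _)
        (norm_nonneg _), ← real_inner_self_eq_norm_sq, L2.inner_def]
      refine integral_congr_ae ?_
      filter_upwards [Lp.coeFn_sub (mulL (fun x ↦ g (t, x)) v) c,
        coeFn_mulL (memLp_section hg hb t) v] with x hx hx'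
      rw [hx, Pi.sub_apply, hx', real_inner_self_eq_norm_sq, Real.norm_eq_abs, sq_abs]
    simp only [h1]
    have h2 : StronglyMeasurable fun p : ℝ × Space d ↦ (g p * v p.2 - c p.2) ^ 2 :=
      ((hg.mul ((Lp.stronglyMeasurable v).comp_measurable measurable_snd)).sub
        ((Lp.stronglyMeasurable c).comp_measurable measurable_snd)).pow 2
    exact (StronglyMeasurable.integral_prod_right (f := fun t x ↦ (g (t, x) * v x - c x) ^ 2)
      h2).measurable.sqrt

/-- A measurable version of the coefficient `u` which satisfies the bounds everywhere. -/
theorem exists_bounded_version {T γ₁ γ₂ : ℝ} (h₁₂ : γ₁ ≤ γ₂) {u : ℝ → Space d → ℝ}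
    (hu_meas : AEStronglyMeasurable (fun p : ℝ × Space d ↦ u p.1 p.2)
      ((timeMeasure T).prod volume))
    (hu_bound : ∀ᵐ p : ℝ × Space d ∂((timeMeasure T).prod volume),
      γ₁ ≤ u p.1 p.2 ∧ u p.1 p.2 ≤ γ₂) :
    ∃ g : ℝ × Space d → ℝ, StronglyMeasurable g ∧ (∀ p, γ₁ ≤ g p ∧ g p ≤ γ₂) ∧
      ∀ᵐ t ∂(timeMeasure T), u t =ᵐ[volume] fun x ↦ g (t, x) := by
  refine ⟨fun p ↦ max γ₁ (min γ₂ (hu_meas.mk _ p)),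
    stronglyMeasurable_const.sup (stronglyMeasurable_const.inf hu_meas.stronglyMeasurable_mk),
    fun p ↦ ⟨le_max_left _ _, max_le h₁₂ (min_le_left _ _)⟩, ?_⟩
  have h : ∀ᵐ p : ℝ × Space d ∂((timeMeasure T).prod volume),
      u p.1 p.2 = max γ₁ (min γ₂ (hu_meas.mk _ p)) := by
    filter_upwards [hu_meas.ae_eq_mk, hu_bound] with p h1 h2
    rw [← h1, min_eq_right h2.2, max_eq_right h2.1]
  exact Measure.ae_ae_of_ae_prod h

theorem opA_congr (a : Fin d → Fin d → W1Infty d) {f : Space d → Space d} {ut ut' : Space d → ℝ}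
    (hut : MemLp ut' ∞ volume) (h : ut =ᵐ[volume] ut') (v : L2 d) :
    opA a f ut v = opA a f ut' v := by
  have h1 : ∀ i j, regular (fun x ↦ ut x * (a i j).val x * v x) =
      regular fun x ↦ ut' x * (a i j).val x * v x := fun i j ↦ by
    have h2 := coeFn_mulL_mulL (a i j).memLp_val hut v
    rw [← regular_congr (locallyIntegrable_coeFn _) h2]
    refine (regular_congr (locallyIntegrable_coeFn _) (h2.trans ?_)).symm
    filter_upwards [h] with x hx
    rw [hx]
  simp only [opA, h1]

variable {E : Type*} [NormedAddCommGroup E] [InnerProductSpace ℝ E] [CompleteSpace E]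
  (S : SobolevModel d E)

/-- The family of operators `(μ + A₀)⁻¹ A(t)`. -/
def SobolevModel.evolutionFamily (a : Fin d → Fin d → W1Infty d) (μ : ℝ) (N : E →L[ℝ] E)
    (f : Space d → Space d) (U : OpFamily (L2 d)) : OpFamily (L2 d) where
  op t := S.evolutionOp a μ N f (U.op t)
  bound := 1 / 2 * U.bound + (‖S.incl ∘L N ∘L S.lower a μ‖ * U.bound +
    ‖S.incl ∘L N ∘L S.drift f‖)
  bound_nonneg := by
    have := U.bound_nonneg
    positivity
  stronglyMeasurable_apply v := by
    simp only [S.evolutionOp_apply]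
    have h := U.stronglyMeasurable_apply v
    exact (h.const_smul (1 / 2 : ℝ)).add (S.incl.continuous.comp_stronglyMeasurable
      (N.continuous.comp_stronglyMeasurable (((S.lower a μ).continuous.comp_stronglyMeasurable
        h).add stronglyMeasurable_const)))
  norm_apply_le t v := by
    have h := U.norm_apply_le t v
    have h1 := (S.incl ∘L N ∘L S.lower a μ).le_opNorm (U.op t v)
    have h2 := (S.incl ∘L N ∘L S.drift f).le_opNorm v
    simp only [ContinuousLinearMap.comp_apply] at h1 h2
    rw [S.evolutionOp_apply, map_add, map_add, add_mul, add_mul, mul_assoc, mul_assoc]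
    refine (norm_add_le _ _).trans (add_le_add ?_ ((norm_add_le _ _).trans (add_le_add
      (h1.trans (mul_le_mul_of_nonneg_left h (norm_nonneg _))) h2)))
    rw [norm_smul, Real.norm_of_nonneg (by norm_num)]
    exact mul_le_mul_of_nonneg_left h (by norm_num)

end TimeDependent

/-! ### Weak derivatives in time -/

section TimeDerivative

variable {T : ℝ}

theorem setIntegral_Ioo_eq_intervalIntegral (hT : 0 < T) (F : ℝ → ℝ) :
    ∫ t in Ioo 0 T, F t = ∫ t in (0 : ℝ)..T, F t := by
  rw [intervalIntegral.integral_of_le hT.le, integral_Ioc_eq_integral_Ioo]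

theorem intervalIntegrable_of_integrableOn_Ioo (hT : 0 < T) {g : ℝ → ℝ}
    (hg : IntegrableOn g (Ioo 0 T)) : IntervalIntegrable g volume 0 T :=
  (intervalIntegrable_iff_integrableOn_Ioo_of_le hT.le).2 hg

theorem test_endpoints (χ : TestFunction (⟨Ioo 0 T, isOpen_Ioo⟩ : Opens ℝ) ℝ ⊤) :
    χ 0 = 0 ∧ χ T = 0 :=
  ⟨image_eq_zero_of_notMem_tsupport fun h ↦ lt_irrefl (0 : ℝ) (χ.tsupport_subset h).1,
    image_eq_zero_of_notMem_tsupport fun h ↦ lt_irrefl T (χ.tsupport_subset h).2⟩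

theorem absolutelyContinuousOnInterval_test
    (χ : TestFunction (⟨Ioo 0 T, isOpen_Ioo⟩ : Opens ℝ) ℝ ⊤) :
    AbsolutelyContinuousOnInterval χ 0 T :=
  (χ.contDiff.of_le (by norm_cast)).contDiffOn.absolutelyContinuousOnInterval

theorem integral_deriv_test (hT : 0 < T)
    (χ : TestFunction (⟨Ioo 0 T, isOpen_Ioo⟩ : Opens ℝ) ℝ ⊤) :
    ∫ t in Ioo 0 T, deriv χ t = 0 := by
  rw [setIntegral_Ioo_eq_intervalIntegral hT,
    (absolutelyContinuousOnInterval_test χ).integral_deriv_eq_sub, (test_endpoints χ).1,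
    (test_endpoints χ).2, sub_zero]

theorem integrable_deriv_test_mul (χ : TestFunction (⟨Ioo 0 T, isOpen_Ioo⟩ : Opens ℝ) ℝ ⊤)
    {k : ℝ → ℝ} (hk : IntegrableOn k (Ioo 0 T)) :
    IntegrableOn (fun t ↦ deriv χ t * k t) (Ioo 0 T) := by
  have hcont : Continuous (deriv χ) := χ.contDiff.continuous_deriv (by norm_cast)
  obtain ⟨C, hC⟩ := hcont.bounded_above_of_compact_support χ.hasCompactSupport.deriv
  exact hk.bdd_mul hcont.aestronglyMeasurable (ae_of_all _ hC)

theorem continuousOn_integral (hT : 0 < T) {g : ℝ → ℝ} (hg : IntegrableOn g (Ioo 0 T)) :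
    ContinuousOn (fun t ↦ ∫ s in (0 : ℝ)..t, g s) (Icc 0 T) := by
  have := intervalIntegral.continuousOn_primitive_interval'
    (intervalIntegrable_of_integrableOn_Ioo hT hg) left_mem_uIcc
  rwa [uIcc_of_le hT.le] at this

/-- A primitive is a weak primitive. -/
theorem integral_deriv_mul_primitive (hT : 0 < T) {g : ℝ → ℝ} (hg : IntegrableOn g (Ioo 0 T))
    (χ : TestFunction (⟨Ioo 0 T, isOpen_Ioo⟩ : Opens ℝ) ℝ ⊤) :
    ∫ t in Ioo 0 T, deriv χ t * ∫ s in (0 : ℝ)..t, g s = -∫ t in Ioo 0 T, χ t * g t := by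
  have hgi := intervalIntegrable_of_integrableOn_Ioo hT hg
  have hG := hgi.absolutelyContinuousOnInterval_intervalIntegral (c := 0) (by simp)
  have h := (absolutelyContinuousOnInterval_test χ).integral_mul_deriv_eq_deriv_mul hG
  rw [(test_endpoints χ).1, (test_endpoints χ).2, zero_mul, zero_mul, sub_zero, zero_sub] at h
  rw [setIntegral_Ioo_eq_intervalIntegral hT, setIntegral_Ioo_eq_intervalIntegral hT,
    ← neg_eq_iff_eq_neg, ← h]
  refine intervalIntegral.integral_congr_ae ?_
  filter_upwards [hgi.ae_hasDerivAt_integral] with t ht htm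
  rw [(ht (uIoc_subset_uIcc htm) 0 (by simp)).deriv]

/-- A test function on `(0,T)` with integral zero is the derivative of a test function. -/
theorem exists_primitive_test {ψ : ℝ → ℝ} (hψ : ContDiff ℝ (⊤ : ℕ∞) ψ) (hc : HasCompactSupport ψ)
    (hs : tsupport ψ ⊆ Ioo 0 T) (hint : ∫ t, ψ t = 0) :
    ∃ χ : TestFunction (⟨Ioo 0 T, isOpen_Ioo⟩ : Opens ℝ) ℝ ⊤, deriv χ = ψ := by
  rcases (tsupport ψ).eq_empty_or_nonempty with he | hne
  · refine ⟨0, ?_⟩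
    rw [tsupport_eq_empty_iff.1 he]
    exact deriv_const' (0 : ℝ)
  have hK : IsCompact (tsupport ψ) := hc
  set a := sInf (tsupport ψ)
  set b := sSup (tsupport ψ)
  have ha := hs (hK.sInf_mem hne)
  have hb := hs (hK.sSup_mem hne)
  have hsub : ∀ t, ψ t ≠ 0 → a ≤ t ∧ t ≤ b := fun t ht ↦
    ⟨csInf_le hK.bddBelow (subset_tsupport _ ht), le_csSup hK.bddAbove (subset_tsupport _ ht)⟩
  have hderiv : ∀ t, HasDerivAt (fun t ↦ ∫ s in (0 : ℝ)..t, ψ s) (ψ t) t := fun t ↦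
    intervalIntegral.integral_hasDerivAt_right (hψ.continuous.intervalIntegrable _ _)
      (hψ.continuous.stronglyMeasurableAtFilter _ _) hψ.continuous.continuousAt
  have hd : deriv (fun t ↦ ∫ s in (0 : ℝ)..t, ψ s) = ψ := funext fun t ↦ (hderiv t).deriv
  have hzero : ∀ t, t ∉ Icc a b → ∫ s in (0 : ℝ)..t, ψ s = 0 := fun t ht ↦ by
    rcases lt_or_ge t a with h | h
    · have h0 : ∀ s ∈ uIcc 0 t, ψ s = 0 := fun s hs' ↦ by
        by_contra hne
        have := (hsub s hne).1
        rcases le_total 0 t with h2 | h2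
        · rw [uIcc_of_le h2] at hs'
          linarith [hs'.2]
        · rw [uIcc_of_ge h2] at hs'
          linarith [hs'.2, ha.1]
      rw [intervalIntegral.integral_congr h0]
      simp
    · have h2 : b < t := not_le.1 fun h2 ↦ ht ⟨h, h2⟩
      rw [intervalIntegral.integral_eq_integral_of_support_subset, hint]
      exact fun s hs' ↦ ⟨ha.1.trans_le (hsub s hs').1, (hsub s hs').2.trans h2.le⟩
  have hsupp : tsupport (fun t ↦ ∫ s in (0 : ℝ)..t, ψ s) ⊆ Icc a b :=
    closure_minimal (fun t ht ↦ by_contra fun h ↦ ht (hzero t h)) isClosed_Icc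
  exact ⟨⟨fun t ↦ ∫ s in (0 : ℝ)..t, ψ s,
    contDiff_infty_iff_deriv.2 ⟨fun t ↦ (hderiv t).differentiableAt, by rw [hd]; exact hψ⟩,
    HasCompactSupport.of_support_subset_isCompact isCompact_Icc
      ((subset_tsupport _).trans hsupp),
    hsupp.trans fun t ht ↦ ⟨ha.1.trans_le ht.1, ht.2.trans_lt hb.2⟩⟩, hd⟩

/-- The du Bois-Reymond lemma: subtracting from a test function a multiple of a fixed bump `θ` gives
the derivative of a test function. -/
theorem exists_ae_eq_const_of_integral_deriv_mul (hT : 0 < T) {H : ℝ → ℝ}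
    (hH : IntegrableOn H (Ioo 0 T))
    (h : ∀ χ : TestFunction (⟨Ioo 0 T, isOpen_Ioo⟩ : Opens ℝ) ℝ ⊤,
      ∫ t in Ioo 0 T, deriv χ t * H t = 0) :
    ∃ c, ∀ᵐ t ∂(volume.restrict (Ioo 0 T)), H t = c := by
  let B : ContDiffBump (T / 2) := ⟨T / 8, T / 4, by positivity, by linarith⟩
  set θ : ℝ → ℝ := B.normed volume
  have hθs : tsupport θ ⊆ Ioo 0 T := by
    rw [B.tsupport_normed_eq, Real.closedBall_eq_Icc]
    exact fun t ht ↦ ⟨by linarith [ht.1, show B.rOut = T / 4 from rfl],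
      by linarith [ht.2, show B.rOut = T / 4 from rfl]⟩
  have hmul : ∀ ψ : ℝ → ℝ, Continuous ψ → HasCompactSupport ψ →
      IntegrableOn (fun t ↦ ψ t * H t) (Ioo 0 T) := fun ψ hψ hc ↦ by
    obtain ⟨C, hC⟩ := hψ.bounded_above_of_compact_support hc
    exact hH.bdd_mul hψ.aestronglyMeasurable (ae_of_all _ hC)
  set c := ∫ t in Ioo 0 T, θ t * H t with hc
  refine ⟨c, ?_⟩
  have h0 : ∀ᵐ t, t ∈ Ioo 0 T → H t - c = 0 := by
    refine isOpen_Ioo.ae_eq_zero_of_integral_contDiff_smul_eq_zero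
      ((hH.sub (integrableOn_const (by simp))).locallyIntegrableOn) fun ψ hψ hψc hψs ↦ ?_
    have hψ' : ContDiff ℝ (⊤ : ℕ∞) fun t ↦ ψ t - (∫ t, ψ t) * θ t :=
      hψ.sub (contDiff_const.mul B.contDiff_normed)
    have hθc : HasCompactSupport θ := B.hasCompactSupport_normed
    have hi1 : Integrable ψ := hψ.continuous.integrable_of_hasCompactSupport hψc
    have hi2 : Integrable θ := B.integrable_normed
    have hψ0 : ∀ t, t ∉ Ioo 0 T → ψ t = 0 := fun t ht ↦
      image_eq_zero_of_notMem_tsupport fun h ↦ ht (hψs h)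
    obtain ⟨χ, hχ⟩ := exists_primitive_test (T := T) hψ' (hψc.sub hθc.mul_left)
      ((tsupport_sub _ _).trans (union_subset hψs ((tsupport_mul_subset_right).trans hθs)))
      (by rw [integral_sub hi1 (hi2.const_mul _), integral_const_mul, B.integral_normed]; ring)
    have h1 := h χ
    have h2 : ∫ t in Ioo 0 T, ψ t * H t = (∫ t, ψ t) * c := by
      rw [hχ] at h1
      simp only [sub_mul, mul_assoc] at h1
      rw [integral_sub (hmul ψ hψ.continuous hψc)
        ((hmul θ B.continuous_normed hθc).const_mul _), integral_const_mul] at h1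
      exact sub_eq_zero.1 h1
    rw [← setIntegral_eq_integral_of_forall_compl_eq_zero (s := Ioo 0 T)
      (fun t ht ↦ by rw [hψ0 t ht, zero_smul])]
    simp only [smul_eq_mul, mul_sub]
    rw [integral_sub (hmul ψ hψ.continuous hψc) (hi1.integrableOn.mul_const c), h2,
      integral_mul_const, setIntegral_eq_integral_of_forall_compl_eq_zero hψ0, sub_self]
  rw [ae_restrict_iff' measurableSet_Ioo]
  filter_upwards [h0] with t ht htm
  exact sub_eq_zero.1 (ht htm)

/-- A continuous function with an integrable weak derivative is the primitive of the latter. -/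
theorem eq_sub_integral_of_weak_deriv (hT : 0 < T) {F h g : ℝ → ℝ}
    (hF : ContinuousOn F (Icc 0 T)) (hFh : h =ᵐ[volume.restrict (Ioo 0 T)] F)
    (hg : IntegrableOn g (Ioo 0 T))
    (hw : ∀ χ : TestFunction (⟨Ioo 0 T, isOpen_Ioo⟩ : Opens ℝ) ℝ ⊤,
      ∫ t in Ioo 0 T, deriv χ t * h t = ∫ t in Ioo 0 T, χ t * g t) :
    ∀ t ∈ Icc 0 T, F t = F 0 - ∫ s in (0 : ℝ)..t, g s := by
  have hGc := continuousOn_integral hT hg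
  have hFi : IntegrableOn F (Ioo 0 T) := hF.integrableOn_Icc.mono_set Ioo_subset_Icc_self
  have hGi : IntegrableOn (fun t ↦ ∫ s in (0 : ℝ)..t, g s) (Ioo 0 T) :=
    hGc.integrableOn_Icc.mono_set Ioo_subset_Icc_self
  obtain ⟨c, hc⟩ := exists_ae_eq_const_of_integral_deriv_mul hT (hFi.add hGi) fun χ ↦ by
    have h1 : ∫ t in Ioo 0 T, deriv χ t * F t = ∫ t in Ioo 0 T, χ t * g t := by
      rw [← hw χ]
      exact integral_congr_ae (hFh.mono fun t ht ↦ by simp only [ht])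
    simp only [Pi.add_apply, mul_add]
    rw [integral_add (integrable_deriv_test_mul χ hFi) (integrable_deriv_test_mul χ hGi), h1,
      integral_deriv_mul_primitive hT hg, add_neg_cancel]
  have hc' : (fun t ↦ F t + ∫ s in (0 : ℝ)..t, g s) =ᵐ[volume.restrict (Icc 0 T)] fun _ ↦ c := by
    rwa [← Measure.restrict_congr_set (Ioo_ae_eq_Icc (a := (0 : ℝ)) (b := T))]
  have heq := Measure.eqOn_Icc_of_ae_eq volume hT.ne hc' (hF.add hGc) continuousOn_const
  intro t ht
  have h1 := heq ht
  have h2 := heq (left_mem_Icc.2 hT.le)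
  simp only [intervalIntegral.integral_same, add_zero] at h1 h2
  linarith

end TimeDerivative

/-! ### Weak solutions and the integrated equation -/

section Solution

section

variable {X : Type*} [NormedAddCommGroup X] [InnerProductSpace ℝ X] {T : ℝ}

theorem integrableOn_inner (z : Lp X 2 (timeMeasure T)) (y : X) :
    IntegrableOn (fun t ↦ inner ℝ (z t) y) (Ioo 0 T) :=
  (integrable_coeFn z).inner_const y

theorem inner_primitive [CompleteSpace X] {t : ℝ} (ht : t ∈ Icc 0 T) (z : Lp X 2 (timeMeasure T))
    (y : X) : inner ℝ (primitive X T t z) y = ∫ s in (0 : ℝ)..t, inner ℝ (z s) y := by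
  have hz : IntervalIntegrable z volume 0 t :=
    (intervalIntegrable_iff_integrableOn_Ioo_of_le ht.1).2
      (IntegrableOn.mono_set (integrable_coeFn z) (Ioo_subset_Ioo_right ht.2))
  rw [primitive_eq_integral ae_eq_rfl ht, real_inner_comm]
  simp only [real_inner_comm y]
  exact ((innerSL ℝ y).intervalIntegral_comp_comm hz).symm

end

variable {d : ℕ} {E : Type*} [NormedAddCommGroup E] [InnerProductSpace ℝ E] [CompleteSpace E]
  (S : SobolevModel d E) {T : ℝ}

/-- The identity `(μ + A₀)⁻¹ r = (μ + A₀)⁻¹ r₀ - ∫₀ᵗ z` in `L²` can be tested with the range of the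
formal adjoint of `μ + A₀`, where it becomes an identity for `r` itself. -/
theorem SobolevModel.incl_eq_sub_primitive_iff {a : Fin d → Fin d → W1Infty d} {μ : ℝ}
    {N : E →L[ℝ] E} (hK : ∀ p, S.energyOp a μ (N p) = p) (hd : DenseRange (formalAdjoint a μ))
    {t : ℝ} (ht : t ∈ Icc 0 T) (z : Lp (L2 d) 2 (timeMeasure T)) (r r₀ : E) :
    S.incl (N r) = S.incl (N r₀) - primitive (L2 d) T t z ↔
      ∀ φ, inner ℝ r (S.test φ) = inner ℝ r₀ (S.test φ) -
        ∫ s in (0 : ℝ)..t, inner ℝ (z s) (formalAdjoint a μ φ) := by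
  have h : ∀ r φ, inner ℝ (S.incl (N r)) (formalAdjoint a μ φ) = inner ℝ r (S.test φ) :=
    fun r φ ↦ by rw [← S.inner_energyOp_test, hK]
  have h2 : ∀ φ, inner ℝ (S.incl (N r₀) - primitive (L2 d) T t z) (formalAdjoint a μ φ) =
      inner ℝ r₀ (S.test φ) - ∫ s in (0 : ℝ)..t, inner ℝ (z s) (formalAdjoint a μ φ) := fun φ ↦ by
    rw [inner_sub_left, h, inner_primitive ht]
  refine ⟨fun h1 φ ↦ by rw [← h, h1, h2], fun h1 ↦ ?_⟩
  refine ext_inner_right ℝ fun y ↦ ?_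
  exact hd.induction_on (p := fun y ↦ inner ℝ (S.incl (N r)) y =
    inner ℝ (S.incl (N r₀) - primitive (L2 d) T t z) y) y
    (isClosed_eq (by fun_prop) (by fun_prop)) fun φ ↦ by rw [h, h2, h1]

/-- A criterion for `HasTimeDeriv` in integrated form, one test function of `ℝᵈ` at a time. -/
theorem hasTimeDeriv_of_ae_eq (hT : 0 < T) {v : ℝ → L2 d} {g : ℝ → Distr d}
    (h : ∀ φ : Test d, ∃ c : ℝ, ∃ k : ℝ → ℝ, IntegrableOn k (Ioo 0 T) ∧
      (∀ᵐ t ∂(timeMeasure T), inner ℝ (v t) (testL2 φ) = c - ∫ s in (0 : ℝ)..t, k s) ∧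
      ∀ᵐ t ∂(timeMeasure T), g t φ = -k t) : HasTimeDeriv T v g := by
  intro χ φ
  obtain ⟨c, k, hk, hv, hg⟩ := h φ
  have hG : IntegrableOn (fun t ↦ ∫ s in (0 : ℝ)..t, k s) (Ioo 0 T) :=
    (continuousOn_integral hT hk).integrableOn_Icc.mono_set Ioo_subset_Icc_self
  have h1 : ∫ t in Ioo 0 T, deriv (⇑χ) t * regular (⇑(v t)) φ =
      ∫ t in Ioo 0 T, (deriv χ t * c - deriv χ t * ∫ s in (0 : ℝ)..t, k s) :=
    integral_congr_ae (hv.mono fun t ht ↦ by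
      simp only [regular_coeFn_apply, ht, mul_sub])
  have h2 : ∫ t in Ioo 0 T, χ t * g t φ = ∫ t in Ioo 0 T, -(χ t * k t) :=
    integral_congr_ae (hg.mono fun t ht ↦ by simp only [ht, mul_neg])
  rw [h1, h2, integral_sub (integrable_deriv_test_mul χ (integrableOn_const (by simp)))
    (integrable_deriv_test_mul χ hG), integral_mul_const, integral_deriv_test hT,
    integral_deriv_mul_primitive hT hk, integral_neg]
  ring

/-- `IsWeakSolution` for curves in an abstract model `E` of `H¹`, identified with its dual. -/
def SobolevModel.IsSolution (T : ℝ) (hT : 0 < T) (a : Fin d → Fin d → W1Infty d)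
    (f : Space d → Space d) (u : ℝ → Space d → ℝ) (r₀ : E) (r : C(Icc (0 : ℝ) T, E)) : Prop :=
  r ⟨0, left_mem_Icc.2 hT.le⟩ = r₀ ∧ ∃ v w : Lp (L2 d) 2 (timeMeasure T),
    (∀ᵐ t : ℝ, ∀ ht : t ∈ Ioo 0 T, r ⟨t, Ioo_subset_Icc_self ht⟩ = S.inclAdj (v t)) ∧
    HasTimeDeriv T (⇑v) (fun t ↦ idAddA0 a (w t)) ∧
    ∀ᵐ t ∂(timeMeasure T), idAddA0 a (w t) + opA a f (u t) (v t) = 0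

/-- The family `S.evolutionFamily` is `(μ + A₀)⁻¹ A(t)` in the weak sense. -/
theorem SobolevModel.inner_evolutionFamily (a : Fin d → Fin d → W1Infty d) (μ : ℝ) {N : E →L[ℝ] E}
    (hK : ∀ p, S.energyOp a μ (N p) = p) {f : Space d → Space d}
    (hf : ∀ i, MemLp (fun x ↦ f x i) ∞ volume) {g : ℝ × Space d → ℝ} (hg : StronglyMeasurable g)
    {b : ℝ} (hb : ∀ p, |g p| ≤ b) (t : ℝ) (v : L2 d) (φ : Test d) :
    inner ℝ ((S.evolutionFamily a μ N f (mulFamily g hg b hb)).op t v) (formalAdjoint a μ φ) =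
      opA a f (fun x ↦ g (t, x)) v φ := by
  rw [opA_apply a hf (memLp_section hg hb t)]
  exact S.inner_evolutionOp a μ hK f _ v φ

theorem opA_symmPart (a : Fin d → Fin d → W1Infty d) {f : Space d → Space d}
    (hf : ∀ i, MemLp (fun x ↦ f x i) ∞ volume) {ut : Space d → ℝ} (hut : MemLp ut ∞ volume)
    (v : L2 d) (φ : Test d) : opA (symmPart a) f ut v φ = opA a f ut v φ := by
  rw [opA_apply _ hf hut, opA_apply _ hf hut, sum_inner_symmPart]

/-- Reformulation of the weak equation as an integrated equation in `L²`. -/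
theorem SobolevModel.IsSolution.incl_eq {S : SobolevModel d E} {hT : 0 < T}
    {a : Fin d → Fin d → W1Infty d} {f : Space d → Space d} {u : ℝ → Space d → ℝ} {r₀ : E}
    {r : C(Icc (0 : ℝ) T, E)} (h : S.IsSolution T hT a f u r₀ r) {s : Fin d → Fin d → W1Infty d}
    {μ : ℝ} {N : E →L[ℝ] E} (hK : ∀ p, S.energyOp s μ (N p) = p)
    (hd : DenseRange (formalAdjoint s μ)) (M : OpFamily (L2 d))
    (hM : ∀ᵐ t ∂(timeMeasure T), ∀ v φ, inner ℝ (M.op t v) (formalAdjoint s μ φ) =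
      opA a f (u t) v φ) :
    ∃ v : Lp (L2 d) 2 (timeMeasure T),
      (∀ᵐ t ∂(timeMeasure T), ∀ ht : t ∈ Icc 0 T, r ⟨t, ht⟩ = S.inclAdj (v t)) ∧
      ∀ t : Icc (0 : ℝ) T, S.incl (N (r t)) =
        S.incl (N r₀) - primitive (L2 d) T t (M.mul T v) := by
  obtain ⟨h0, v, w, hv, hder, heq⟩ := h
  have hv' : ∀ᵐ t ∂(timeMeasure T), ∀ ht : t ∈ Icc 0 T, r ⟨t, ht⟩ = S.inclAdj (v t) := by
    rw [ae_restrict_iff' measurableSet_Ioo]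
    filter_upwards [hv] with t ht htm _
    exact ht htm
  refine ⟨v, hv', fun t ↦ (S.incl_eq_sub_primitive_iff hK hd t.2 _ _ _).2 fun φ ↦ ?_⟩
  have key := eq_sub_integral_of_weak_deriv hT
    (F := fun t ↦ inner ℝ (r (projIcc 0 T hT.le t)) (S.test φ))
    (h := fun t ↦ inner ℝ (v t) (testL2 φ))
    (g := fun t ↦ inner ℝ (M.mul T v t) (formalAdjoint s μ φ))
    (Continuous.continuousOn (by fun_prop)) ?_ (integrableOn_inner _ _) (fun χ ↦ ?_) t t.2
  · simp only [projIcc_val, projIcc_left] at key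
    rw [key, h0]
  · filter_upwards [hv', ae_restrict_mem measurableSet_Ioo] with t ht htm
    rw [projIcc_of_mem hT.le (Ioo_subset_Icc_self htm), ht (Ioo_subset_Icc_self htm),
      S.inner_inclAdj, S.incl_test]
  · have h1 := hder χ φ
    simp only [regular_coeFn_apply] at h1
    rw [h1, ← integral_neg]
    refine integral_congr_ae ?_
    filter_upwards [heq, hM, M.coeFn_mul v] with t h2 h3 h4
    have h5 : idAddA0 a (w t) φ + opA a f (u t) (v t) φ = 0 := by
      rw [← add_apply, h2, zero_apply]
    rw [h4, h3, eq_neg_of_add_eq_zero_left h5]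
    ring

theorem SobolevModel.IsSolution.unique {S : SobolevModel d E} {hT : 0 < T}
    {a : Fin d → Fin d → W1Infty d} {f : Space d → Space d} {u : ℝ → Space d → ℝ} {r₀ : E}
    {r r' : C(Icc (0 : ℝ) T, E)} (h : S.IsSolution T hT a f u r₀ r)
    (h' : S.IsSolution T hT a f u r₀ r') {s : Fin d → Fin d → W1Infty d}
    {μ : ℝ} {N : E →L[ℝ] E} (hK : ∀ p, S.energyOp s μ (N p) = p)
    (hN : ∀ p q, inner ℝ (N p) q = inner ℝ p (N q)) {κ : ℝ} (hκ : 0 < κ)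
    (hNκ : ∀ p, κ * ‖p‖ ^ 2 ≤ inner ℝ (N p) p)
    (hd : DenseRange (formalAdjoint s μ)) (M : OpFamily (L2 d))
    (hM : ∀ᵐ t ∂(timeMeasure T), ∀ v φ, inner ℝ (M.op t v) (formalAdjoint s μ φ) =
      opA a f (u t) v φ) {c l : ℝ} (hc : 0 < c) (hl : 0 ≤ l)
    (hMc : ∀ t x, c * ‖x‖ ^ 2 ≤
      inner ℝ (M.op t x) x + l * inner ℝ (N (S.inclAdj x)) (S.inclAdj x)) : r = r' := by
  obtain ⟨v, hv, hr⟩ := h.incl_eq hK hd M hM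
  obtain ⟨v', hv', hr'⟩ := h'.incl_eq hK hd M hM
  set G : L2 d →L[ℝ] L2 d := S.incl ∘L N ∘L S.inclAdj
  have hG : ∀ x y, inner ℝ (G x) y = inner ℝ (N (S.inclAdj x)) (S.inclAdj y) := fun x y ↦ by
    rw [real_inner_comm (S.inclAdj y), S.inner_inclAdj, real_inner_comm]
    rfl
  have hvv : v - v' = 0 := by
    refine eq_zero_of_compLpL_add_volterra_mul_eq_zero hT M G (fun x y ↦ ?_) (fun x hx ↦ ?_) hc hl
      (fun t x ↦ by rw [hG]; exact hMc t x) _ ?_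
    · rw [hG, real_inner_comm (G y), hG, hN, real_inner_comm]
    · have : 0 < ‖S.inclAdj x‖ :=
        norm_pos_iff.2 ((map_ne_zero_iff _ S.injective_inclAdj).2 hx)
      rw [hG]
      exact lt_of_lt_of_le (by positivity) (hNκ _)
    · refine Lp.ext ?_
      filter_upwards [Lp.coeFn_add (G.compLpL 2 (timeMeasure T) (v - v'))
        (volterra (L2 d) T (M.mul T (v - v'))), Lp.coeFn_zero (L2 d) 2 (timeMeasure T),
        G.coeFn_compLpL (v - v'), coeFn_volterra (M.mul T (v - v')), Lp.coeFn_sub v v', hv, hv',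
        ae_restrict_mem measurableSet_Ioo] with t h1 h2 h3 h4 h5 h6 h7 htm
      have ht := Ioo_subset_Icc_self htm
      have h8 : ∀ x, G x = S.incl (N (S.inclAdj x)) := fun x ↦ rfl
      rw [h1, h2, Pi.add_apply, h3, h4, h5, Pi.sub_apply, map_sub, h8, h8, ← h6 ht, ← h7 ht,
        hr, hr', map_sub, map_sub, Pi.zero_apply]
      abel
  have hvv' : v = v' := sub_eq_zero.1 hvv
  ext1 t
  have h1 : S.incl (N (r t)) = S.incl (N (r' t)) := by rw [hr, hr', hvv']
  have h2 : N (r t) = N (r' t) := by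
    rw [← sub_eq_zero]
    exact S.eq_zero_of_incl_eq_zero _ (by rw [map_sub, h1, sub_self])
  rw [← hK (r t), h2, hK]

end Solution

/-! ### Well-posedness in the Sobolev model -/

section Existence

theorem inner_symm_of_rightInverse {E : Type*} [NormedAddCommGroup E]
    [InnerProductSpace ℝ E] {K N : E →L[ℝ] E}
    (hK : ∀ p q, inner ℝ (K p) q = inner ℝ p (K q)) (hN : ∀ p, K (N p) = p) (p q : E) :
    inner ℝ (N p) q = inner ℝ p (N q) := by
  rw [← hN q, ← hK, hN, hN]

variable {d : ℕ} {E : Type*} [NormedAddCommGroup E] [InnerProductSpace ℝ E] [CompleteSpace E]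
  (S : SobolevModel d E) {T : ℝ}

/-- The curve `r` given by an integrated equation in `L²` is a weak solution. -/
theorem SobolevModel.isSolution_of_incl_eq (hT : 0 < T) {a : Fin d → Fin d → W1Infty d}
    {f : Space d → Space d} {u : ℝ → Space d → ℝ} {r₀ : E} {r : C(Icc (0 : ℝ) T, E)}
    (h0 : r ⟨0, left_mem_Icc.2 hT.le⟩ = r₀) {s : Fin d → Fin d → W1Infty d}
    {μ : ℝ} {N : E →L[ℝ] E} (hK : ∀ p, S.energyOp s μ (N p) = p)
    (hd : DenseRange (formalAdjoint s μ)) (M : OpFamily (L2 d))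
    (hM : ∀ᵐ t ∂(timeMeasure T), ∀ v φ, inner ℝ (M.op t v) (formalAdjoint s μ φ) =
      opA a f (u t) v φ) (M' : OpFamily (L2 d))
    (hM' : ∀ᵐ t ∂(timeMeasure T), ∀ v φ, inner ℝ (M'.op t v) (formalAdjoint a 1 φ) =
      opA a f (u t) v φ)
    {v : Lp (L2 d) 2 (timeMeasure T)}
    (hv : ∀ᵐ t ∂(timeMeasure T), ∀ ht : t ∈ Icc 0 T, r ⟨t, ht⟩ = S.inclAdj (v t))
    (hr : ∀ t : Icc (0 : ℝ) T, S.incl (N (r t)) =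
      S.incl (N r₀) - primitive (L2 d) T t (M.mul T v)) :
    S.IsSolution T hT a f u r₀ r := by
  have hw : ∀ᵐ t ∂(timeMeasure T), ∀ φ,
      idAddA0 a ((-M'.mul T v : Lp (L2 d) 2 (timeMeasure T)) t) φ = -opA a f (u t) (v t) φ := by
    filter_upwards [Lp.coeFn_neg (M'.mul T v), M'.coeFn_mul v, hM'] with t h1 h2 h3 φ
    rw [idAddA0_apply, h1, Pi.neg_apply, h2, inner_neg_left, h3]
  refine ⟨h0, v, -M'.mul T v, ?_, hasTimeDeriv_of_ae_eq hT fun φ ↦ ⟨inner ℝ r₀ (S.test φ),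
    fun t ↦ inner ℝ (M.mul T v t) (formalAdjoint s μ φ), integrableOn_inner _ _, ?_, ?_⟩, ?_⟩
  · rw [ae_restrict_iff' measurableSet_Ioo] at hv
    filter_upwards [hv] with t ht htm
    exact ht htm _
  · filter_upwards [hv, ae_restrict_mem measurableSet_Ioo] with t ht htm
    have h1 := (S.incl_eq_sub_primitive_iff hK hd (Ioo_subset_Icc_self htm) _ _ _).1
      (hr ⟨t, Ioo_subset_Icc_self htm⟩) φ
    rwa [ht (Ioo_subset_Icc_self htm), S.inner_inclAdj, S.incl_test] at h1
  · filter_upwards [hw, hM, M.coeFn_mul v] with t h1 h2 h3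
    rw [h1, h3, h2]
  · filter_upwards [hw] with t ht
    ext φ
    rw [add_apply, ht, neg_add_cancel, zero_apply]

/-- Here the symmetric part of `a` and a large `μ` govern the evolution, while `a` itself and the
constant `1` enter in the representation `(I + A₀) w` of the time derivative. -/
theorem SobolevModel.existsUnique_isSolution (hT : 0 < T) {γ₀ γ₁ γ₂ : ℝ}
    (hγ₀ : 0 < γ₀) (hγ₁ : 0 < γ₁) (hγ₁₂ : γ₁ ≤ γ₂) {u : ℝ → Space d → ℝ}
    (hu_meas : AEStronglyMeasurable (fun p : ℝ × Space d ↦ u p.1 p.2)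
      ((timeMeasure T).prod volume))
    (hu_bound : ∀ᵐ p : ℝ × Space d ∂((timeMeasure T).prod volume),
      γ₁ ≤ u p.1 p.2 ∧ u p.1 p.2 ≤ γ₂)
    {a : Fin d → Fin d → W1Infty d}
    (ha : ∀ᵐ x : Space d, ∀ ξ : Space d,
      γ₀ * ‖ξ‖ ^ 2 ≤ ∑ i, ∑ j, (a i j).val x * ξ i * ξ j)
    {f : Space d → Space d} (hf : MemLp f ∞ volume) (r₀ : E) :
    ∃! r : C(Icc (0 : ℝ) T, E), S.IsSolution T hT a f u r₀ r := by
  have hfi : ∀ i, MemLp (fun x ↦ f x i) ∞ volume := fun i ↦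
    hf.of_le ((EuclideanSpace.proj (𝕜 := ℝ) i).continuous.comp_aestronglyMeasurable hf.1)
      (ae_of_all _ fun x ↦ PiLp.norm_apply_le (f x) i)
  obtain ⟨g, hg, hgb, hug⟩ := exists_bounded_version hγ₁₂ hu_meas hu_bound
  have hb : ∀ p, |g p| ≤ γ₂ := fun p ↦ abs_le.2 ⟨by linarith [(hgb p).1, (hgb p).2], (hgb p).2⟩
  have hγ₂ : 0 < γ₂ := hγ₁.trans_le hγ₁₂
  have hs := symmPart_elliptic ha
  obtain ⟨μ₀, hμ₀⟩ := exists_denseRange_formalAdjoint hγ₀ hs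
  set μ := max μ₀ 1
  have hμ : 0 < min μ γ₀ := lt_min (zero_lt_one.trans_le (le_max_right _ _)) hγ₀
  have hd := hμ₀ μ (le_max_left _ _)
  have hKc := S.energyOp_coercive hs μ
  obtain ⟨N, hK⟩ := exists_inverse_of_coercive (S.energyOp (symmPart a) μ) hμ hKc
  obtain ⟨N', hK'⟩ := exists_inverse_of_coercive (S.energyOp a 1) (lt_min one_pos hγ₀)
    (S.energyOp_coercive ha 1)
  have hN := inner_symm_of_rightInverse (S.energyOp_symm (symmPart a) (symmPart_swap a) μ) hK
  obtain ⟨κ, hκ, hNκ⟩ := inverse_coercive _ N hμ hKc hK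
  obtain ⟨l, hl, hcoer⟩ := S.exists_evolutionOp_coercive (symmPart a) μ hN hκ hNκ f hγ₁ hγ₂.le
  set U := mulFamily g hg γ₂ hb
  set M := S.evolutionFamily (symmPart a) μ N f U
  have hMc : ∀ t x, γ₁ / 4 * ‖x‖ ^ 2 ≤
      inner ℝ (M.op t x) x + l * inner ℝ (N (S.inclAdj x)) (S.inclAdj x) := fun t x ↦ by
    refine hcoer (U.op t) (fun v ↦ ?_) (U.norm_apply_le t) x
    change γ₁ * ‖v‖ ^ 2 ≤ inner ℝ (mulL (fun x ↦ g (t, x)) v) v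
    have hvv : Integrable fun x ↦ v x * v x := (Lp.memLp v).integrable_mul (Lp.memLp v)
    rw [inner_mulL_left (memLp_section hg hb t), ← real_inner_self_eq_norm_sq, L2.inner_def,
      ← integral_const_mul]
    refine integral_mono_ae (hvv.const_mul γ₁) ?_ (ae_of_all _ fun x ↦ ?_)
    · simp only [mul_assoc]
      exact hvv.bdd_mul (hg.comp_measurable measurable_prodMk_left).aestronglyMeasurable
        (ae_of_all _ fun x ↦ hb (t, x))
    · simp only [mul_assoc]
      exact mul_le_mul_of_nonneg_right (hgb (t, x)).1 (mul_self_nonneg _)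
  have hut : ∀ᵐ t ∂(timeMeasure T), ∀ v, opA a f (fun x ↦ g (t, x)) v = opA a f (u t) v := by
    filter_upwards [hug] with t ht v
    exact (opA_congr a (memLp_section hg hb t) ht v).symm
  have hM : ∀ᵐ t ∂(timeMeasure T), ∀ v φ,
      inner ℝ (M.op t v) (formalAdjoint (symmPart a) μ φ) = opA a f (u t) v φ := by
    filter_upwards [hut] with t ht v φ
    rw [S.inner_evolutionFamily _ μ hK hfi hg hb, opA_symmPart a hfi (memLp_section hg hb t), ht]
  have hM' : ∀ᵐ t ∂(timeMeasure T), ∀ v φ,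
      inner ℝ ((S.evolutionFamily a 1 N' f U).op t v) (formalAdjoint a 1 φ) =
        opA a f (u t) v φ := by
    filter_upwards [hut] with t ht v φ
    rw [S.inner_evolutionFamily _ 1 hK' hfi hg hb, ht]
  obtain ⟨r, h0, v, hv, hr⟩ := exists_evolution hT M S.inclAdj S.denseRange_inclAdj
    S.injective_inclAdj N hN hκ hNκ (by positivity) hl hMc r₀
  rw [S.adjoint_inclAdj] at hr
  exact ⟨r, S.isSolution_of_incl_eq hT h0 hK hd M hM _ hM' hv hr, fun r' hr' ↦
    hr'.unique (S.isSolution_of_incl_eq hT h0 hK hd M hM _ hM' hv hr) hK hN hκ hNκ hd M hM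
      (by positivity) hl hMc⟩

end Existence

/-! ### The space `H¹` and its dual -/

section H1Space

variable {d : ℕ}

theorem mem_H1_iff (p : WithLp 2 (L2 d × PiLp 2 (fun _ : Fin d ↦ L2 d))) :
    p ∈ H1 d ↔ ∀ i φ, inner ℝ (p.snd i) (testL2 φ) = -inner ℝ p.fst (testL2 (pd i φ)) := by
  change (∀ i, partialD i (regular (⇑p.fst)) = regular (⇑(p.snd i))) ↔ _
  refine forall_congr' fun i ↦ ⟨fun h φ ↦ ?_, fun h ↦ ?_⟩
  · rw [← regular_coeFn_apply, ← regular_coeFn_apply, ← h, partialD_apply]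
  · ext φ
    change partialD i (regular (⇑p.fst)) φ = regular (⇑(p.snd i)) φ
    rw [partialD_apply, regular_coeFn_apply, regular_coeFn_apply, h]

instance completeSpace_H1 (d : ℕ) : CompleteSpace (H1 d) := by
  have h : IsClosed ((H1 d : Submodule ℝ _) :
      Set (WithLp 2 (L2 d × PiLp 2 (fun _ : Fin d ↦ L2 d)))) := by
    have : ((H1 d : Submodule ℝ _) : Set (WithLp 2 (L2 d × PiLp 2 (fun _ : Fin d ↦ L2 d)))) =
        ⋂ i, ⋂ φ : Test d, {p | inner ℝ (p.snd i) (testL2 φ) =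
          -inner ℝ p.fst (testL2 (pd i φ))} := by
      ext p
      simp only [SetLike.mem_coe, mem_H1_iff, mem_iInter, mem_ofPred_eq]
    rw [this]
    exact isClosed_iInter fun i ↦ isClosed_iInter fun φ ↦ isClosed_eq (by fun_prop) (by fun_prop)
  exact h.completeSpace_coe

/-- `H¹(ℝᵈ)` itself, as a `SobolevModel`. -/
def sobolevModel (d : ℕ) : SobolevModel d (H1 d) where
  incl := (WithLp.fstL 2 ℝ (L2 d) (PiLp 2 (fun _ : Fin d ↦ L2 d))).comp (H1 d).subtypeL
  weakD i := (PiLp.proj 2 (fun _ : Fin d ↦ L2 d) i).comp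
    ((WithLp.sndL 2 ℝ (L2 d) (PiLp 2 (fun _ : Fin d ↦ L2 d))).comp (H1 d).subtypeL)
  test :=
    { toFun := testH1
      map_add' := fun φ ψ ↦ by
        refine Subtype.ext ?_
        simp only [testH1, map_add]
        rfl
      map_smul' := fun c φ ↦ by
        refine Subtype.ext ?_
        simp only [testH1, map_smul]
        rfl }
  inner_eq _ _ := rfl
  inner_weakD i p φ := (mem_H1_iff _).1 p.2 i φ
  incl_test _ := rfl
  weakD_test _ _ := rfl

/-- Under the Riesz isomorphism `H¹ ≅ H⁻¹`, the adjoint of the inclusion `H¹ ⊂ L²` is the embedding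
`L² ⊂ H⁻¹`. -/
theorem toDual_inclAdj (v : L2 d) :
    InnerProductSpace.toDual ℝ (H1 d) ((sobolevModel d).inclAdj v) = toHNegOne v := by
  ext p
  rw [InnerProductSpace.toDual_apply_apply, (sobolevModel d).inner_inclAdj]
  rfl

/-- Composition of curves with the Riesz isomorphism. -/
def rieszCurve (d : ℕ) (T : ℝ) : C(Icc (0 : ℝ) T, H1 d) ≃ C(Icc (0 : ℝ) T, HNegOne d) where
  toFun r := ⟨fun t ↦ InnerProductSpace.toDual ℝ (H1 d) (r t),
    (InnerProductSpace.toDual ℝ (H1 d)).continuous.comp r.continuous⟩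
  invFun ρ := ⟨fun t ↦ (InnerProductSpace.toDual ℝ (H1 d)).symm (ρ t),
    (InnerProductSpace.toDual ℝ (H1 d)).symm.continuous.comp ρ.continuous⟩
  left_inv r := by ext1 t; exact LinearIsometryEquiv.symm_apply_apply _ _
  right_inv ρ := by ext1 t; exact LinearIsometryEquiv.apply_symm_apply _ _

theorem isWeakSolution_rieszCurve_iff {T : ℝ} (hT : 0 < T) (a : Fin d → Fin d → W1Infty d)
    (f : Space d → Space d) (u : ℝ → Space d → ℝ) (r₀ : H1 d) (r : C(Icc (0 : ℝ) T, H1 d)) :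
    IsWeakSolution T hT a f u (InnerProductSpace.toDual ℝ (H1 d) r₀) (rieszCurve d T r) ↔
      (sobolevModel d).IsSolution T hT a f u r₀ r := by
  have h : ∀ (t : Icc (0 : ℝ) T) (v : L2 d), rieszCurve d T r t = toHNegOne v ↔
      r t = (sobolevModel d).inclAdj v := fun t v ↦ by
    rw [← toDual_inclAdj]
    exact (InnerProductSpace.toDual ℝ (H1 d)).injective.eq_iff
  constructor
  · rintro ⟨h0, v, w, hv, hder, heq⟩
    exact ⟨(InnerProductSpace.toDual ℝ (H1 d)).injective h0, v, w,
      hv.mono fun t ht htm ↦ (h _ _).1 (ht htm), hder, heq⟩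
  · rintro ⟨h0, v, w, hv, hder, heq⟩
    exact ⟨congrArg (InnerProductSpace.toDual ℝ (H1 d)) h0, v, w,
      hv.mono fun t ht htm ↦ (h _ _).2 (ht htm), hder, heq⟩

end H1Space

end FokkerPlanck

end

theorem mainTheorem3 {d : ℕ} (T : ℝ) (hT : 0 < T) (γ₀ γ₁ γ₂ : ℝ)
    (hγ₀ : 0 < γ₀) (hγ₁ : 0 < γ₁) (hγ₁₂ : γ₁ < γ₂)
    (u : ℝ → FokkerPlanck.Space d → ℝ)
    (hu_meas : MeasureTheory.AEStronglyMeasurable (fun p : ℝ × FokkerPlanck.Space d ↦ u p.1 p.2)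
      ((MeasureTheory.volume.restrict (Set.Ioo 0 T)).prod MeasureTheory.volume))
    (hu_bound : ∀ᵐ p : ℝ × FokkerPlanck.Space d
      ∂((MeasureTheory.volume.restrict (Set.Ioo 0 T)).prod MeasureTheory.volume),
      γ₁ ≤ u p.1 p.2 ∧ u p.1 p.2 ≤ γ₂)
    (a : Fin d → Fin d → FokkerPlanck.W1Infty d)
    (ha : ∀ᵐ x : FokkerPlanck.Space d, ∀ ξ : FokkerPlanck.Space d,
      γ₀ * ‖ξ‖ ^ 2 ≤ ∑ i, ∑ j, (a i j).val x * ξ i * ξ j)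
    (f : FokkerPlanck.Space d → FokkerPlanck.Space d)
    (hf : MeasureTheory.MemLp f ⊤ MeasureTheory.volume)
    (ρ₀ : FokkerPlanck.HNegOne d) :
    ∃! ρ : C(Set.Icc (0 : ℝ) T, FokkerPlanck.HNegOne d),
      FokkerPlanck.IsWeakSolution T hT a f u ρ₀ ρ := by
  obtain ⟨r₀, rfl⟩ := (InnerProductSpace.toDual ℝ (FokkerPlanck.H1 d)).surjective ρ₀
  obtain ⟨r, hr, hunique⟩ := (FokkerPlanck.sobolevModel d).existsUnique_isSolution hT hγ₀ hγ₁
    hγ₁₂.le hu_meas hu_bound ha hf r₀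
  refine ⟨FokkerPlanck.rieszCurve d T r,
    (FokkerPlanck.isWeakSolution_rieszCurve_iff hT a f u r₀ r).2 hr, fun ρ hρ ↦ ?_⟩
  obtain ⟨r', rfl⟩ := (FokkerPlanck.rieszCurve d T).surjective ρ
  rw [hunique r' ((FokkerPlanck.isWeakSolution_rieszCurve_iff hT a f u r₀ r').1 hρ)]
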